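/- Let $S$ be a finite set of time series, and let $\mathcal V^f = S\times\mathbb Z$ be the set of variables $s_t$ (series $s$ at time $t$), where each variable $v$ takes values in a countable discrete set $\Omega_v$ with at least two elements. **Graphs.** A *full time causal graph* (FTCG) is a directed acyclic graph on $\mathcal V^f$ without edges that go backward in time (variables may have infinitely many parents). A directed graph $\mathcal G^s$ on $S$ (cycles and self-loops allowed) is the *summary causal graph* (SCG) of an FTCG $\mathcal G^f$ if, for all $a,b\in S$: $a\to b$ in $\mathcal G^s$ if and only if $a_{t-\gamma}\to b_t$ in $\mathcal G^f$ for some $t\in\mathbb Z$ and $\gamma\ge 0$. Then $\mathcal G^f$ is a *candidate FTCG* of $\mathcal G^s$; $\mathcal C(\mathcal G^s)$ is the set of all of them. **Criterion.** A path is a sequence of distinct vertices, each joined to the next one by an edge in either direction; it is *causal* if all edges point towards its last vertex. A path from $\mathbf X$ to $\mathbf Y$ is *proper* if only its first vertex is in $\mathbf X$. $\mathbf Z$ *blocks* a path if a non-collider of the path is in $\mathbf Z$, or if some collider of the path has no descendant in $\mathbf Z$ (a vertex is a descendant of itself). $\mathbf Z$ satisfies the *adjustment criterion* relative to $\mathbf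 X$ and $\mathbf Y$ in $\mathcal G^f$ if (1) $\mathbf Z$ contains no descendant of any $W\notin\mathbf X$ on a proper causal path from $\mathbf X$ to $\mathbf Y$, and (2) $\mathbf Z$ blocks all proper non-causal paths from $\mathbf X$ to $\mathbf Y$. $\mathbf Z$ satisfies the *common adjustment criterion* relative to $\mathbf X$ and $\mathbf Y$ in $\mathcal G^s$ if it satisfies the adjustment criterion in every $\mathcal G^f\in\mathcal C(\mathcal G^s)$. **Distributions.** A probability distribution $P$ on $\prod_v\Omega_v$ is *compatible* with an FTCG $\mathcal G^f$, with conditional distributions $P(v\mid \mathrm{pa}(v))$ of the variables given their parents, if (a) for all times $a\le b$, given the variables before time $a$, the joint distribution of the variables at times $a,\dots,b$ is the product of their factors $P(v\mid\mathrm{pa}(v))$, and (b) disjoint sets of variables that are closed under taking parents are independent (for variables with finitely many ancestors, (b) follows from (a)). For finite disjoint $\mathbf X,\mathbf Y$, $P(\mathbf y\mid \mathrm{do}(\mathbf x))$ is given by the truncated factorization: the variables before the earliest time in $\mathbf X\cup\mathbf Y$ keep their distribution, $\mathbf X$ is set to $\mathbf x$, and the other variables are drawn from their factors $P(v\mid\mathrm{pa}(v))$.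 $P$ is compatible with $\mathcal G^s$ if it is compatible with some $\mathcal G^f\in\mathcal C(\mathcal G^s)$. **Proposition.** Let $\mathcal G^s$ be an SCG and let $\mathbf X,\mathbf Y,\mathbf Z\subseteq\mathcal V^f$ be finite and pairwise disjoint. The following are equivalent: (i) $\mathbf Z$ satisfies the common adjustment criterion relative to $\mathbf X$ and $\mathbf Y$ in $\mathcal G^s$; (ii) for every $P$ compatible with $\mathcal G^s$ (with the interventional distribution of any $\mathcal G^f\in\mathcal C(\mathcal G^s)$ and any conditional distributions $P(v\mid \mathrm{pa}(v))$ with which $P$ is compatible), all values $\mathbf y$, and all values $\mathbf x$ for which the right-hand side is defined, i.e. $P(\mathbf x,\mathbf z)>0$ whenever $P(\mathbf z)>0$, $$P(\mathbf y\mid \mathrm{do}(\mathbf x))=\begin{cases}P(\mathbf y\mid\mathbf x) & \text{if }\mathbf Z=\emptyset,\\ \sum_{\mathbf z}P(\mathbf y\mid\mathbf x,\mathbf z)\,P(\mathbf z)&\text{otherwise,}\end{cases}$$ where the sum runs over the values $\mathbf z$ with $P(\mathbf z)>0$. -/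

import Mathlib

open MeasureTheory ProbabilityTheory
open scoped ENNReal

namespace SCGAdjustment

/-! ### Paths, blocking and the adjustment criterion in a directed graph -/

section Graph

variable {V : Type*}

/-- There is a directed path (possibly of length zero) from `u` to `v`. -/
def IsDescendant (G : Digraph V) (u v : V) : Prop :=
  Relation.ReflTransGen G.Adj u v

/-- No directed cycle. -/
def IsAcyclic (G : Digraph V) : Prop :=
  ∀ v, ¬ Relation.TransGen G.Adj v v

/-- A path: a nonempty sequence of distinct vertices, each joined to its successor by an edge, in
either direction. -/
def IsPath (G : Digraph V) (p : List V) : Prop :=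
  p ≠ [] ∧ p.Nodup ∧ p.IsChain (fun u v => G.Adj u v ∨ G.Adj v u)

/-- A causal (directed) path: all edges point towards the last vertex. -/
def IsCausalPath (G : Digraph V) (p : List V) : Prop :=
  IsPath G p ∧ p.IsChain G.Adj

/-- A path that is not causal. -/
def IsNonCausalPath (G : Digraph V) (p : List V) : Prop :=
  IsPath G p ∧ ¬ p.IsChain G.Adj

/-- The sequence `p` leads from `X` to `Y` and only its first vertex is in `X`. -/
def IsProperFromTo (X Y : Set V) (p : List V) : Prop :=
  ∃ (u : V) (q : List V), p = u :: q ∧ u ∈ X ∧ (∀ v ∈ q, v ∉ X) ∧ ∃ v ∈ p.getLast?, v ∈ Y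

/-- `v` is a collider on `p`: the path contains `u → v ← w`. -/
def IsColliderOn (G : Digraph V) (p : List V) (v : V) : Prop :=
  ∃ u w, [u, v, w] <:+: p ∧ G.Adj u v ∧ G.Adj w v

/-- `Z` blocks `p`: a non-collider of `p` is in `Z`, or some collider of `p` has no descendant
in `Z`. -/
def Blocks (G : Digraph V) (Z : Set V) (p : List V) : Prop :=
  (∃ v ∈ p, ¬ IsColliderOn G p v ∧ v ∈ Z) ∨
    ∃ v ∈ p, IsColliderOn G p v ∧ ∀ d, IsDescendant G v d → d ∉ Z

/-- The forbidden set: all descendants of any `w ∉ X` on a proper causal path from `X` to `Y`. -/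
def forbidden (G : Digraph V) (X Y : Set V) : Set V :=
  {d | ∃ w p, IsCausalPath G p ∧ IsProperFromTo X Y p ∧ w ∈ p ∧ w ∉ X ∧ IsDescendant G w d}

/-- The adjustment criterion relative to `X` and `Y` in `G`. -/
def AdjustmentCriterion (G : Digraph V) (X Y Z : Set V) : Prop :=
  forbidden G X Y ∩ Z = ∅ ∧
    ∀ p, IsNonCausalPath G p → IsProperFromTo X Y p → Blocks G Z p

/-- A set of vertices that contains all parents of its elements. -/
def IsAncestral (G : Digraph V) (A : Set V) : Prop :=
  ∀ u v, G.Adj u v → v ∈ A → u ∈ A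

end Graph

/-! ### Full time causal graphs and summary causal graphs -/

section Time

variable {S : Type*}

/-- A full time causal graph on the instances `(s, t)` of the time series `s : S` at times `t : ℤ`:
a directed acyclic graph in which no edge goes backward in time. -/
structure IsFTCG (G : Digraph (S × ℤ)) : Prop where
  acyclic : IsAcyclic G
  forward : ∀ u v, G.Adj u v → u.2 ≤ v.2

/-- `Gs` is the summary causal graph of `Gf`: `a → b` in `Gs` if and only if
`a_{t-γ} → b_t` in `Gf` for some time `t` and some lag `γ ≥ 0`. -/
def IsReducedFrom (Gs : Digraph S) (Gf : Digraph (S × ℤ)) : Prop :=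
  ∀ a b, Gs.Adj a b ↔ ∃ (t : ℤ) (γ : ℕ), Gf.Adj (a, t - γ) (b, t)

/-- The candidate full time causal graphs of a summary causal graph. Every directed graph on `S`
is the summary of at least one full time causal graph (take all the edges `a_{t-1} → b_t`). -/
def candidates (Gs : Digraph S) : Set (Digraph (S × ℤ)) :=
  {Gf | IsFTCG Gf ∧ IsReducedFrom Gs Gf}

/-- The common adjustment criterion relative to `X` and `Y` in `Gs`. -/
def CommonAdjustmentCriterion (Gs : Digraph S) (X Y Z : Set (S × ℤ)) : Prop :=
  ∀ Gf ∈ candidates Gs, AdjustmentCriterion Gf X Y Z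

/-- All variables with times between `a` and `b`. -/
noncomputable def window [Fintype S] (a b : ℤ) : Finset (S × ℤ) :=
  Finset.univ ×ˢ Finset.Icc a b

/-- All variables with times between the earliest and the latest time of a variable in `A`. -/
noncomputable def timeSpan [Fintype S] [DecidableEq S] (A : Finset (S × ℤ)) : Finset (S × ℤ) :=
  A.biUnion fun u => A.biUnion fun v => window u.2 v.2

end Time

/-! ### Compatible distributions and interventions -/

noncomputable section Prob

variable {S : Type*} {Ω : S × ℤ → Type*}

/-- The event that the variables in `A` take the values `a`. -/
def event (A : Finset (S × ℤ)) (a : ∀ v : A, Ω v) : Set (∀ v, Ω v) :=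
  {ω | ∀ v : A, ω v = a v}

/-- The configuration that equals `w` on `F` and `ω` elsewhere. -/
def splice [DecidableEq S] (F : Finset (S × ℤ)) (w : ∀ v : F, Ω v) (ω : ∀ v, Ω v) : ∀ v, Ω v :=
  fun v => if h : v ∈ F then w ⟨v, h⟩ else ω v

variable [∀ v, MeasurableSpace (Ω v)]

/-- A conditional distribution of each variable given the values of its parents in `G`. -/
abbrev Mechanisms (G : Digraph (S × ℤ)) (Ω : S × ℤ → Type*) [∀ v, MeasurableSpace (Ω v)] :=
  ∀ v, Kernel (∀ u : {u // G.Adj u v}, Ω u) (Ω v)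

/-- The product of the factors `κ_v(w_v | pa_v)` over `v ∈ F \ X`. Parents outside `F` have their
values in `ω`. -/
def factorProduct [DecidableEq S] {G : Digraph (S × ℤ)} (κ : Mechanisms G Ω)
    (X F : Finset (S × ℤ)) (w : ∀ v : F, Ω v) (ω : ∀ v, Ω v) : ℝ≥0∞ :=
  ∏ v : F, if (v : S × ℤ) ∈ X then 1 else κ v (fun u => splice F w ω u) {w v}

/-- The joint law `P` is compatible with (Markov relative to) `G`, with the conditional
distributions `κ` of the variables given their parents.

`factorization`: the joint probability of all variables in a window of time, together with any event
`B` of the variables before that window, is the product of the conditional probabilities of the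
variables in the window given their parents.

`indep_of_disjoint`: disjoint ancestral sets are independent. If every variable has finitely many
ancestors, this follows from the factorization. Here time has no beginning, and without this
condition two variables with no common ancestor could depend on each other through a hidden common
cause at time `-∞`: with two series and only the edges `s_{t-1} → s_t`, the law under which
all variables equal one and the same coin toss satisfies `factorization`. -/
structure IsCompatible [Fintype S] [DecidableEq S] (G : Digraph (S × ℤ)) (κ : Mechanisms G Ω)
    (P : Measure (∀ v, Ω v)) : Prop where
  isProbabilityMeasure : IsProbabilityMeasure P
  isMarkovKernel : ∀ v, IsMarkovKernel (κ v)
  factorization : ∀ (a b : ℤ) (B : Set (∀ v, Ω v)),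
    MeasurableSet[cylinderEvents {v : S × ℤ | v.2 < a}] B →
    ∀ w : ∀ v : (window a b : Finset (S × ℤ)), Ω v,
      P (B ∩ event (window a b) w) = ∫⁻ ω in B, factorProduct κ ∅ (window a b) w ω ∂P
  indep_of_disjoint : ∀ A B : Set (S × ℤ), IsAncestral G A → IsAncestral G B → Disjoint A B →
    Indep (cylinderEvents A) (cylinderEvents B) P

/-- The probability `P(y | do(x))`, by the truncated factorization. The variables before the
earliest time in `X ∪ Y` keep their law, the variables in `X` are set to `x`, and all others up to
the latest time in `X ∪ Y` are drawn from their conditional distributions given their parents. -/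
def doProb [Fintype S] [DecidableEq S] {G : Digraph (S × ℤ)} (κ : Mechanisms G Ω)
    (P : Measure (∀ v, Ω v)) (X Y : Finset (S × ℤ)) (x : ∀ v : X, Ω v) (y : ∀ v : Y, Ω v) : ℝ≥0∞ :=
  ∑' w : {w : ∀ v : timeSpan (X ∪ Y), Ω v //
      (∀ (v : timeSpan (X ∪ Y)) (h : (v : S × ℤ) ∈ X), w v = x ⟨v, h⟩) ∧
      (∀ (v : timeSpan (X ∪ Y)) (h : (v : S × ℤ) ∈ Y), w v = y ⟨v, h⟩)},
    ∫⁻ ω, factorProduct κ X (timeSpan (X ∪ Y)) w ω ∂P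

/-- The right-hand side of the adjustment formula: `P(y | x)` if `Z` is empty, and
`∑ z, P(y | x, z) P(z)` otherwise. -/
def adjustedProb [DecidableEq S] (P : Measure (∀ v, Ω v)) (X Y Z : Finset (S × ℤ))
    (x : ∀ v : X, Ω v) (y : ∀ v : Y, Ω v) : ℝ≥0∞ :=
  if Z = ∅ then cond P (event X x) (event Y y)
  else ∑' z : ∀ v : Z, Ω v, cond P (event X x ∩ event Z z) (event Y y) * P (event Z z)

/-- The conditional probabilities `P(y | x, z)` in the adjustment formula are defined: `(x, z)` has
positive probability for each value `z` of positive probability. -/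
def IsAdmissible (P : Measure (∀ v, Ω v)) (X Z : Finset (S × ℤ)) (x : ∀ v : X, Ω v) : Prop :=
  ∀ z : ∀ v : Z, Ω v, P (event Z z) ≠ 0 → P (event X x ∩ event Z z) ≠ 0

end Prob

end SCGAdjustment

open MeasureTheory ProbabilityTheory
open scoped ENNReal

set_option linter.unusedSectionVars false

namespace SCGAdjustment

/-! ### The proper back-door graph and separation by chains of common ancestors -/

section Separation

variable {V : Type*}

/-! The equivalence holds for each candidate graph `G` separately; the summary graph only selects
the graphs. Time has no beginning, so laws are handled through finite windows: `margProd` sums the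
product of the factors over a window, and what lies earlier is controlled by the independence of
disjoint ancestral sets.

Graphs. Let `H` be `backdoorGraph G X Y`. The adjustment criterion amounts to two conditions: no
element of `Z` descends from the second vertex of a proper causal path (`AvoidsForbidden`), and `Z`
separates `X` from `Y` in `H`. Separation is expressed without paths: `IsConnected` asks for a chain
t 0 ∈ Y, t 1, …, t k ∈ Z, t (k + 1) ∈ X in which neighbours have a common open ancestor. The link
with blocked paths is made by `not_isConnected_of_adjustmentCriterion` and
`adjustmentCriterion_of_not_isConnected`.

Sufficiency (`doProb_eq_adjustedProb`). Fix x and let causal nodes read x instead of the actual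
values of their parents in `X`. The modified law R factorizes over `H`. It gives `Y` the law under
do(x); it agrees with P on the event X = x; and it gives `Z` its law under P, because `Z` avoids the
forbidden set. By separation, R(x, y, z) = Φ(x) Ψ(y) for fixed z
(`exists_lintegral_margProd_eq_mul`), whence P(y | x, z) P(z) = Φ(1) Ψ(y) = R(y, z), and summation
over z gives the formula.

Necessity. The counterexamples are linear models over the field with two elements, given together
with their solutions because recursion over an infinite past is not available. The noise bits are 1
with probability 1/4; fair bits would in general not tell the two sides apart. If `X` and `Y` are
connected (`not_isConnected_of_forall`), take a shortest chain, put a noise bit at each common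
ancestor and pass it on along shortest paths to its two targets. Then t 0 = t (k + 1) + t 1 + … + t
k. Intervening on `X` does not affect t 0, so the left side at t 0 = 1 is 1/4, while the right side
at t (k + 1) = 1 is the probability that the elements of `Z` sum to 0, which is at least 1/2. If
they are separated but `Z` meets the forbidden set (`avoidsForbidden_of_forall`), some edge x → w
starts directed paths that avoid `X` and lead to both `Y` and `Z`. Let x be a noise bit and pass x
plus a second bit on from w. The left side at x = y = 1 is 3/4, the right side at most 1/2. -/

/-- A vertex outside `X` from which a directed path that avoids `X` leads to `Y`. -/
def IsCausalNode (G : Digraph V) (X Y : Set V) (v : V) : Prop :=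
  v ∉ X ∧ ∃ y ∈ Y, Relation.ReflTransGen (fun a b => G.Adj a b ∧ b ∉ X) v y

/-- The proper back-door graph: the first edges of all proper causal paths are removed. -/
def backdoorGraph (G : Digraph V) (X Y : Set V) : Digraph V where
  Adj u v := G.Adj u v ∧ ¬ (u ∈ X ∧ IsCausalNode G X Y v)

/-- The vertices outside `Z` with a directed path to `t` on which only `t` may be in `Z`. -/
def openAnc (H : Digraph V) (Z : Set V) (t : V) : Set V :=
  {s | s ∉ Z ∧ Relation.ReflTransGen (fun a b => H.Adj a b ∧ a ∉ Z) s t}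

/-- The elements of `Y`, and those of `Z` that are joined to `Y` by a sequence of elements of `Z`
of which any two successive ones have a common open ancestor. -/
inductive Linked (H : Digraph V) (Y Z : Set V) : V → Prop
  | base {t : V} (ht : t ∈ Y) : Linked H Y Z t
  | step {t t' s : V} (ht : Linked H Y Z t) (ht' : t' ∈ Z) (hs : s ∈ openAnc H Z t)
      (hs' : s ∈ openAnc H Z t') : Linked H Y Z t'

/-- Some element of `X` has a common open ancestor with a vertex that is linked to `Y`. -/
def IsConnected (H : Digraph V) (X Y Z : Set V) : Prop :=
  ∃ x ∈ X, ∃ t s, Linked H Y Z t ∧ s ∈ openAnc H Z x ∧ s ∈ openAnc H Z t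

/-- No element of `Z` descends from the second vertex of a proper causal path. -/
def AvoidsForbidden (G : Digraph V) (X Y Z : Set V) : Prop :=
  ∀ u ∈ X, ∀ v, G.Adj u v → IsCausalNode G X Y v → ∀ z ∈ Z, ¬ IsDescendant G v z

variable {G H : Digraph V} {X Y Z : Set V}

theorem IsAcyclic.asymm (hG : IsAcyclic G) {u v : V} (h : G.Adj u v) : ¬ G.Adj v u :=
  fun h' => hG u (.head h (.single h'))

theorem IsAcyclic.mono (hG : IsAcyclic G) (h : ∀ u v, H.Adj u v → G.Adj u v) : IsAcyclic H :=
  fun v hv => hG v (Relation.TransGen.mono h v v hv)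

theorem IsDescendant.mono (h : ∀ u v, H.Adj u v → G.Adj u v) {u v : V}
    (huv : IsDescendant H u v) : IsDescendant G u v :=
  Relation.ReflTransGen.mono h u v huv

theorem backdoorGraph_le (u v : V) (h : (backdoorGraph G X Y).Adj u v) : G.Adj u v := h.1

theorem IsAcyclic.nodup_of_isChain (hG : IsAcyclic G) {p : List V} (hp : p.IsChain G.Adj) :
    p.Nodup := by
  have h1 : p.IsChain (Relation.TransGen G.Adj) := hp.imp fun a b h => .single h
  have h2 : p.Pairwise (Relation.TransGen G.Adj) := List.isChain_iff_pairwise.1 h1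
  exact h2.imp fun {a b} h (hab : a = b) => hG a (by rw [← hab] at h; exact h)

theorem avoidsForbidden_of_forbidden_inter_eq_empty (hG : IsAcyclic G)
    (h : forbidden G X Y ∩ Z = ∅) : AvoidsForbidden G X Y Z := by
  rintro u hu v huv ⟨hvX, y, hy, hvy⟩ z hz hvz
  obtain ⟨l, hl, hlast⟩ := List.exists_isChain_cons_of_relationReflTransGen hvy
  have hchain : (u :: v :: l).IsChain G.Adj :=
    List.isChain_cons_cons.2 ⟨huv, hl.imp fun a b h => h.1⟩
  have hX : ∀ w ∈ v :: l, w ∉ X := by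
    intro w hw
    rcases List.mem_cons.1 hw with rfl | hw
    · exact hvX
    · have : ∀ (a : V) (l : List V), (a :: l).IsChain (fun a b => G.Adj a b ∧ b ∉ X) →
          ∀ w ∈ l, w ∉ X := by
        intro a l
        induction l generalizing a with
        | nil => simp
        | cons b l ih =>
          intro hc w hw
          rw [List.isChain_cons_cons] at hc
          rcases List.mem_cons.1 hw with rfl | hw
          · exact hc.1.2
          · exact ih b hc.2 w hw
      exact this v l hl w hw
  have : z ∈ forbidden G X Y ∩ Z := by
    refine ⟨⟨v, u :: v :: l, ⟨⟨by simp, hG.nodup_of_isChain hchain, hchain.imp fun a b h => .inl h⟩,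
      hchain⟩, ⟨u, v :: l, rfl, hu, hX, y, ?_, hy⟩, by simp, hvX, hvz⟩, hz⟩
    rw [List.getLast?_cons_cons, List.getLast?_eq_getLast_of_ne_nil (by simp), hlast]
    rfl
  rw [h] at this
  exact this

theorem reflTransGen_of_isChain {R : V → V → Prop} {a b : V} {l : List V}
    (h : (a :: l).IsChain R) (hb : b ∈ a :: l) : Relation.ReflTransGen R a b := by
  induction l generalizing a with
  | nil => simp at hb; subst hb; exact .refl
  | cons c l ih =>
    rw [List.isChain_cons_cons] at h
    rcases List.mem_cons.1 hb with rfl | hb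
    · exact .refl
    · exact .head h.1 (ih h.2 hb)

theorem exists_of_mem_forbidden {d : V} (hd : d ∈ forbidden G X Y) :
    ∃ u ∈ X, ∃ v w y, G.Adj u v ∧ y ∈ Y ∧ v ∉ X ∧
      Relation.ReflTransGen (fun a b => G.Adj a b ∧ b ∉ X) v w ∧
      Relation.ReflTransGen (fun a b => G.Adj a b ∧ b ∉ X) w y ∧ IsDescendant G w d := by
  obtain ⟨w, p, hp, ⟨u, q, rfl, hu, hq, y, hy, hyY⟩, hw, hwX, hwd⟩ := hd
  have hwq : w ∈ q := by
    rcases List.mem_cons.1 hw with rfl | h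
    · exact absurd hu hwX
    · exact h
  obtain ⟨q1, q2, rfl⟩ := List.append_of_mem hwq
  have hc : (q1 ++ w :: q2).IsChain (fun a b => G.Adj a b ∧ b ∉ X) := by
    have := hp.2.tail
    simp only [List.tail_cons] at this
    exact this.imp_of_mem_imp fun a b _ hb h => ⟨h, hq b hb⟩
  have h2 : (w :: q2).IsChain (fun a b => G.Adj a b ∧ b ∉ X) := hc.right_of_append
  have hyq : y ∈ w :: q2 := by
    have : (u :: (q1 ++ w :: q2)).getLast? = (w :: q2).getLast? := by
      rw [← List.cons_append, List.getLast?_append_of_ne_nil _ (by simp)]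
    rw [this] at hy
    exact List.mem_of_getLast? hy
  cases q1 with
  | nil =>
    exact ⟨u, hu, w, w, y, hp.2.rel_head? (by simp), hyY, hwX, .refl,
      reflTransGen_of_isChain h2 hyq, hwd⟩
  | cons v q1 =>
    refine ⟨u, hu, v, w, y, hp.2.rel_head? (by simp), hyY, hq v (by simp),
      reflTransGen_of_isChain hc (by simp), reflTransGen_of_isChain h2 hyq, hwd⟩

/-- Every vertex outside `X` on a proper causal path descends from the second vertex of that path,
so it suffices to watch the descendants of second vertices. -/
theorem forbidden_inter_eq_empty_of_avoidsForbidden (h : AvoidsForbidden G X Y Z) :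
    forbidden G X Y ∩ Z = ∅ := by
  rw [Set.eq_empty_iff_forall_notMem]
  rintro d ⟨hd, hdZ⟩
  obtain ⟨u, hu, v, w, y, huv, hy, hvX, hvw, hwy, hwd⟩ := exists_of_mem_forbidden hd
  exact h u hu v huv ⟨hvX, y, hy, hvw.trans hwy⟩ d hdZ
    ((hvw.lift id fun _ _ h => h.1 : Relation.ReflTransGen G.Adj v w).trans hwd)

/-- The condition for a walk to be open at the vertex `b` between `a` and `c`. -/
def TripleOpen (H : Digraph V) (Z : Set V) (a b c : V) : Prop :=
  (H.Adj a b → H.Adj c b → ∃ z ∈ Z, IsDescendant H b z) ∧ (¬ (H.Adj a b ∧ H.Adj c b) → b ∉ Z)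

/-- A walk that is open given `Z`. -/
def OpenWalk (H : Digraph V) (Z : Set V) : List V → Prop
  | [] => True
  | [_] => True
  | [a, b] => H.Adj a b ∨ H.Adj b a
  | a :: b :: c :: l => (H.Adj a b ∨ H.Adj b a) ∧ TripleOpen H Z a b c ∧ OpenWalk H Z (b :: c :: l)

/-! ### Open walks and the removal of repeated vertices -/

theorem openWalk_cons_cons {a b : V} {l : List V} : OpenWalk H Z (a :: b :: l) ↔
    (H.Adj a b ∨ H.Adj b a) ∧ (∀ c ∈ l.head?, TripleOpen H Z a b c) ∧ OpenWalk H Z (b :: l) := by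
  cases l <;> simp [OpenWalk]

theorem openWalk_append {l₁ l₂ : List V} {v : V} : OpenWalk H Z (l₁ ++ v :: l₂) ↔
    OpenWalk H Z (l₁ ++ [v]) ∧ OpenWalk H Z (v :: l₂) ∧
      ∀ a ∈ l₁.getLast?, ∀ b ∈ l₂.head?, TripleOpen H Z a v b := by
  induction l₁ with
  | nil => simp [OpenWalk]
  | cons a l₁ ih =>
    cases l₁ with
    | nil =>
      simp only [List.cons_append, List.nil_append, openWalk_cons_cons]
      simp [OpenWalk]
      tauto
    | cons b l₁ =>
      simp only [List.cons_append] at ih ⊢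
      rw [openWalk_cons_cons, ih, openWalk_cons_cons, List.getLast?_cons_cons]
      have : (l₁ ++ v :: l₂).head? = (l₁ ++ [v]).head? := by cases l₁ <;> simp
      rw [this]
      tauto

theorem openWalk_iff {p : List V} : OpenWalk H Z p ↔
    p.IsChain (fun u v => H.Adj u v ∨ H.Adj v u) ∧
      ∀ u v w, [u, v, w] <:+: p → TripleOpen H Z u v w := by
  induction p with
  | nil => simp [OpenWalk]
  | cons a p ih =>
    cases p with
    | nil => simp [OpenWalk, List.infix_cons_iff]
    | cons b p =>
      rw [openWalk_cons_cons, ih, List.isChain_cons_cons]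
      constructor
      · rintro ⟨h1, h2, h3, h4⟩
        refine ⟨⟨h1, h3⟩, fun u v w h => ?_⟩
        rw [List.infix_cons_iff] at h
        rcases h with h | h
        · rw [List.cons_prefix_cons, List.cons_prefix_cons] at h
          obtain ⟨rfl, rfl, h⟩ := h
          refine h2 _ ?_
          obtain ⟨t, rfl⟩ := h
          simp
        · exact h4 _ _ _ h
      · rintro ⟨⟨h1, h3⟩, h4⟩
        refine ⟨h1, fun c hc => h4 _ _ _ ?_, h3, fun u v w h => h4 _ _ _ (h.trans ?_)⟩
        · cases p with
          | nil => simp at hc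
          | cons d p =>
            simp at hc
            subst hc
            exact ⟨[], p, by simp⟩
        · exact (List.suffix_cons a _).isInfix

/-- A walk that starts forward keeps going forward until its first collider. That collider descends
from `w` and, the walk being open, has a descendant in `Z`. -/
theorem OpenWalk.descendant_or_isChain {v w : V} {l : List V} (h : OpenWalk H Z (v :: w :: l))
    (hvw : H.Adj v w) : (∃ z ∈ Z, IsDescendant H w z) ∨ (v :: w :: l).IsChain H.Adj := by
  induction l generalizing v w with
  | nil => right; simpa using hvw
  | cons c l ih =>
    rw [openWalk_cons_cons] at h
    have ht := h.2.1 c (by simp)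
    by_cases hcw : H.Adj c w
    · exact .inl (ht.1 hvw hcw)
    · have hwc : H.Adj w c := by
        have := h.2.2
        rw [openWalk_cons_cons] at this
        exact this.1.resolve_right hcw
      rcases ih h.2.2 hwc with ⟨z, hz, hcz⟩ | hch
      · exact .inl ⟨z, hz, .head hwc hcz⟩
      · exact .inr (List.isChain_cons_cons.2 ⟨hvw, hch⟩)

/-- The only delicate case is that `v` becomes a collider although the loop leaves it forward. The
loop cannot be directed all the way back to `v`, by acyclicity, so `v` has a descendant in `Z` by
`descendant_or_isChain`. -/
theorem OpenWalk.remove_loop (hH : IsAcyclic H) {l₁ l₂ l₃ : List V} {v : V}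
    (h : OpenWalk H Z (l₁ ++ v :: (l₂ ++ v :: l₃))) : OpenWalk H Z (l₁ ++ v :: l₃) := by
  rw [openWalk_append] at h ⊢
  obtain ⟨h1, h2, h3⟩ := h
  rw [← List.cons_append, openWalk_append] at h2
  obtain ⟨h4, h5, h6⟩ := h2
  refine ⟨h1, h5, fun a ha b hb => ?_⟩
  obtain ⟨c, m, hcm⟩ : ∃ c m, l₂ ++ [v] = c :: m := by cases l₂ <;> simp
  have hc : c ∈ (l₂ ++ v :: l₃).head? := by
    cases l₂ with
    | nil => simp at hcm; simp [hcm.1]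
    | cons d l => simp at hcm; simp [hcm.1]
  have ht1 := h3 a ha c hc
  obtain ⟨d, hd⟩ : ∃ d, d ∈ (v :: l₂).getLast? := by
    exact ⟨_, List.getLast?_eq_getLast_of_ne_nil (by simp)⟩
  have ht2 := h6 d hd b hb
  refine ⟨fun hav hbv => ?_, fun hn => ?_⟩
  · by_cases hcv : H.Adj c v
    · exact ht1.1 hav hcv
    · rw [List.cons_append, hcm] at h4
      have hvc : H.Adj v c := (openWalk_cons_cons.1 h4).1.resolve_right hcv
      rcases h4.descendant_or_isChain hvc with ⟨z, hz, hcz⟩ | hch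
      · exact ⟨z, hz, .head hvc hcz⟩
      · have := hH.nodup_of_isChain hch
        rw [← hcm] at this
        simp at this
  · by_cases hav : H.Adj a v
    · exact ht2.2 fun h' => hn ⟨hav, h'.2⟩
    · exact ht1.2 fun h' => hav h'.1

theorem exists_eq_append_of_not_nodup {p : List V} (h : ¬ p.Nodup) :
    ∃ l₁ v l₂ l₃, p = l₁ ++ v :: (l₂ ++ v :: l₃) := by
  induction p with
  | nil => simp at h
  | cons a p ih =>
    by_cases ha : a ∈ p
    · obtain ⟨s, t, rfl⟩ := List.append_of_mem ha
      exact ⟨[], a, s, t, rfl⟩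
    · obtain ⟨l₁, v, l₂, l₃, rfl⟩ := ih (by simpa [ha] using h)
      exact ⟨a :: l₁, v, l₂, l₃, rfl⟩

/-- Induction on the length: cut the walk at a later visit to `X`, or excise a loop. Both steps
shorten the walk and keep it open. -/
theorem OpenWalk.exists_nodup (hH : IsAcyclic H) {p : List V} (hp : OpenWalk H Z p)
    (hX : ∃ x ∈ p.head?, x ∈ X) (hY : ∃ y ∈ p.getLast?, y ∈ Y) :
    ∃ q, OpenWalk H Z q ∧ q.Nodup ∧ IsProperFromTo X Y q := by
  induction hn : p.length using Nat.strong_induction_on generalizing p with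
  | _ n ih =>
    subst hn
    obtain ⟨x, hx, hxX⟩ := hX
    cases p with
    | nil => simp at hx
    | cons a q =>
      simp at hx
      subst hx
      by_cases hnd : (a :: q).Nodup
      · by_cases hq : ∀ v ∈ q, v ∉ X
        · exact ⟨_, hp, hnd, a, q, rfl, hxX, hq, hY⟩
        · push Not at hq
          obtain ⟨v, hv, hvX⟩ := hq
          obtain ⟨s, t, rfl⟩ := List.append_of_mem hv
          refine ih (v :: t).length (by simp) (p := v :: t) ?_ ⟨v, by simp, hvX⟩ ?_ rfl
          · rw [← List.cons_append, openWalk_append] at hp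
            exact hp.2.1
          · rwa [← List.cons_append, List.getLast?_append_of_ne_nil _ (by simp)] at hY
      · obtain ⟨l₁, v, l₂, l₃, hl⟩ := exists_eq_append_of_not_nodup hnd
        rw [hl] at hp hY
        refine ih (l₁ ++ v :: l₃).length (by rw [hl]; simp) (hp.remove_loop hH) ?_ ?_ rfl
        · refine ⟨a, ?_, hxX⟩
          cases l₁ <;> simp at hl <;> simp [hl.1]
        · rw [List.getLast?_append_of_ne_nil _ (by simp)] at hY ⊢
          rwa [← List.cons_append, List.getLast?_append_of_ne_nil _ (by simp)] at hY

/-- There is an open walk from `v` to `Y` that leaves `v ∉ Z` along an edge out of `v`, or is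
trivial. -/
def WalkOut (H : Digraph V) (Y Z : Set V) (v : V) : Prop :=
  v ∉ Z ∧ ∃ l, OpenWalk H Z (v :: l) ∧ (∃ y ∈ (v :: l).getLast?, y ∈ Y) ∧
    ∀ b ∈ l.head?, H.Adj v b

/-- There is an open walk from `v` to `Y` that leaves `v` along an edge into `v`. -/
def WalkIn (H : Digraph V) (Y Z : Set V) (v : V) : Prop :=
  ∃ b l, OpenWalk H Z (v :: b :: l) ∧ (∃ y ∈ (v :: b :: l).getLast?, y ∈ Y) ∧ H.Adj b v

theorem WalkOut.parent (hH : IsAcyclic H) {u v : V} (h : WalkOut H Y Z v) (huv : H.Adj u v)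
    (hu : u ∉ Z) : WalkOut H Y Z u := by
  obtain ⟨hv, l, hl, hy, hb⟩ := h
  refine ⟨hu, v :: l, openWalk_cons_cons.2 ⟨.inl huv, fun c hc => ⟨fun _ h => ?_, fun _ => hv⟩, hl⟩,
    by rwa [List.getLast?_cons_cons], by simpa using huv⟩
  exact absurd (hb c hc) (hH.asymm h)

theorem WalkOut.child (hH : IsAcyclic H) {v w : V} (h : WalkOut H Y Z v) (hvw : H.Adj v w) :
    WalkIn H Y Z w := by
  obtain ⟨hv, l, hl, hy, hb⟩ := h
  refine ⟨v, l, openWalk_cons_cons.2 ⟨.inr hvw, fun c hc => ⟨fun h => ?_, fun _ => hv⟩, hl⟩,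
    by rwa [List.getLast?_cons_cons], hvw⟩
  exact absurd hvw (hH.asymm h)

theorem WalkIn.child (hH : IsAcyclic H) {v w : V} (h : WalkIn H Y Z v) (hv : v ∉ Z)
    (hvw : H.Adj v w) : WalkIn H Y Z w := by
  obtain ⟨b, l, hl, hy, hb⟩ := h
  refine ⟨v, b :: l, openWalk_cons_cons.2 ⟨.inr hvw, fun c hc => ⟨fun h => ?_, fun _ => hv⟩, hl⟩,
    by rwa [List.getLast?_cons_cons], hvw⟩
  exact absurd hvw (hH.asymm h)

theorem WalkIn.parent {v u : V} (h : WalkIn H Y Z v) (hv : v ∈ Z)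
    (huv : H.Adj u v) (hu : u ∉ Z) : WalkOut H Y Z u := by
  obtain ⟨b, l, hl, hy, hb⟩ := h
  refine ⟨hu, v :: b :: l, openWalk_cons_cons.2 ⟨.inl huv, fun c hc =>
    ⟨fun _ _ => ⟨v, hv, .refl⟩, fun h => ?_⟩, hl⟩, by rwa [List.getLast?_cons_cons], by simpa using huv⟩
  simp at hc
  subst hc
  exact absurd ⟨huv, hb⟩ h

/-! ### From chains of common ancestors to open paths -/

theorem walkOut_of_mem_openAnc (hH : IsAcyclic H) {s t : V} (hs : s ∈ openAnc H Z t)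
    (ht : WalkOut H Y Z t ∨ t ∈ Z ∧ WalkIn H Y Z t) : WalkOut H Y Z s := by
  have key : ∀ a, Relation.ReflTransGen (fun a b => H.Adj a b ∧ a ∉ Z) a t →
      a = t ∨ WalkOut H Y Z a := by
    intro a ha
    induction ha using Relation.ReflTransGen.head_induction_on with
    | refl => exact .inl rfl
    | head hab _ ih =>
      right
      rcases ih with rfl | ih
      · rcases ht with ht | ht
        · exact ht.parent hH hab.1 hab.2
        · exact ht.2.parent ht.1 hab.1 hab.2
      · exact ih.parent hH hab.1 hab.2
  rcases key s hs.2 with rfl | h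
  · exact ht.resolve_right fun h => hs.1 h.1
  · exact h

theorem WalkOut.descend (hH : IsAcyclic H) {s t : V} (hs : WalkOut H Y Z s)
    (ht : s ∈ openAnc H Z t) : t = s ∨ WalkIn H Y Z t := by
  have := ht.2
  induction this with
  | refl => exact .inl rfl
  | tail h1 h2 ih =>
    right
    rcases ih ⟨hs.1, h1⟩ with rfl | ih
    · exact hs.child hH h2.1
    · exact ih.child hH h2.2 h2.1

/-- Each link climbs from `t` to a common open ancestor and descends to `t'`. An element of `Z` must
be entered as a collider, hence the alternative. -/
theorem Linked.walk (hH : IsAcyclic H) (hYZ : Disjoint Y Z) {t : V} (ht : Linked H Y Z t) :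
    WalkOut H Y Z t ∨ t ∈ Z ∧ WalkIn H Y Z t := by
  induction ht with
  | @base t ht =>
    exact .inl ⟨fun h => Set.disjoint_left.1 hYZ ht h, [], by simp [OpenWalk], ⟨t, by simp, ht⟩,
      by simp⟩
  | step _ ht' hs hs' ih =>
    rcases (walkOut_of_mem_openAnc hH hs ih).descend hH hs' with rfl | h
    · exact absurd ht' hs.1
    · exact .inr ⟨ht', h⟩

theorem IsConnected.exists_openWalk (hH : IsAcyclic H) (hYZ : Disjoint Y Z)
    (h : IsConnected H X Y Z) :
    ∃ p, OpenWalk H Z p ∧ (∃ x ∈ p.head?, x ∈ X) ∧ ∃ y ∈ p.getLast?, y ∈ Y := by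
  obtain ⟨x, hx, t, s, ht, hsx, hst⟩ := h
  have hs := walkOut_of_mem_openAnc hH hst (ht.walk hH hYZ)
  rcases hs.descend hH hsx with rfl | ⟨b, l, hl, hy, -⟩
  · obtain ⟨-, l, hl, hy, -⟩ := hs
    exact ⟨_, hl, ⟨x, by simp, hx⟩, hy⟩
  · exact ⟨_, hl, ⟨x, by simp, hx⟩, hy⟩

theorem exists_triple_of_mem {p : List V} {v : V} (hv : v ∈ p) (h1 : v ∉ p.head?)
    (h2 : v ∉ p.getLast?) : ∃ u w, [u, v, w] <:+: p := by
  obtain ⟨s, t, rfl⟩ := List.append_of_mem hv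
  rcases List.eq_nil_or_concat s with rfl | ⟨s, u, rfl⟩
  · simp at h1
  · cases t with
    | nil => simp at h2
    | cons w t => exact ⟨u, w, s, t, by simp⟩

/-- A connection yields an open proper path of the back-door graph. As a path of `G` it is not
causal, since the first edge of a proper causal path has been removed, and it is still open because
descendants in the subgraph are descendants in `G`. -/
theorem not_isConnected_of_adjustmentCriterion (hG : IsAcyclic G) (hXY : Disjoint X Y)
    (hXZ : Disjoint X Z) (hYZ : Disjoint Y Z) (h : AdjustmentCriterion G X Y Z) :
    ¬ IsConnected (backdoorGraph G X Y) X Y Z := by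
  intro hc
  have hH : IsAcyclic (backdoorGraph G X Y) := hG.mono backdoorGraph_le
  obtain ⟨p, hp, hpX, hpY⟩ := hc.exists_openWalk hH hYZ
  obtain ⟨q, hq, hqn, hqp⟩ := hp.exists_nodup hH hpX hpY
  obtain ⟨hadj, htr⟩ := openWalk_iff.1 hq
  have hpath : IsPath G q := by
    refine ⟨?_, hqn, hadj.imp fun a b h => h.imp (fun h => h.1) (fun h => h.1)⟩
    obtain ⟨u, l, rfl, -⟩ := hqp
    simp
  have hnc : IsNonCausalPath G q := by
    refine ⟨hpath, fun hch => ?_⟩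
    have hqp' := hqp
    obtain ⟨u, l, rfl, hu, hl, y, hy, hyY⟩ := hqp'
    cases l with
    | nil =>
      simp at hy
      subst hy
      exact Set.disjoint_left.1 hXY hu hyY
    | cons v l =>
      have hyl : y ∈ v :: l := by
        rw [List.getLast?_cons_cons] at hy
        exact List.mem_of_getLast? hy
      have hcn : IsCausalNode G X Y v := by
        refine ⟨hl v (by simp), y, hyY, reflTransGen_of_isChain (l := l) ?_ hyl⟩
        exact (List.isChain_cons_cons.1 hch).2.imp_of_mem_imp fun a b _ hb h => ⟨h, hl b hb⟩
      have huv : G.Adj u v := (List.isChain_cons_cons.1 hch).1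
      rcases (List.isChain_cons_cons.1 hadj).1 with h | h
      · exact h.2 ⟨hu, hcn⟩
      · exact hG.asymm huv h.1
  rcases h.2 q hnc hqp with ⟨v, hv, hvc, hvZ⟩ | ⟨v, hv, ⟨u, w, huvw, huv, hwv⟩, hd⟩
  · obtain ⟨u, l, rfl, hu, hl, y, hy, hyY⟩ := hqp
    obtain ⟨a, b, hab⟩ := exists_triple_of_mem hv
      (by simp; rintro rfl; exact Set.disjoint_left.1 hXZ hu hvZ)
      (by
        intro hvl
        have : v = y := Option.some.inj (hvl.symm.trans hy)
        subst this
        exact Set.disjoint_left.1 hYZ hyY hvZ)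
    exact (htr a v b hab).2 (fun h => hvc ⟨a, b, hab, h.1.1, h.2.1⟩) hvZ
  · have hch := hadj.infix huvw
    simp only [List.isChain_cons_cons, List.isChain_singleton, and_true] at hch
    have h1 := hch.1.resolve_right fun h => hG.asymm huv h.1
    have h2 := hch.2.resolve_left fun h => hG.asymm hwv h.1
    obtain ⟨z, hz, hvz⟩ := (htr u v w huvw).1 h1 h2
    exact hd z (IsDescendant.mono backdoorGraph_le hvz) hz

/-! ### From open paths to chains of common ancestors -/

theorem mem_openAnc_of_adj {u v t : V} (hu : u ∉ Z) (huv : H.Adj u v)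
    (hvt : Relation.ReflTransGen (fun a b => H.Adj a b ∧ a ∉ Z) v t) : u ∈ openAnc H Z t :=
  ⟨hu, .head ⟨huv, hu⟩ hvt⟩

theorem self_mem_openAnc {v : V} (hv : v ∉ Z) : v ∈ openAnc H Z v := ⟨hv, .refl⟩

theorem exists_open_of_isDescendant {T : Set V} (hZT : Z ⊆ T) {v z : V} (hz : z ∈ T)
    (h : IsDescendant H v z) :
    ∃ z' ∈ T, Relation.ReflTransGen (fun a b => H.Adj a b ∧ a ∉ Z) v z' := by
  induction h using Relation.ReflTransGen.head_induction_on with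
  | refl => exact ⟨z, hz, .refl⟩
  | @head a b hab _ ih =>
    by_cases ha : a ∈ Z
    · exact ⟨a, hZT ha, .refl⟩
    · obtain ⟨z', hz', h⟩ := ih
      exact ⟨z', hz', .head ⟨hab, ha⟩ h⟩

/-- The chain is read off from the far end of the walk. The forks become common open ancestors, and
each collider is replaced by the first element of `Z` on a directed path from it to `Z`. -/
theorem OpenWalk.exists_linked (hH : IsAcyclic H) (hYZ : Disjoint Y Z) {v w : V} {l : List V}
    (h : OpenWalk H Z (v :: w :: l)) (hy : ∃ y ∈ (v :: w :: l).getLast?, y ∈ Y) :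
    (H.Adj v w → v ∉ Z → ∃ t, Linked H Y Z t ∧ v ∈ openAnc H Z t) ∧
      (H.Adj w v → ∃ t s, Linked H Y Z t ∧ s ∈ openAnc H Z t ∧ s ∈ openAnc H Z v) := by
  induction l generalizing v w with
  | nil =>
    simp at hy
    have hw : w ∉ Z := fun h => Set.disjoint_left.1 hYZ hy h
    exact ⟨fun hvw hv => ⟨w, .base hy, mem_openAnc_of_adj hv hvw .refl⟩,
      fun hwv => ⟨w, w, .base hy, self_mem_openAnc hw, mem_openAnc_of_adj hw hwv .refl⟩⟩
  | cons c l ih =>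
    obtain ⟨hadj, ht, hrest⟩ := openWalk_cons_cons.1 h
    have ht := ht c (by simp)
    obtain ⟨ih1, ih2⟩ := ih hrest (by rwa [List.getLast?_cons_cons] at hy)
    have hwc := (openWalk_cons_cons.1 hrest).1
    refine ⟨fun hvw hv => ?_, fun hwv => ?_⟩
    · by_cases hcw : H.Adj c w
      · obtain ⟨t, s, hLt, hst, hsw⟩ := ih2 hcw
        obtain ⟨z, hz, hwz⟩ := ht.1 hvw hcw
        obtain ⟨z', hz', hwz'⟩ := exists_open_of_isDescendant (T := Z) subset_rfl hz hwz
        exact ⟨z', .step hLt hz' hst ⟨hsw.1, hsw.2.trans hwz'⟩, mem_openAnc_of_adj hv hvw hwz'⟩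
      · obtain ⟨t, hLt, hwt⟩ := ih1 (hwc.resolve_right hcw) (ht.2 fun h => hcw h.2)
        exact ⟨t, hLt, mem_openAnc_of_adj hv hvw hwt.2⟩
    · have hw : w ∉ Z := ht.2 fun h => hH.asymm hwv h.1
      rcases hwc with hwc | hcw
      · obtain ⟨t, hLt, hwt⟩ := ih1 hwc hw
        exact ⟨t, w, hLt, hwt, mem_openAnc_of_adj hw hwv .refl⟩
      · obtain ⟨t, s, hLt, hst, hsw⟩ := ih2 hcw
        exact ⟨t, s, hLt, hst, hsw.1, hsw.2.tail ⟨hwv, hw⟩⟩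

theorem AvoidsForbidden.isDescendant_backdoorGraph (h : AvoidsForbidden G X Y Z) {v z : V}
    (hz : z ∈ Z) (hvz : IsDescendant G v z) : IsDescendant (backdoorGraph G X Y) v z := by
  induction hvz using Relation.ReflTransGen.head_induction_on with
  | refl => exact .refl
  | head hab hbz ih => exact .head ⟨hab, fun h' => h _ h'.1 _ hab h'.2 z hz hbz⟩ ih

/-- `Blocks` speaks of vertices and `TripleOpen` of positions; without repetitions a vertex has only
one position. -/
theorem triple_unique {p : List V} (hp : p.Nodup) {u v w u' w' : V} (h : [u, v, w] <:+: p)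
    (h' : [u', v, w'] <:+: p) : u = u' ∧ w = w' := by
  obtain ⟨s, t, rfl⟩ := h
  obtain ⟨s', t', he⟩ := h'
  have hlen : s.length = s'.length := by
    have h1 : (s ++ [u, v, w] ++ t)[s.length + 1]? = some v := by simp
    have h2 : (s ++ [u, v, w] ++ t)[s'.length + 1]? = some v := by rw [← he]; simp
    have := (List.getElem?_inj (by simp) hp).1 (h1.trans h2.symm)
    omega
  have := List.append_inj (by simpa using he.symm) hlen
  simp at this
  exact ⟨this.2.1, this.2.2.1⟩

theorem openWalk_of_not_blocks {p : List V} (hp : IsPath G p) (hb : ¬ Blocks G Z p) :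
    OpenWalk G Z p := by
  rw [openWalk_iff]
  refine ⟨hp.2.2, fun u v w h => ?_⟩
  have hv : v ∈ p := h.subset (by simp)
  unfold Blocks at hb
  push Not at hb
  refine ⟨fun huv hwv => ?_, fun hn => hb.1 v hv ?_⟩
  · obtain ⟨d, hd, hdZ⟩ := hb.2 v hv ⟨u, w, h, huv, hwv⟩
    exact ⟨d, hdZ, hd⟩
  · rintro ⟨u', w', h', hu', hw'⟩
    obtain ⟨rfl, rfl⟩ := triple_unique hp.2.1 h h'
    exact hn ⟨hu', hw'⟩

/-- A proper non-causal path that is not blocked survives in the back-door graph. Only its first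
edge could have been removed; then `descendant_or_isChain` makes the path causal or puts a
descendant of its second vertex into `Z`. The descendants in `Z` that open the colliders also
survive, by `isDescendant_backdoorGraph`. -/
theorem adjustmentCriterion_of_not_isConnected (hG : IsAcyclic G) (hXY : Disjoint X Y)
    (hXZ : Disjoint X Z) (hYZ : Disjoint Y Z) (hF : AvoidsForbidden G X Y Z)
    (hC : ¬ IsConnected (backdoorGraph G X Y) X Y Z) : AdjustmentCriterion G X Y Z := by
  refine ⟨forbidden_inter_eq_empty_of_avoidsForbidden hF, fun p hp hpr => ?_⟩
  by_contra hb
  have hH : IsAcyclic (backdoorGraph G X Y) := hG.mono backdoorGraph_le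
  have hw := openWalk_of_not_blocks hp.1 hb
  obtain ⟨u, l, rfl, hu, hl, y, hy, hyY⟩ := hpr
  cases l with
  | nil =>
    simp at hy
    subst hy
    exact Set.disjoint_left.1 hXY hu hyY
  | cons v l =>
    have hedge : ∀ a b, b ∉ X → a ∈ u :: v :: l → ([a, b] <:+: u :: v :: l ∨ a ∉ X) → G.Adj a b →
        (backdoorGraph G X Y).Adj a b := by
      rintro a b hbX ha hab hadj
      refine ⟨hadj, fun h => ?_⟩
      have hau : a = u := by
        rcases List.mem_cons.1 ha with h' | h'
        · exact h'
        · exact absurd h.1 (hl a h')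
      subst hau
      have hbv : b = v := by
        rcases hab with hab | hab
        · rw [List.infix_cons_iff] at hab
          rcases hab with hab | hab
          · simp at hab
            exact hab
          · exact absurd h.1 (hl a (hab.subset (by simp)))
        · exact absurd h.1 hab
      subst hbv
      rcases hw.descendant_or_isChain hadj with ⟨z, hz, hbz⟩ | hch
      · exact hF a hu b hadj h.2 z hz hbz
      · exact hp.2 hch
    have hmem : ∀ a, a ∈ u :: v :: l → a ∈ X → a = u := fun a ha haX => by
      rcases List.mem_cons.1 ha with h' | h'
      · exact h'
      · exact absurd haX (hl a h')
    have hwH : OpenWalk (backdoorGraph G X Y) Z (u :: v :: l) := by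
      obtain ⟨hch, htr⟩ := openWalk_iff.1 hw
      have hlift : ∀ a b, [a, b] <:+: u :: v :: l → (G.Adj a b ∨ G.Adj b a) →
          (backdoorGraph G X Y).Adj a b ∨ (backdoorGraph G X Y).Adj b a := by
        intro a b hab h
        have ha : a ∈ u :: v :: l := hab.subset (by simp)
        have hb : b ∈ u :: v :: l := hab.subset (by simp)
        have hbX : b ∉ X := by
          intro hbX
          have := hmem b hb hbX
          subst this
          obtain ⟨s, t, hst⟩ := hab
          have hnd := hp.1.2.1
          rw [← hst] at hnd
          cases s with
          | nil =>
            simp at hst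
            obtain ⟨rfl, rfl, -⟩ := hst
            simp at hnd
          | cons c s =>
            simp at hst
            obtain ⟨rfl, -⟩ := hst
            simp at hnd
        rcases h with h | h
        · exact .inl (hedge a b hbX ha (.inl hab) h)
        · exact .inr ⟨h, fun h' => hbX h'.1⟩
      have hchH : (u :: v :: l).IsChain (fun a b => (backdoorGraph G X Y).Adj a b ∨
          (backdoorGraph G X Y).Adj b a) := by
        rw [List.isChain_iff_forall_rel_of_append_cons_cons] at hch ⊢
        intro a b l₁ l₂ he
        exact hlift a b ⟨l₁, l₂, by simp [he]⟩ (hch he)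
      refine openWalk_iff.2 ⟨hchH, fun a b c habc => ⟨fun h1 h2 => ?_, fun hn => ?_⟩⟩
      · obtain ⟨z, hz, hbz⟩ := (htr a b c habc).1 h1.1 h2.1
        exact ⟨z, hz, hF.isDescendant_backdoorGraph hz hbz⟩
      · refine (htr a b c habc).2 fun h => hn ?_
        have hch := hchH.infix habc
        simp only [List.isChain_cons_cons, List.isChain_singleton, and_true] at hch
        exact ⟨hch.1.resolve_right fun h' => hG.asymm h.1 h'.1,
          hch.2.resolve_left fun h' => hG.asymm h.2 h'.1⟩
    have huZ : u ∉ Z := fun h => Set.disjoint_left.1 hXZ hu h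
    obtain ⟨h1, h2⟩ := hwH.exists_linked hH hYZ ⟨y, hy, hyY⟩
    rcases (openWalk_cons_cons.1 hwH).1 with h | h
    · obtain ⟨t, ht, hut⟩ := h1 h huZ
      exact hC ⟨u, hu, t, u, ht, self_mem_openAnc huZ, hut⟩
    · obtain ⟨t, s, ht, hst, hsu⟩ := h2 h
      exact hC ⟨u, hu, t, s, ht, hsu, hst⟩

end Separation

end SCGAdjustment

namespace SCGAdjustment

/-! ### Sums over the values of finitely many variables -/

noncomputable section Marginal

variable {V : Type*} [DecidableEq V] {Ω : V → Type*} [∀ v, MeasurableSpace (Ω v)]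

/-- The sum of `h · ∏ φ_v` over all values of the variables in `W`, as a function of the values of
all other variables. -/
def margProd (φ : ∀ _ : V, (∀ v, Ω v) → ℝ≥0∞) (W : Finset V) (h : (∀ v, Ω v) → ℝ≥0∞) :
    (∀ v, Ω v) → ℝ≥0∞ :=
  lmarginal (fun _ => Measure.count) W fun η => h η * ∏ v ∈ W, φ v η

/-- `φ v` is a conditional probability of the variable `v` given its parents in `D`. -/
structure IsFactorSystem (D : Digraph V) (φ : ∀ _ : V, (∀ v, Ω v) → ℝ≥0∞) : Prop where
  measurable : ∀ v, Measurable (φ v)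
  dependsOn : ∀ v, DependsOn (φ v) (insert v {u | D.Adj u v})
  lintegral_eq_one : ∀ v η, ∫⁻ t, φ v (Function.update η v t) ∂Measure.count = 1

theorem IsAcyclic.exists_sink {D : Digraph V} (hD : IsAcyclic D) {F : Finset V}
    (hF : F.Nonempty) : ∃ v ∈ F, ∀ u ∈ F, ¬ D.Adj v u := by
  let r : F → F → Prop := fun a b => Relation.TransGen D.Adj b a
  have : IsTrans F r := ⟨fun a b c h1 h2 => h2.trans h1⟩
  have : Std.Irrefl r := ⟨fun a h => hD a h⟩
  have hwf : WellFounded r := Finite.wellFounded_of_trans_of_irrefl r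
  obtain ⟨v, -, hv⟩ := hwf.has_min Set.univ ⟨⟨hF.choose, hF.choose_spec⟩, trivial⟩
  exact ⟨v, v.2, fun u hu h => hv ⟨u, hu⟩ trivial (.single h)⟩

theorem IsAcyclic.exists_source {D : Digraph V} (hD : IsAcyclic D) {F : Finset V}
    (hF : F.Nonempty) : ∃ v ∈ F, ∀ u ∈ F, ¬ D.Adj u v := by
  let r : F → F → Prop := fun a b => Relation.TransGen D.Adj a b
  have : IsTrans F r := ⟨fun a b c h1 h2 => h1.trans h2⟩
  have : Std.Irrefl r := ⟨fun a h => hD a h⟩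
  have hwf : WellFounded r := Finite.wellFounded_of_trans_of_irrefl r
  obtain ⟨v, -, hv⟩ := hwf.has_min Set.univ ⟨⟨hF.choose, hF.choose_spec⟩, trivial⟩
  exact ⟨v, v.2, fun u hu h => hv ⟨u, hu⟩ trivial (.single h)⟩

theorem dependsOn_prod {ι : Type*} {s : Finset ι} {f : ι → (∀ v, Ω v) → ℝ≥0∞} {A : Set V}
    (h : ∀ i ∈ s, DependsOn (f i) A) : DependsOn (fun η => ∏ i ∈ s, f i η) A :=
  fun _ _ hxy => Finset.prod_congr rfl fun i hi => h i hi hxy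

theorem dependsOn_mul {f g : (∀ v, Ω v) → ℝ≥0∞} {A : Set V}
    (hf : DependsOn f A) (hg : DependsOn g A) : DependsOn (fun η => f η * g η) A :=
  fun _ _ hxy => congrArg₂ _ (hf hxy) (hg hxy)

theorem dependsOn_lmarginal {μ : ∀ v, Measure (Ω v)} {f : (∀ v, Ω v) → ℝ≥0∞} {A : Set V}
    {s : Finset V} (hf : DependsOn f A) : DependsOn (lmarginal μ s f) (A \ s) := by
  intro x y hxy
  refine lintegral_congr fun w => hf fun i hi => ?_
  simp only [Function.updateFinset]
  split_ifs with h
  · rfl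
  · exact hxy i ⟨hi, h⟩

/-- Freezing the coordinates outside `A` at an arbitrary point does not change `f` and makes it a
measurable function of the coordinates in `A`. -/
theorem measurable_cylinderEvents_of_dependsOn {β : Type*} [MeasurableSpace β]
    [∀ v, Nonempty (Ω v)] {f : (∀ v, Ω v) → β} {A : Set V} (hf : Measurable f)
    (hA : DependsOn f A) : Measurable[cylinderEvents A] f := by
  classical
  let ω₀ : ∀ v, Ω v := fun v => Classical.arbitrary _
  have h : f = f ∘ fun ω v => if v ∈ A then ω v else ω₀ v := by
    funext ω
    exact hA fun i hi => by simp [hi]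
  rw [h]
  refine hf.comp (@measurable_pi_lambda _ _ _ (_) _ _ fun v => ?_)
  by_cases hv : v ∈ A
  · simpa [hv] using measurable_cylinderEvent_apply hv
  · simp [hv]

theorem dependsOn_of_measurable_cylinderEvents {B : Set (∀ v, Ω v)} {A : Set V}
    (hB : MeasurableSet[cylinderEvents A] B) : DependsOn (· ∈ B) A := by
  have key : cylinderEvents (X := Ω) A ≤ MeasurableSpace.comap (A.domRestrict (π := Ω)) MeasurableSpace.pi := by
    refine iSup₂_le fun i hi => ?_
    have h : (fun σ : ∀ v, Ω v => σ i) = (fun σ : ∀ v : A, Ω v => σ ⟨i, hi⟩) ∘ A.domRestrict (π := Ω) := rfl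
    rw [h, ← MeasurableSpace.comap_comp]
    exact MeasurableSpace.comap_mono (measurable_pi_apply (⟨i, hi⟩ : A)).comap_le
  obtain ⟨C, -, rfl⟩ := key _ hB
  intro x y hxy
  have : A.domRestrict x = A.domRestrict y := funext fun i => hxy i i.2
  simp [Set.mem_preimage, this]

variable [∀ v, DiscreteMeasurableSpace (Ω v)] [∀ v, Countable (Ω v)]

theorem lmarginal_count (s : Finset V) (f : (∀ v, Ω v) → ℝ≥0∞) (ω : ∀ v, Ω v) :
    lmarginal (fun _ => Measure.count) s f ω
      = ∑' w : ∀ v : s, Ω v, f (Function.updateFinset ω s w) := by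
  rw [lmarginal, lintegral_countable']
  refine tsum_congr fun w => ?_
  simp [Measure.pi_singleton]

theorem lmarginal_mul_of_dependsOn {s : Finset V} {f g : (∀ v, Ω v) → ℝ≥0∞}
    (hg : DependsOn g {v | v ∉ s}) (ω : ∀ v, Ω v) :
    lmarginal (fun _ => Measure.count) s (fun η => f η * g η) ω
      = lmarginal (fun _ => Measure.count) s f ω * g ω := by
  rw [lmarginal_count, lmarginal_count, ← ENNReal.tsum_mul_right]
  refine tsum_congr fun w => ?_
  congr 1
  exact hg fun i hi => by simp [Function.updateFinset, show i ∉ s from hi]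

theorem IsFactorSystem.measurable_prod {D : Digraph V} {φ : ∀ _ : V, (∀ v, Ω v) → ℝ≥0∞}
    (hφ : IsFactorSystem D φ) (W : Finset V) : Measurable fun η => ∏ v ∈ W, φ v η :=
  Finset.measurable_fun_prod _ fun v _ => hφ.measurable v

theorem IsFactorSystem.measurable_margProd {D : Digraph V} {φ : ∀ _ : V, (∀ v, Ω v) → ℝ≥0∞}
    (hφ : IsFactorSystem D φ) (W : Finset V) {h : (∀ v, Ω v) → ℝ≥0∞} (hh : Measurable h) :
    Measurable (margProd φ W h) :=
  Measurable.lmarginal _ (hh.mul (hφ.measurable_prod W))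

/-- Marginalization to a set closed under parents: a sink of `W \ A` occurs in no other factor, and
its own factor sums to 1, so it can be summed out. -/
theorem IsFactorSystem.margProd_eq {D : Digraph V} (hD : IsAcyclic D)
    {φ : ∀ _ : V, (∀ v, Ω v) → ℝ≥0∞} (hφ : IsFactorSystem D φ) {A W : Finset V} (hAW : A ⊆ W)
    (hA : ∀ u v, D.Adj u v → v ∈ A → u ∈ W → u ∈ A) {h : (∀ v, Ω v) → ℝ≥0∞} (hh : Measurable h)
    (hd : DependsOn h {v | v ∈ W → v ∈ A}) : margProd φ W h = margProd φ A h := by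
  induction hn : (W \ A).card generalizing W with
  | zero =>
    rw [Finset.card_eq_zero, Finset.sdiff_eq_empty_iff_subset] at hn
    rw [hn.antisymm hAW]
  | succ n ih =>
    have hne : (W \ A).Nonempty := by rw [← Finset.card_pos]; omega
    obtain ⟨v, hv, hsink⟩ := hD.exists_sink hne
    obtain ⟨hvW, hvA⟩ := Finset.mem_sdiff.1 hv
    have hsink' : ∀ u ∈ W, ¬ D.Adj v u := fun u hu hvu => by
      by_cases huA : u ∈ A
      · exact hvA (hA v u hvu huA hvW)
      · exact hsink u (Finset.mem_sdiff.2 ⟨hu, huA⟩) hvu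
    rw [← ih (W := W.erase v) (fun u hu => Finset.mem_erase.2 ⟨fun h => hvA (h ▸ hu), hAW hu⟩)
      (fun u w huw hw hu => hA u w huw hw (Finset.mem_of_mem_erase hu))
      (hd.mono fun u (hu : u ∈ W → u ∈ A) hu' => hu (Finset.mem_of_mem_erase hu'))
      (by rw [Finset.erase_sdiff_comm, Finset.card_erase_of_mem hv, hn]; rfl)]
    unfold margProd
    rw [lmarginal_erase' _ (hh.fun_mul (hφ.measurable_prod W)) hvW]
    congr 1
    funext η
    have h1 : ∀ t, h (Function.update η v t) * ∏ u ∈ W, φ u (Function.update η v t)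
        = h η * (∏ u ∈ W.erase v, φ u η) * φ v (Function.update η v t) := by
      intro t
      rw [← Finset.prod_erase_mul _ _ hvW, ← mul_assoc]
      congr 2
      · exact hd fun i hi => Function.update_of_ne (by rintro rfl; exact hvA (hi hvW)) _ _
      · refine Finset.prod_congr rfl fun u hu => hφ.dependsOn u fun i hi => ?_
        refine Function.update_of_ne ?_ _ _
        rintro rfl
        rcases hi with rfl | hi
        · exact (Finset.notMem_erase _ _) hu
        · exact hsink' u (Finset.mem_of_mem_erase hu) hi
    simp_rw [h1]
    rw [lintegral_const_mul _ Measurable.of_discrete, hφ.lintegral_eq_one, mul_one]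

theorem margProd_margProd {D : Digraph V} {φ : ∀ _ : V, (∀ v, Ω v) → ℝ≥0∞}
    (hφ : IsFactorSystem D φ) {W₁ W₂ : Finset V} (hW : Disjoint W₁ W₂)
    (hD : ∀ u v, D.Adj u v → v ∈ W₁ → u ∉ W₂) {h : (∀ v, Ω v) → ℝ≥0∞} (hh : Measurable h) :
    margProd φ W₁ (margProd φ W₂ h) = margProd φ (W₁ ∪ W₂) h := by
  unfold margProd
  rw [lmarginal_union _ _ (hh.fun_mul (hφ.measurable_prod _)) hW]
  congr 1
  funext η
  rw [← lmarginal_mul_of_dependsOn (g := fun η => ∏ v ∈ W₁, φ v η)]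
  · congr 1
    funext ω
    rw [Finset.prod_union hW]
    ring
  · refine dependsOn_prod fun v hv => (hφ.dependsOn v).mono ?_
    rintro u (rfl | hu)
    · exact Finset.disjoint_left.1 hW hv
    · exact hD u v hu hv

end Marginal

end SCGAdjustment

namespace SCGAdjustment

/-! ### The law of a window of time, with and without interventions -/

noncomputable section Law

variable {S : Type*} [DecidableEq S] {Ω : S × ℤ → Type*} [∀ v, MeasurableSpace (Ω v)]
  {G : Digraph (S × ℤ)}

open Classical in
/-- The conditional probability of the value of `v` given its parents, where the parents in `C v`
are read off `ξ`. -/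
def factor (κ : Mechanisms G Ω) (ξ : ∀ v, Ω v) (C : S × ℤ → Set (S × ℤ)) (v : S × ℤ)
    (η : ∀ v, Ω v) : ℝ≥0∞ :=
  κ v (fun u => if (u : S × ℤ) ∈ C v then ξ u else η u) {η v}

open Classical in
/-- The factors after the variables in `X` are set to their values in `ξ`. -/
def doFactor (κ : Mechanisms G Ω) (ξ : ∀ v, Ω v) (X : Finset (S × ℤ)) (C : S × ℤ → Set (S × ℤ))
    (v : S × ℤ) (η : ∀ v, Ω v) : ℝ≥0∞ :=
  if v ∈ X then (if η v = ξ v then 1 else 0) else factor κ ξ C v η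

/-- The indicator function of the event that the variables in `A` have the values given by `ξ`. -/
def eventInd (A : Finset (S × ℤ)) (ξ : ∀ v, Ω v) : (∀ v, Ω v) → ℝ≥0∞ :=
  (event A fun v => ξ v).indicator 1

/-- The graph `G` without the edges from `C v` to `v`. -/
def cutGraph (G : Digraph (S × ℤ)) (C : S × ℤ → Set (S × ℤ)) : Digraph (S × ℤ) where
  Adj u v := G.Adj u v ∧ u ∉ C v

theorem mem_event_restrict {A : Finset (S × ℤ)} {ξ ω : ∀ v, Ω v} :
    (ω ∈ event A fun v => ξ v) ↔ ∀ v ∈ A, ω v = ξ v :=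
  ⟨fun h v hv => h ⟨v, hv⟩, fun h v => h v v.2⟩

open Classical in
theorem eventInd_apply {A : Finset (S × ℤ)} {ξ η : ∀ v, Ω v} :
    eventInd A ξ η = if ∀ v ∈ A, η v = ξ v then 1 else 0 := by
  unfold eventInd
  rw [Set.indicator_apply]
  simp only [mem_event_restrict, Pi.one_apply]

theorem dependsOn_eventInd (A : Finset (S × ℤ)) (ξ : ∀ v, Ω v) :
    DependsOn (eventInd A ξ) (A : Set (S × ℤ)) := by
  classical
  intro η η' h
  rw [eventInd_apply, eventInd_apply]
  have : (∀ v ∈ A, η v = ξ v) ↔ ∀ v ∈ A, η' v = ξ v :=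
    forall₂_congr fun v hv => by rw [h v hv]
  simp only [this]

theorem splice_eq_updateFinset (F : Finset (S × ℤ)) (w : ∀ v : F, Ω v) (ω : ∀ v, Ω v) :
    splice F w ω = Function.updateFinset ω F w := rfl

theorem mem_window [Fintype S] {a b : ℤ} {v : S × ℤ} :
    v ∈ window (S := S) a b ↔ a ≤ v.2 ∧ v.2 ≤ b := by
  simp [window]

theorem window_union [Fintype S] {a b c : ℤ} (hab : a ≤ b) (hbc : b ≤ c + 1) :
    window (S := S) a (b - 1) ∪ window b c = window a c := by
  ext v
  simp only [Finset.mem_union, mem_window]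
  omega

theorem exists_timeSpan_eq_window [Fintype S] {A : Finset (S × ℤ)} (hA : A.Nonempty) :
    ∃ a b, timeSpan A = window a b ∧ ∃ u ∈ A, ∃ v ∈ A, u.2 = a ∧ v.2 = b ∧
      ∀ w ∈ A, a ≤ w.2 ∧ w.2 ≤ b := by
  obtain ⟨u, hu, hmin⟩ := A.exists_min_image Prod.snd hA
  obtain ⟨v, hv, hmax⟩ := A.exists_max_image Prod.snd hA
  refine ⟨u.2, v.2, ?_, u, hu, v, hv, rfl, rfl, fun w hw => ⟨hmin w hw, hmax w hw⟩⟩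
  ext w
  simp only [timeSpan, Finset.mem_biUnion, mem_window]
  constructor
  · rintro ⟨p, hp, q, hq, h1, h2⟩
    exact ⟨(hmin p hp).trans h1, h2.trans (hmax q hq)⟩
  · exact fun h => ⟨u, hu, v, hv, h⟩

theorem exists_window_superset [Fintype S] (A : Finset (S × ℤ)) : ∃ a b, A ⊆ window a b := by
  rcases A.eq_empty_or_nonempty with rfl | hA
  · exact ⟨0, 0, by simp⟩
  · obtain ⟨a, b, -, u, -, v, -, -, -, h⟩ := exists_timeSpan_eq_window hA
    exact ⟨a, b, fun w hw => mem_window.2 (h w hw)⟩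

variable [∀ v, DiscreteMeasurableSpace (Ω v)] [∀ v, Countable (Ω v)]

/-! ### Measurability, and the factors of observed and intervened models -/

theorem measurableSet_event (A : Finset (S × ℤ)) (a : ∀ v : A, Ω v) :
    MeasurableSet (event A a) := by
  have : event A a = ⋂ v : A, (fun ω : ∀ v, Ω v => ω v) ⁻¹' {a v} := by
    ext ω; simp [event]
  rw [this]
  exact MeasurableSet.iInter fun v => measurable_pi_apply _ (measurableSet_singleton _)

theorem measurable_eventInd (A : Finset (S × ℤ)) (ξ : ∀ v, Ω v) : Measurable (eventInd A ξ) :=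
  measurable_one.indicator (measurableSet_event _ _)

theorem lintegral_eventInd (P : Measure (∀ v, Ω v)) (A : Finset (S × ℤ)) (ξ : ∀ v, Ω v) :
    ∫⁻ ω, eventInd A ξ ω ∂P = P (event A fun v => ξ v) :=
  lintegral_indicator_one (measurableSet_event _ _)

theorem measurable_factor (κ : Mechanisms G Ω) (ξ : ∀ v, Ω v) (C : S × ℤ → Set (S × ℤ))
    (v : S × ℤ) : Measurable (factor κ ξ C v) := by
  classical
  have h1 : Measurable fun η : ∀ v, Ω v =>
      (fun u : {u // G.Adj u v} => if (u : S × ℤ) ∈ C v then ξ u else η u) := by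
    refine measurable_pi_lambda _ fun u => ?_
    by_cases hu : (u : S × ℤ) ∈ C v
    · simp [hu]
    · simpa [hu] using measurable_pi_apply (u : S × ℤ)
  have h2 : Measurable fun p : (∀ u : {u // G.Adj u v}, Ω u) × Ω v => κ v p.1 {p.2} :=
    measurable_from_prod_countable_left fun t => (κ v).measurable_coe (measurableSet_singleton t)
  exact h2.comp (h1.prodMk (measurable_pi_apply v))

theorem isFactorSystem_factor (hG : IsAcyclic G) {κ : Mechanisms G Ω}
    (hκ : ∀ v, IsMarkovKernel (κ v)) (ξ : ∀ v, Ω v) (C : S × ℤ → Set (S × ℤ)) :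
    IsFactorSystem (cutGraph G C) (factor κ ξ C) where
  measurable := measurable_factor κ ξ C
  dependsOn v η η' h := by
    unfold factor
    rw [h v (by simp)]
    congr 2
    funext u
    split_ifs with hu
    · rfl
    · exact h u (.inr ⟨u.2, hu⟩)
  lintegral_eq_one v η := by
    classical
    have h : ∀ t, factor κ ξ C v (Function.update η v t)
        = κ v (fun u => if (u : S × ℤ) ∈ C v then ξ u else η u) {t} := by
      intro t
      unfold factor
      rw [Function.update_self]
      congr 2
      funext u
      have : (u : S × ℤ) ≠ v := by
        rintro h
        exact hG v (.single (by have := u.2; rwa [h] at this))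
      rw [Function.update_of_ne this]
    simp_rw [h]
    have h1 := lintegral_countable' (μ := κ v fun u => if (u : S × ℤ) ∈ C v then ξ u else η u)
      fun _ => 1
    simp only [lintegral_one, measure_univ, one_mul] at h1
    rw [lintegral_count, ← h1]

/-- With a point mass at the intervened variables, in place of the factor 1 in `factorProduct`, the
factors still sum to 1, so that intervened models also allow sinks to be summed out. -/
theorem isFactorSystem_doFactor (hG : IsAcyclic G) {κ : Mechanisms G Ω}
    (hκ : ∀ v, IsMarkovKernel (κ v)) (ξ : ∀ v, Ω v) (X : Finset (S × ℤ))
    (C : S × ℤ → Set (S × ℤ)) :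
    IsFactorSystem (cutGraph G C) (doFactor κ ξ X C) where
  measurable v := by
    classical
    unfold doFactor
    by_cases hv : v ∈ X
    · simp only [hv, if_true]
      exact Measurable.ite (measurable_pi_apply v (measurableSet_singleton (ξ v)))
        measurable_const measurable_const
    · simpa [hv] using measurable_factor κ ξ C v
  dependsOn v η η' h := by
    unfold doFactor
    rw [(isFactorSystem_factor hG hκ ξ C).dependsOn v h, h v (by simp)]
  lintegral_eq_one v η := by
    classical
    by_cases hv : v ∈ X
    · simp only [doFactor, hv, if_true, Function.update_self]
      rw [lintegral_count, tsum_ite_eq]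
    · simpa [doFactor, hv] using (isFactorSystem_factor hG hκ ξ C).lintegral_eq_one v η

theorem prod_factor_update (κ : Mechanisms G Ω) (ξ ω : ∀ v, Ω v) (W : Finset (S × ℤ))
    (w : ∀ v : W, Ω v) :
    ∏ v ∈ W, factor κ ξ (fun _ => ∅) v (Function.updateFinset ω W w)
      = factorProduct κ ∅ W w ω := by
  classical
  rw [← Finset.prod_coe_sort]
  unfold factorProduct
  refine Finset.prod_congr rfl fun v _ => ?_
  simp only [factor, Set.mem_empty_iff_false, if_false, Finset.notMem_empty,
    splice_eq_updateFinset]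
  congr 2
  simp [Function.updateFinset]

theorem measurable_factorProduct (κ : Mechanisms G Ω) (ξ : ∀ v, Ω v) (W : Finset (S × ℤ))
    (w : ∀ v : W, Ω v) : Measurable (factorProduct κ ∅ W w) := by
  have : factorProduct κ ∅ W w = (fun η => ∏ v ∈ W, factor κ ξ (fun _ => ∅) v η) ∘
      fun ω => Function.updateFinset ω W w := by
    funext ω
    exact (prod_factor_update κ ξ ω W w).symm
  rw [this]
  exact (Finset.measurable_fun_prod _ fun v _ => measurable_factor κ ξ _ v).comp
    measurable_updateFinset_left

theorem iUnion_event (W : Finset (S × ℤ)) : ⋃ w : ∀ v : W, Ω v, event W w = Set.univ :=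
  Set.eq_univ_of_forall fun ω => Set.mem_iUnion.2 ⟨fun v => ω v, fun _ => rfl⟩

theorem pairwise_disjoint_event (W : Finset (S × ℤ)) :
    Pairwise (Function.onFun Disjoint fun w : ∀ v : W, Ω v => event W w) := by
  intro w w' hne
  rw [Function.onFun, Set.disjoint_left]
  intro ω h h'
  exact hne (funext fun v => (h v).symm.trans (h' v))

variable [Fintype S] [∀ v, Nonempty (Ω v)]

/-- On the event that the window has the value `w`, `h` is a function of the past alone, and there
the restriction of `P` to this event has density `factorProduct κ ∅ W w` with respect to `P`.
Summing over `w` gives the formula. -/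
theorem IsCompatible.lintegral_eq {κ : Mechanisms G Ω} {P : Measure (∀ v, Ω v)}
    (hP : IsCompatible G κ P) (ξ : ∀ v, Ω v) (a b : ℤ) {h : (∀ v, Ω v) → ℝ≥0∞} (hh : Measurable h)
    (hd : DependsOn h {v | v.2 ≤ b}) :
    ∫⁻ ω, h ω ∂P
      = ∫⁻ ω, margProd (factor κ ξ fun _ => ∅) (window a b) h ω ∂P := by
  classical
  set W : Finset (S × ℤ) := window a b with hW
  have key : ∀ w : ∀ v : W, Ω v, ∫⁻ ω in event W w, h ω ∂P
      = ∫⁻ ω, h (Function.updateFinset ω W w) * factorProduct κ ∅ W w ω ∂P := by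
    intro w
    set g : (∀ v, Ω v) → ℝ≥0∞ := fun ω => h (Function.updateFinset ω W w) with hg
    have hgm : Measurable g := hh.comp measurable_updateFinset_left
    have hgd : DependsOn g {v | v.2 < a} := by
      intro ω ω' hωω'
      refine hd fun i hi => ?_
      simp only [Function.updateFinset]
      split_ifs with hiW
      · rfl
      · refine hωω' i ?_
        rw [hW, mem_window] at hiW
        have : i.2 ≤ b := hi
        show i.2 < a
        by_contra hlt
        exact hiW ⟨not_lt.1 hlt, this⟩
    have hgm' := measurable_cylinderEvents_of_dependsOn hgm hgd
    have hm : cylinderEvents (X := Ω) {v : S × ℤ | v.2 < a} ≤ MeasurableSpace.pi :=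
      cylinderEvents_le_pi
    have h1 : ∫⁻ ω in event W w, h ω ∂P = ∫⁻ ω in event W w, g ω ∂P := by
      refine setLIntegral_congr_fun (measurableSet_event _ _) fun ω hω => ?_
      simp only [hg]
      congr 1
      funext v
      simp only [Function.updateFinset]
      split_ifs with hv
      · exact hω ⟨v, hv⟩
      · rfl
    -- The two measures need only agree on events of the past, which is what the factorization
    -- supplies.
    have h2 : (P.restrict (event W w)).trim hm = (P.withDensity (factorProduct κ ∅ W w)).trim hm := by
      refine @Measure.ext _ (_) _ _ fun B hB => ?_
      rw [trim_measurableSet_eq hm hB, trim_measurableSet_eq hm hB,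
        Measure.restrict_apply (hm _ hB), withDensity_apply _ (hm _ hB)]
      exact hP.factorization a b B hB w
    rw [h1, ← lintegral_trim hm hgm', h2, lintegral_trim hm hgm',
      lintegral_withDensity_eq_lintegral_mul _ (measurable_factorProduct κ ξ W w) hgm]
    exact lintegral_congr fun ω => mul_comm _ _
  calc ∫⁻ ω, h ω ∂P = ∑' w : ∀ v : W, Ω v, ∫⁻ ω in event W w, h ω ∂P := by
        rw [← lintegral_iUnion (fun w => measurableSet_event W w) (pairwise_disjoint_event W),
          iUnion_event, setLIntegral_univ]
    _ = ∑' w : ∀ v : W, Ω v,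
          ∫⁻ ω, h (Function.updateFinset ω W w) * factorProduct κ ∅ W w ω ∂P :=
        tsum_congr key
    _ = ∫⁻ ω, ∑' w : ∀ v : W, Ω v, h (Function.updateFinset ω W w) * factorProduct κ ∅ W w ω ∂P :=
        (lintegral_tsum fun w =>
          ((hh.comp measurable_updateFinset_left).mul (measurable_factorProduct κ ξ W w)).aemeasurable).symm
    _ = _ := by
        refine lintegral_congr fun ω => ?_
        rw [margProd, lmarginal_count]
        simp_rw [prod_factor_update]

theorem prod_doFactor_update (κ : Mechanisms G Ω) (ξ ω : ∀ v, Ω v) {X W : Finset (S × ℤ)}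
    (w : ∀ v : W, Ω v) (hw : ∀ (v : W), (v : S × ℤ) ∈ X → w v = ξ v) :
    ∏ v ∈ W, doFactor κ ξ X (fun _ => ∅) v (Function.updateFinset ω W w)
      = factorProduct κ X W w ω := by
  classical
  rw [← Finset.prod_coe_sort]
  unfold factorProduct
  refine Finset.prod_congr rfl fun v _ => ?_
  have hv : Function.updateFinset ω W w v = w v := by simp [Function.updateFinset]
  simp only [doFactor, factor, Set.mem_empty_iff_false, if_false, splice_eq_updateFinset, hv]
  split_ifs with h1 h2
  · rfl
  · exact absurd (hw v h1) h2
  · rfl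

theorem cutGraph_le (C : S × ℤ → Set (S × ℤ)) (u v : S × ℤ) (h : (cutGraph G C).Adj u v) :
    G.Adj u v := h.1

/-- The time span in the definition may be enlarged to any window that contains `X` and `Y`: later
variables are summed out, and earlier ones are not intervened on, so drawing them from their factors
reproduces `P`. This allows one window for `X`, `Y` and `Z`. -/
theorem doProb_eq {κ : Mechanisms G Ω} {P : Measure (∀ v, Ω v)} (hG : IsFTCG G)
    (hP : IsCompatible G κ P) {X Y : Finset (S × ℤ)} (ξ ξ' : ∀ v, Ω v) {a b : ℤ}
    (hX : X ⊆ window a b) (hY : Y ⊆ window a b) :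
    doProb κ P X Y (fun v => ξ v) (fun v => ξ' v)
      = ∫⁻ ω, margProd (doFactor κ ξ X fun _ => ∅) (window a b) (eventInd Y ξ') ω ∂P := by
  classical
  have := hP.isProbabilityMeasure
  have hφ := isFactorSystem_doFactor hG.acyclic hP.isMarkovKernel ξ X fun _ => ∅
  have hcut : IsAcyclic (cutGraph G fun _ => ∅) := hG.acyclic.mono (cutGraph_le _)
  have hXT : X ⊆ timeSpan (X ∪ Y) := fun v hv => by
    simp only [timeSpan, Finset.mem_biUnion, mem_window]
    exact ⟨v, by simp [hv], v, by simp [hv], le_rfl, le_rfl⟩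
  have hYT : Y ⊆ timeSpan (X ∪ Y) := fun v hv => by
    simp only [timeSpan, Finset.mem_biUnion, mem_window]
    exact ⟨v, by simp [hv], v, by simp [hv], le_rfl, le_rfl⟩
  have step1 : doProb κ P X Y (fun v => ξ v) (fun v => ξ' v)
      = ∫⁻ ω, margProd (doFactor κ ξ X fun _ => ∅) (timeSpan (X ∪ Y)) (eventInd Y ξ') ω ∂P := by
    unfold doProb
    generalize timeSpan (X ∪ Y) = T at hXT hYT
    refine (tsum_subtype {w : ∀ v : T, Ω v | (∀ (v : T) (_ : (v : S × ℤ) ∈ X), w v = ξ v) ∧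
      ∀ (v : T) (_ : (v : S × ℤ) ∈ Y), w v = ξ' v}
      fun w => ∫⁻ ω, factorProduct κ X T w ω ∂P).trans ?_
    simp_rw [margProd, lmarginal_count]
    have hmeas : ∀ w : ∀ v : T, Ω v, Measurable fun ω : ∀ v, Ω v =>
        eventInd Y ξ' (Function.updateFinset ω T w) *
          ∏ v ∈ T, doFactor κ ξ X (fun _ => ∅) v (Function.updateFinset ω T w) := fun w =>
      ((measurable_eventInd Y ξ').mul (hφ.measurable_prod T)).comp measurable_updateFinset_left
    rw [lintegral_tsum fun w => (hmeas w).aemeasurable]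
    refine tsum_congr fun w => ?_
    have hupd : ∀ (ω : ∀ v, Ω v) (v : S × ℤ) (hv : v ∈ T),
        Function.updateFinset ω T w v = w ⟨v, hv⟩ := fun ω v hv => by
      simp [Function.updateFinset, hv]
    by_cases hw : (∀ (v : T) (_ : (v : S × ℤ) ∈ X), w v = ξ v) ∧
        ∀ (v : T) (_ : (v : S × ℤ) ∈ Y), w v = ξ' v
    · rw [Set.indicator_of_mem (by exact hw)]
      refine lintegral_congr fun ω => ?_
      have h1 : eventInd Y ξ' (Function.updateFinset ω T w) = 1 := by
        rw [eventInd_apply, if_pos]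
        intro v hv
        rw [hupd ω v (hYT hv)]
        exact hw.2 ⟨v, hYT hv⟩ hv
      rw [prod_doFactor_update κ ξ ω w hw.1, h1, one_mul]
    · rw [Set.indicator_of_notMem (by exact hw)]
      symm
      rw [lintegral_eq_zero_iff (hmeas w)]
      refine Filter.Eventually.of_forall fun ω => ?_
      simp only [Pi.zero_apply, mul_eq_zero]
      by_cases hX' : ∀ (v : T) (_ : (v : S × ℤ) ∈ X), w v = ξ v
      · left
        rw [eventInd_apply, if_neg]
        intro h
        refine hw ⟨hX', fun v hv => ?_⟩
        rw [← h v hv, hupd ω v v.2]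
      · right
        push Not at hX'
        obtain ⟨v, hv, hne⟩ := hX'
        refine Finset.prod_eq_zero v.2 ?_
        rw [doFactor, if_pos hv, hupd ω v v.2, if_neg hne]
  rw [step1]
  have hindY : ∀ W : Finset (S × ℤ), DependsOn (eventInd Y ξ')
      {v | v ∈ W → v ∈ timeSpan (X ∪ Y)} := fun W =>
    (dependsOn_eventInd Y ξ').mono fun v hv _ => hYT hv
  rcases (X ∪ Y).eq_empty_or_nonempty with hE | hne
  · have hT : timeSpan (X ∪ Y) = ∅ := by rw [hE]; rfl
    rw [hφ.margProd_eq hcut (A := timeSpan (X ∪ Y)) (W := window a b) (by rw [hT]; simp)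
      (by rw [hT]; simp) (measurable_eventInd Y ξ') (hindY _)]
  · obtain ⟨a', b', hT, u₁, hu₁, u₂, hu₂, rfl, rfl, hle⟩ := exists_timeSpan_eq_window hne
    have hsub : X ∪ Y ⊆ window a b := Finset.union_subset hX hY
    have ha := (mem_window.1 (hsub hu₁)).1
    have hb := (mem_window.1 (hsub hu₂)).2
    have h12 := (hle u₁ hu₁).2
    have hA : timeSpan (X ∪ Y) ⊆ window u₁.2 b := by
      rw [hT]
      intro v hv
      rw [mem_window] at hv ⊢
      omega
    rw [← hφ.margProd_eq hcut (A := timeSpan (X ∪ Y)) (W := window u₁.2 b) hA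
      (fun u v huv hv hu => by
        rw [hT, mem_window] at hv ⊢
        rw [mem_window] at hu
        have := hG.forward u v huv.1
        omega) (measurable_eventInd Y ξ') (hindY _)]
    -- Once all times from `u₁.2` on are summed out, only the strict past is left, so
    -- `IsCompatible.lintegral_eq` applies to the window that ends at `u₁.2 - 1`.
    have hlow : DependsOn (margProd (doFactor κ ξ X fun _ => ∅) (window u₁.2 b) (eventInd Y ξ'))
        {v : S × ℤ | v.2 ≤ u₁.2 - 1} := by
      refine (dependsOn_lmarginal (A := {v : S × ℤ | v.2 ≤ b}) (dependsOn_mul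
        ((dependsOn_eventInd Y ξ').mono fun v hv => (mem_window.1 (hY hv)).2)
        (dependsOn_prod fun v hv => (hφ.dependsOn v).mono ?_))).mono ?_
      · rintro u (rfl | hu)
        · exact (mem_window.1 hv).2
        · exact (hG.forward u v hu.1).trans (mem_window.1 hv).2
      · rintro v ⟨hv, hv'⟩
        have h1 : v.2 ≤ b := hv
        have h2 : ¬ (u₁.2 ≤ v.2 ∧ v.2 ≤ b) := fun h => hv' (mem_window.2 h)
        show v.2 ≤ u₁.2 - 1
        omega
    rw [hP.lintegral_eq ξ a (u₁.2 - 1)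
      (hφ.measurable_margProd _ (measurable_eventInd Y ξ')) hlow]
    have hdisj : Disjoint (window (S := S) a (u₁.2 - 1)) (window u₁.2 b) := by
      rw [Finset.disjoint_left]
      intro v hv hv'
      rw [mem_window] at hv hv'
      omega
    rw [← window_union (S := S) ha (c := b) (by omega), ← margProd_margProd hφ hdisj
      (fun u v huv hv hu => by
        rw [mem_window] at hv hu
        have := hG.forward u v huv.1
        omega) (measurable_eventInd Y ξ')]
    refine lintegral_congr fun ω => ?_
    unfold margProd
    congr 1
    funext η
    congr 1
    refine Finset.prod_congr rfl fun v hv => ?_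
    have : v ∉ X := fun hvX => by
      have := (hle v (by simp [hvX])).1
      rw [mem_window] at hv
      omega
    rw [doFactor, if_neg this]

end Law

end SCGAdjustment

namespace SCGAdjustment

/-! ### Separation implies the adjustment formula -/

section LinkedAncestors

variable {V : Type*} {H : Digraph V} {X Y Z : Set V}

/-- The open ancestors of the vertices that are linked to `Y`. -/
def linkedAnc (H : Digraph V) (Y Z : Set V) : Set V :=
  {v | ∃ t, Linked H Y Z t ∧ v ∈ openAnc H Z t}

/-- The ancestors of `X ∪ Y ∪ Z`. -/
def allAnc (H : Digraph V) (X Y Z : Set V) : Set V :=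
  {v | ∃ t ∈ X ∪ Y ∪ Z, IsDescendant H v t}

theorem Linked.mem {t : V} (ht : Linked H Y Z t) : t ∈ Y ∪ Z := by
  cases ht with
  | base h => exact .inl h
  | step _ h _ _ => exact .inr h

theorem isDescendant_of_mem_openAnc {s t : V} (h : s ∈ openAnc H Z t) : IsDescendant H s t :=
  h.2.lift id fun _ _ h => h.1

theorem notMem_of_mem_linkedAnc {v : V} (h : v ∈ linkedAnc H Y Z) : v ∉ Z := by
  obtain ⟨t, -, h⟩ := h
  exact h.1

theorem linkedAnc_subset_allAnc : linkedAnc H Y Z ⊆ allAnc H X Y Z := by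
  rintro v ⟨t, ht, hv⟩
  refine ⟨t, ?_, isDescendant_of_mem_openAnc hv⟩
  rcases ht.mem with h | h
  · exact .inl (.inr h)
  · exact .inr h

theorem mem_allAnc_of_adj {u v : V} (huv : H.Adj u v) (hv : v ∈ allAnc H X Y Z) :
    u ∈ allAnc H X Y Z := by
  obtain ⟨t, ht, h⟩ := hv
  exact ⟨t, ht, .head huv h⟩

/-- If `u` is linked, follow `v` to its first open target. That target is not in `X`, as this would
be a connection; if in `Y` it is linked by definition, and if in `Z` it is linked through the common
ancestor `u`. -/
theorem mem_linkedAnc_iff_of_adj (hC : ¬ IsConnected H X Y Z) {u v : V} (hv : v ∉ Z) (hu : u ∉ Z)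
    (hvA : v ∈ allAnc H X Y Z) (huv : H.Adj u v) :
    u ∈ linkedAnc H Y Z ↔ v ∈ linkedAnc H Y Z := by
  constructor
  · rintro ⟨t, ht, hut⟩
    obtain ⟨t', ht', hvt'⟩ := hvA
    obtain ⟨t'', ht'', hvt''⟩ := exists_open_of_isDescendant (Z := Z) Set.subset_union_right ht' hvt'
    have hut'' : u ∈ openAnc H Z t'' := mem_openAnc_of_adj hu huv hvt''
    refine ⟨t'', ?_, hv, hvt''⟩
    rcases ht'' with (h | h) | h
    · exact absurd ⟨t'', h, t, u, ht, hut'', hut⟩ hC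
    · exact .base h
    · exact .step ht h hut hut''
  · rintro ⟨t, ht, hvt⟩
    exact ⟨t, ht, mem_openAnc_of_adj hu huv hvt.2⟩

/-- The parents of an element `v` of `Z` have `v` as a common target, so one linked parent links `v`
and with it all parents outside `Z`. -/
theorem mem_linkedAnc_of_adj_mem {u u' v : V} (hv : v ∈ Z) (hu' : u' ∉ Z)
    (huv : H.Adj u v) (hu'v : H.Adj u' v) (hu : u ∈ linkedAnc H Y Z) : u' ∈ linkedAnc H Y Z := by
  obtain ⟨t, ht, hut⟩ := hu
  exact ⟨v, .step ht hv hut (mem_openAnc_of_adj hut.1 huv .refl), mem_openAnc_of_adj hu' hu'v .refl⟩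

end LinkedAncestors

noncomputable section Soundness

variable {S : Type*} [DecidableEq S] {Ω : S × ℤ → Type*} [∀ v, MeasurableSpace (Ω v)]
  {G : Digraph (S × ℤ)} [∀ v, DiscreteMeasurableSpace (Ω v)] [∀ v, Countable (Ω v)]
  [Fintype S] [∀ v, Nonempty (Ω v)]

theorem lmarginal_eventInd_mul {Z : Finset (S × ℤ)} (ζ : ∀ v, Ω v) (f : (∀ v, Ω v) → ℝ≥0∞)
    (ω : ∀ v, Ω v) :
    lmarginal (fun _ => Measure.count) Z (fun η => eventInd Z ζ η * f η) ω
      = f (Function.updateFinset ω Z fun v => ζ v) := by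
  classical
  rw [lmarginal_count, tsum_eq_single fun v : Z => ζ v]
  · rw [eventInd_apply, if_pos, one_mul]
    intro v hv
    simp [Function.updateFinset, hv]
  · intro w hw
    rw [eventInd_apply, if_neg, zero_mul]
    intro h
    refine hw (funext fun v => ?_)
    rw [← h v v.2]
    simp [Function.updateFinset]

/-- Conditional independence of `X` and `Y` given `Z`, without division. With `U` the set of open
ancestors of linked vertices, no factor involves both a vertex of `U` and a vertex outside `U ∪ Z`.
Once `Z` is fixed to `ζ`, the sum over the window is therefore a product of two functions of the
past, which live on disjoint ancestral sets and are independent. -/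
theorem exists_lintegral_margProd_eq_mul {H : Digraph (S × ℤ)} {P : Measure (∀ v, Ω v)}
    (hG : IsFTCG G) (hHG : ∀ u v, H.Adj u v → G.Adj u v)
    (hind : ∀ A B : Set (S × ℤ), IsAncestral G A → IsAncestral G B → Disjoint A B →
      Indep (cylinderEvents A) (cylinderEvents B) P)
    {X Y Z : Finset (S × ℤ)} {a b : ℤ} (hX : X ⊆ window a b) (hY : Y ⊆ window a b)
    (hZ : Z ⊆ window a b) (hYZ : Disjoint Y Z)
    (hpast : ∀ u v, G.Adj u v → u.2 < a → H.Adj u v)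
    (hC : ¬ IsConnected H (X : Set (S × ℤ)) Y Z)
    {φ : ∀ _ : S × ℤ, (∀ v, Ω v) → ℝ≥0∞} (hφ : IsFactorSystem H φ) (ζ : ∀ v, Ω v) :
    ∃ Φ Ψ : ((∀ v, Ω v) → ℝ≥0∞) → ℝ≥0∞, ∀ h₁ h₂, Measurable h₁ → Measurable h₂ →
      DependsOn h₁ (X : Set (S × ℤ)) → DependsOn h₂ (Y : Set (S × ℤ)) →
      ∫⁻ ω, margProd φ (window a b) (fun η => eventInd Z ζ η * (h₁ η * h₂ η)) ω ∂P
        = Φ h₁ * Ψ h₂ := by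
  classical
  have hH : IsAcyclic H := hG.acyclic.mono hHG
  set U : Set (S × ℤ) := linkedAnc H (Y : Set (S × ℤ)) Z with hU
  set N : Set (S × ℤ) := allAnc H (X : Set (S × ℤ)) Y Z with hN
  have hNb : ∀ v ∈ N, v.2 ≤ b := by
    rintro v ⟨t, ht, hvt⟩
    have h1 : t.2 ≤ b := by
      rcases ht with (h | h) | h
      · exact (mem_window.1 (hX h)).2
      · exact (mem_window.1 (hY h)).2
      · exact (mem_window.1 (hZ h)).2
    refine le_trans ?_ h1
    clear ht h1
    induction hvt with
    | refl => rfl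
    | tail _ h ih => exact ih.trans (hG.forward _ _ (hHG _ _ h))
  have hUN : U ⊆ N := linkedAnc_subset_allAnc
  have hUZ : ∀ v ∈ U, v ∉ Z := fun v hv => notMem_of_mem_linkedAnc hv
  have hXU : ∀ v ∈ X, v ∉ U := by
    rintro v hv ⟨t, ht, hvt⟩
    exact hC ⟨v, hv, t, v, ht, self_mem_openAnc hvt.1, hvt⟩
  have hYU : ∀ v ∈ Y, v ∈ U := fun v hv =>
    ⟨v, .base hv, self_mem_openAnc fun h => Finset.disjoint_left.1 hYZ hv h⟩
  set A : Finset (S × ℤ) := (window a b).filter (· ∈ N) with hA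
  set A₂ : Finset (S × ℤ) := A.filter (· ∈ U) with hA₂
  set A₁ : Finset (S × ℤ) := A.filter fun v => v ∉ U ∧ v ∉ Z with hA₁
  have hZN : ∀ v ∈ Z, v ∈ N := fun v hv => ⟨v, .inr hv, .refl⟩
  have hXN : ∀ v ∈ X, v ∈ N := fun v hv => ⟨v, .inl (.inl hv), .refl⟩
  have hYN : ∀ v ∈ Y, v ∈ N := fun v hv => ⟨v, .inl (.inr hv), .refl⟩
  have hsplit : A = Z ∪ (A₁ ∪ A₂) := by
    ext v
    simp only [hA₁, hA₂, hA, Finset.mem_union, Finset.mem_filter]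
    constructor
    · rintro ⟨h1, h2⟩
      by_cases hvZ : v ∈ Z
      · exact .inl hvZ
      · by_cases hvU : v ∈ U <;> tauto
    · rintro (h | ⟨h, -⟩ | ⟨h, -⟩)
      · exact ⟨hZ h, hZN v h⟩
      · exact h
      · exact h
  have hd₁ : Disjoint Z (A₁ ∪ A₂) := by
    rw [Finset.disjoint_left]
    intro v hv hv'
    rcases Finset.mem_union.1 hv' with h | h
    · exact (Finset.mem_filter.1 h).2.2 hv
    · exact hUZ v (Finset.mem_filter.1 h).2 hv
  have hd₂ : Disjoint A₁ A₂ := by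
    rw [Finset.disjoint_left]
    intro v hv hv'
    exact (Finset.mem_filter.1 hv).2.1 (Finset.mem_filter.1 hv').2
  -- `q` marks the factors that involve a vertex of `U`. An element of `Z` may have its factor on
  -- either side, decided by its parents.
  set q : S × ℤ → Prop := fun v => ∃ w ∈ insert v {u | H.Adj u v}, w ∈ U with hq
  have hB₂ : ∀ v ∈ A.filter q, insert v {u | H.Adj u v} ⊆ U ∪ Z := by
    intro v hv u hu
    obtain ⟨hvA, w, hw, hwU⟩ := Finset.mem_filter.1 hv
    have hvN : v ∈ N := (Finset.mem_filter.1 hvA).2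
    by_cases huZ : u ∈ Z
    · exact .inr huZ
    left
    by_cases hvZ : v ∈ Z
    · rcases hw with rfl | hw
      · exact absurd hvZ (hUZ w hwU)
      rcases hu with rfl | hu
      · exact absurd hvZ huZ
      exact mem_linkedAnc_of_adj_mem hvZ huZ hw hu hwU
    · have hvU : v ∈ U := by
        rcases hw with rfl | hw
        · exact hwU
        · exact (mem_linkedAnc_iff_of_adj hC hvZ (hUZ w hwU) hvN hw).1 hwU
      rcases hu with rfl | hu
      · exact hvU
      · exact (mem_linkedAnc_iff_of_adj hC hvZ huZ hvN hu).2 hvU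
  have hB₁ : ∀ v ∈ A.filter (¬ q ·), insert v {u | H.Adj u v} ⊆ N \ U := by
    intro v hv u hu
    obtain ⟨hvA, hvq⟩ := Finset.mem_filter.1 hv
    have hvN : v ∈ N := (Finset.mem_filter.1 hvA).2
    refine ⟨?_, fun h => hvq ⟨u, hu, h⟩⟩
    rcases hu with rfl | hu
    · exact hvN
    · exact mem_allAnc_of_adj hu hvN
  let σ : (∀ v, Ω v) → ∀ v, Ω v := fun ω => Function.updateFinset ω Z fun v => ζ v
  have hσ : Measurable σ := measurable_updateFinset_left
  let f₁ : ((∀ v, Ω v) → ℝ≥0∞) → (∀ v, Ω v) → ℝ≥0∞ := fun h η =>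
    h η * ∏ v ∈ A.filter (¬ q ·), φ v η
  let f₂ : ((∀ v, Ω v) → ℝ≥0∞) → (∀ v, Ω v) → ℝ≥0∞ := fun h η => h η * ∏ v ∈ A.filter q, φ v η
  refine ⟨fun h => ∫⁻ ω, lmarginal (fun _ => Measure.count) A₁ (f₁ h) (σ ω) ∂P,
    fun h => ∫⁻ ω, lmarginal (fun _ => Measure.count) A₂ (f₂ h) (σ ω) ∂P,
    fun h₁ h₂ hm₁ hm₂ hD₁ hD₂ => ?_⟩
  have hf₁ : Measurable (f₁ h₁) := hm₁.mul (hφ.measurable_prod _)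
  have hf₂ : Measurable (f₂ h₂) := hm₂.mul (hφ.measurable_prod _)
  have hDf₁ : DependsOn (f₁ h₁) (N \ U) :=
    dependsOn_mul (hD₁.mono fun v hv => ⟨hXN v hv, hXU v hv⟩)
      (dependsOn_prod fun v hv => (hφ.dependsOn v).mono (hB₁ v hv))
  have hDf₂ : DependsOn (f₂ h₂) (U ∪ Z) :=
    dependsOn_mul (hD₂.mono fun v hv => .inl (hYU v hv))
      (dependsOn_prod fun v hv => (hφ.dependsOn v).mono (hB₂ v hv))
  have hpt : ∀ ω, margProd φ (window a b) (fun η => eventInd Z ζ η * (h₁ η * h₂ η)) ω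
      = lmarginal (fun _ => Measure.count) A₁ (f₁ h₁) (σ ω) *
        lmarginal (fun _ => Measure.count) A₂ (f₂ h₂) (σ ω) := by
    intro ω
    have hmeas : Measurable fun η => eventInd Z ζ η * (h₁ η * h₂ η) :=
      (measurable_eventInd Z ζ).mul (hm₁.mul hm₂)
    rw [hφ.margProd_eq hH (A := A) (Finset.filter_subset _ _)
      (fun u v huv hv hu => Finset.mem_filter.2 ⟨hu, mem_allAnc_of_adj huv (Finset.mem_filter.1 hv).2⟩)
      hmeas]
    · have h1 : (fun η => eventInd Z ζ η * (h₁ η * h₂ η) * ∏ v ∈ A, φ v η)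
          = fun η => (f₁ h₁ η * f₂ h₂ η) * eventInd Z ζ η := by
        funext η
        rw [← Finset.prod_filter_mul_prod_filter_not A q]
        simp only [f₁, f₂]
        ring
      have h2 : ∀ η, lmarginal (fun _ => Measure.count) (A₁ ∪ A₂)
            (fun η => (f₁ h₁ η * f₂ h₂ η) * eventInd Z ζ η) η
          = eventInd Z ζ η * lmarginal (fun _ => Measure.count) (A₁ ∪ A₂)
            (fun η => f₁ h₁ η * f₂ h₂ η) η := by
        intro η
        rw [lmarginal_mul_of_dependsOn ((dependsOn_eventInd Z ζ).mono
          fun v hv => Finset.disjoint_left.1 hd₁ hv), mul_comm]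
      rw [margProd, h1, hsplit, lmarginal_union _ _ ((hf₁.fun_mul hf₂).fun_mul (measurable_eventInd Z ζ)) hd₁]
      rw [show lmarginal (fun _ => Measure.count) (A₁ ∪ A₂)
        (fun η => (f₁ h₁ η * f₂ h₂ η) * eventInd Z ζ η) = _ from funext h2, lmarginal_eventInd_mul]
      change lmarginal _ _ _ (σ ω) = _
      rw [lmarginal_union _ _ (hf₁.fun_mul hf₂) hd₂]
      have h3 : lmarginal (fun _ => Measure.count) A₂ (fun η => f₁ h₁ η * f₂ h₂ η)
          = fun η => f₁ h₁ η * lmarginal (fun _ => Measure.count) A₂ (f₂ h₂) η := by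
        funext η
        simp_rw [mul_comm (f₁ h₁ _)]
        rw [lmarginal_mul_of_dependsOn (hDf₁.mono ?_)]
        rintro v ⟨-, hv⟩ hv'
        exact hv (Finset.mem_filter.1 hv').2
      rw [h3, lmarginal_mul_of_dependsOn ((dependsOn_lmarginal hDf₂).mono ?_)]
      rintro v ⟨hv, -⟩ hv'
      obtain ⟨-, h, h'⟩ := Finset.mem_filter.1 hv'
      exact hv.elim h h'
    · refine dependsOn_mul ((dependsOn_eventInd Z ζ).mono fun v hv hv' =>
        Finset.mem_filter.2 ⟨hv', hZN v hv⟩) (dependsOn_mul (hD₁.mono fun v hv hv' =>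
        Finset.mem_filter.2 ⟨hv', hXN v hv⟩) (hD₂.mono fun v hv hv' =>
        Finset.mem_filter.2 ⟨hv', hYN v hv⟩))
  simp_rw [hpt]
  have hσd : ∀ (f : (∀ v, Ω v) → ℝ≥0∞) (B : Set (S × ℤ)), DependsOn f B →
      DependsOn (fun ω => f (σ ω)) (B \ Z) := by
    intro f B hf ω ω' h
    refine hf fun i hi => ?_
    simp only [σ, Function.updateFinset]
    split_ifs with hiZ
    · rfl
    · exact h i ⟨hi, hiZ⟩
  have hpastmem : ∀ v ∈ N, v ∉ A → v.2 < a := by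
    intro v hv hvA
    by_contra hlt
    exact hvA (Finset.mem_filter.2 ⟨mem_window.2 ⟨not_lt.1 hlt, hNb v hv⟩, hv⟩)
  have hpastZ : ∀ v : S × ℤ, v.2 < a → v ∉ Z := fun v hv h =>
    absurd (mem_window.1 (hZ h)).1 (not_le.2 hv)
  -- Before time `a` there are no vertices of `Z` and no removed edges, so membership in `U` is
  -- constant along the edges to ancestors; both sets are ancestral in `G`, not only in `H`.
  have hI := hind {v | v ∈ N \ U ∧ v.2 < a} {v | v ∈ U ∧ v.2 < a} ?_ ?_ ?_
  · refine lintegral_mul_eq_lintegral_mul_lintegral_of_independent_measurableSpace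
      cylinderEvents_le_pi cylinderEvents_le_pi hI ?_ ?_
    · refine measurable_cylinderEvents_of_dependsOn ((Measurable.lmarginal _ hf₁).comp hσ)
        ((hσd _ _ (dependsOn_lmarginal hDf₁)).mono ?_)
      rintro v ⟨⟨hv, hvA₁⟩, hvZ⟩
      refine ⟨hv, hpastmem v hv.1 fun hvA => hvA₁ (Finset.mem_filter.2 ⟨hvA, hv.2, hvZ⟩)⟩
    · refine measurable_cylinderEvents_of_dependsOn ((Measurable.lmarginal _ hf₂).comp hσ)
        ((hσd _ _ (dependsOn_lmarginal hDf₂)).mono ?_)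
      rintro v ⟨⟨hv, hvA₂⟩, hvZ⟩
      have hvU : v ∈ U := hv.resolve_right hvZ
      exact ⟨hvU, hpastmem v (hUN hvU) fun hvA => hvA₂ (Finset.mem_filter.2 ⟨hvA, hvU⟩)⟩
  · rintro u v huv ⟨hv, hva⟩
    have hua : u.2 < a := (hG.forward u v huv).trans_lt hva
    have huvH := hpast u v huv hua
    refine ⟨⟨mem_allAnc_of_adj huvH hv.1, fun hu => hv.2 ?_⟩, hua⟩
    exact (mem_linkedAnc_iff_of_adj hC (hpastZ v hva) (hpastZ u hua) hv.1 huvH).1 hu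
  · rintro u v huv ⟨hv, hva⟩
    have hua : u.2 < a := (hG.forward u v huv).trans_lt hva
    exact ⟨(mem_linkedAnc_iff_of_adj hC (hpastZ v hva) (hpastZ u hua) (hUN hv)
      (hpast u v huv hua)).2 hv, hua⟩
  · rw [Set.disjoint_left]
    exact fun v hv hv' => hv.1.2 hv'.1

/-! ### From the product form to the adjustment formula -/

theorem event_eq_restrict {A : Finset (S × ℤ)} (z : ∀ v : A, Ω v) (ξ : ∀ v, Ω v) :
    event A z = event A fun v => Function.updateFinset ξ A z v := by
  congr 1
  funext v
  simp [Function.updateFinset]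

theorem adjustedProb_eq_tsum {P : Measure (∀ v, Ω v)} [IsProbabilityMeasure P]
    (X Y Z : Finset (S × ℤ)) (x : ∀ v : X, Ω v) (y : ∀ v : Y, Ω v) :
    adjustedProb P X Y Z x y
      = ∑' z : ∀ v : Z, Ω v, cond P (event X x ∩ event Z z) (event Y y) * P (event Z z) := by
  unfold adjustedProb
  split_ifs with hZ
  · subst hZ
    have h : ∀ z : ∀ v : (∅ : Finset (S × ℤ)), Ω v, event ∅ z = Set.univ := fun z =>
      Set.eq_univ_of_forall fun ω v => absurd v.2 (Finset.notMem_empty _)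
    simp only [h, Set.inter_univ, measure_univ, mul_one]
    have : Unique (∀ v : (∅ : Finset (S × ℤ)), Ω v) :=
      ⟨⟨fun v => absurd v.2 (Finset.notMem_empty _)⟩,
        fun z => funext fun v => absurd v.2 (Finset.notMem_empty _)⟩
    rw [tsum_fintype, Fintype.sum_unique]
  · rfl

theorem tsum_eventInd (A : Finset (S × ℤ)) (ξ η : ∀ v, Ω v) :
    ∑' z : ∀ v : A, Ω v, eventInd A (Function.updateFinset ξ A z) η = 1 := by
  classical
  rw [tsum_eq_single fun v : A => η v]
  · rw [eventInd_apply, if_pos]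
    intro v hv
    simp [Function.updateFinset, hv]
  · intro z hz
    rw [eventInd_apply, if_neg]
    intro h
    refine hz (funext fun v => ?_)
    rw [h v v.2]
    simp [Function.updateFinset]

theorem tsum_lintegral_margProd {D : Digraph (S × ℤ)} {φ : ∀ _ : S × ℤ, (∀ v, Ω v) → ℝ≥0∞}
    (hφ : IsFactorSystem D φ) (P : Measure (∀ v, Ω v)) (W A : Finset (S × ℤ)) (ξ : ∀ v, Ω v)
    {h : (∀ v, Ω v) → ℝ≥0∞} (hh : Measurable h) :
    ∑' z : ∀ v : A, Ω v,
        ∫⁻ ω, margProd φ W (fun η => eventInd A (Function.updateFinset ξ A z) η * h η) ω ∂P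
      = ∫⁻ ω, margProd φ W h ω ∂P := by
  rw [← lintegral_tsum fun z => (hφ.measurable_margProd W
    ((measurable_eventInd A _).fun_mul hh)).aemeasurable]
  refine lintegral_congr fun ω => ?_
  simp_rw [margProd, lmarginal_count]
  rw [ENNReal.tsum_comm]
  refine tsum_congr fun w => ?_
  simp_rw [mul_assoc]
  rw [ENNReal.tsum_mul_right, tsum_eventInd, one_mul]

theorem factor_congr_of_eq {κ : Mechanisms G Ω} {ξ η : ∀ v, Ω v} {C : S × ℤ → Set (S × ℤ)}
    {v : S × ℤ} (h : ∀ u, G.Adj u v → u ∈ C v → η u = ξ u) :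
    factor κ ξ C v η = factor κ ξ (fun _ => ∅) v η := by
  unfold factor
  congr 2
  funext u
  simp only [Set.mem_empty_iff_false, if_false]
  split_ifs with hu
  · exact (h u u.2 hu).symm
  · rfl

theorem eventInd_mul_eventInd {A B : Finset (S × ℤ)} {ξ ξ' η : ∀ v, Ω v} :
    eventInd A ξ η * eventInd B ξ' η
      = ((event A fun v => ξ v) ∩ event B fun v => ξ' v).indicator 1 η := by
  rw [Set.inter_indicator_one]
  rfl

/-- Going back from `Y`, the path cannot enter `X`: the edge from an element of `X` to a causal node
has been removed. -/
theorem isCausalNode_of_isDescendant_backdoorGraph {V : Type*} {G : Digraph V} {X Y : Set V}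
    (hXY : Disjoint X Y) {v y : V} (hy : y ∈ Y) (h : IsDescendant (backdoorGraph G X Y) v y) :
    IsCausalNode G X Y v := by
  induction h using Relation.ReflTransGen.head_induction_on with
  | refl => exact ⟨fun h => Set.disjoint_left.1 hXY h hy, y, hy, .refl⟩
  | head hab _ ih =>
    refine ⟨fun ha => hab.2 ⟨ha, ih⟩, ?_⟩
    obtain ⟨hb, y', hy', h'⟩ := ih
    exact ⟨y', hy', .head ⟨hab.1, hb⟩ h'⟩

/-- The original, intervened and cut models (`hK`, `hM`, `hR`) are compared through `margProd` on
one window; the formula then follows term by term in `z` from the product form of the cut model. -/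
theorem doProb_eq_adjustedProb {κ : Mechanisms G Ω} {P : Measure (∀ v, Ω v)} (hG : IsFTCG G)
    (hP : IsCompatible G κ P) {X Y Z : Finset (S × ℤ)} (hXY : Disjoint X Y) (hYZ : Disjoint Y Z)
    (hF : AvoidsForbidden G (X : Set (S × ℤ)) Y Z)
    (hC : ¬ IsConnected (backdoorGraph G (X : Set (S × ℤ)) Y) (X : Set (S × ℤ)) Y Z)
    (x : ∀ v : X, Ω v) (y : ∀ v : Y, Ω v) (hx : IsAdmissible P X Z x) :
    doProb κ P X Y x y = adjustedProb P X Y Z x y := by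
  classical
  have := hP.isProbabilityMeasure
  obtain ⟨ξ, rfl⟩ : ∃ ξ : ∀ v, Ω v, x = fun v : X => ξ v :=
    ⟨Function.updateFinset (fun v => Classical.arbitrary _) X x, by
      funext v; simp [Function.updateFinset]⟩
  obtain ⟨υ, rfl⟩ : ∃ υ : ∀ v, Ω v, y = fun v : Y => υ v :=
    ⟨Function.updateFinset (fun v => Classical.arbitrary _) Y y, by
      funext v; simp [Function.updateFinset]⟩
  obtain ⟨a, b, hW⟩ := exists_window_superset (X ∪ Y ∪ Z)
  have hX : X ⊆ window a b := fun v hv => hW (by simp [hv])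
  have hY : Y ⊆ window a b := fun v hv => hW (by simp [hv])
  have hZ : Z ⊆ window a b := fun v hv => hW (by simp [hv])
  set W : Finset (S × ℤ) := window a b with hWdef
  let C : S × ℤ → Set (S × ℤ) := fun v =>
    {u | u ∈ (X : Set (S × ℤ)) ∧ IsCausalNode G (X : Set (S × ℤ)) Y v}
  have hcut : cutGraph G C = backdoorGraph G (X : Set (S × ℤ)) Y := rfl
  have hR := isFactorSystem_factor hG.acyclic hP.isMarkovKernel ξ C
  have hM := isFactorSystem_doFactor hG.acyclic hP.isMarkovKernel ξ X C
  have hK := isFactorSystem_factor hG.acyclic hP.isMarkovKernel ξ fun _ => ∅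
  have hacyc : ∀ C, IsAcyclic (cutGraph G C) := fun C => hG.acyclic.mono (cutGraph_le C)
  -- the law of the intervened variables, in the model where causal nodes read `ξ`
  have hdo : doProb κ P X Y (fun v => ξ v) (fun v => υ v)
      = ∫⁻ ω, margProd (factor κ ξ C) W (eventInd Y υ) ω ∂P := by
    rw [doProb_eq hG hP ξ υ hX hY]
    -- The point masses force `X` to its values in `ξ`, so reading those values off `ξ` changes
    -- nothing; otherwise both products vanish.
    have h1 : margProd (doFactor κ ξ X fun _ => ∅) W (eventInd Y υ)
        = margProd (doFactor κ ξ X C) W (eventInd Y υ) := by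
      unfold margProd
      congr 1
      funext η
      congr 1
      by_cases hη : ∀ u ∈ X, η u = ξ u
      · refine Finset.prod_congr rfl fun v _ => ?_
        unfold doFactor
        rw [factor_congr_of_eq (C := C) fun u _ hu => hη u hu.1]
      · push Not at hη
        obtain ⟨u, hu, hne⟩ := hη
        rw [Finset.prod_eq_zero (hX hu) (by rw [doFactor, if_pos hu, if_neg hne]),
          Finset.prod_eq_zero (hX hu) (by rw [doFactor, if_pos hu, if_neg hne])]
    rw [h1]
    -- The back-door ancestors of `Y` suffice for the law of `Y`. None of them is in `X`, so the
    -- intervened and the cut factors agree on them.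
    set A := W.filter fun v =>
      ∃ y ∈ (Y : Set (S × ℤ)), IsDescendant (backdoorGraph G (X : Set (S × ℤ)) Y) v y with hA
    have hAcl : ∀ u v, (cutGraph G C).Adj u v → v ∈ A → u ∈ W → u ∈ A := by
      intro u v huv hv hu
      obtain ⟨-, y, hy, hvy⟩ := Finset.mem_filter.1 hv
      exact Finset.mem_filter.2 ⟨hu, y, hy, .head huv hvy⟩
    have hdep : DependsOn (eventInd Y υ) {v | v ∈ W → v ∈ A} :=
      (dependsOn_eventInd Y υ).mono fun v hv hvW => Finset.mem_filter.2 ⟨hvW, v, hv, .refl⟩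
    rw [hM.margProd_eq (hacyc C) (A := A) (Finset.filter_subset _ _) hAcl
        (measurable_eventInd Y υ) hdep,
      hR.margProd_eq (hacyc C) (A := A) (Finset.filter_subset _ _) hAcl
        (measurable_eventInd Y υ) hdep]
    refine lintegral_congr fun ω => ?_
    unfold margProd
    congr 1
    funext η
    congr 1
    refine Finset.prod_congr rfl fun v hv => ?_
    obtain ⟨-, y, hy, hvy⟩ := Finset.mem_filter.1 hv
    have := (isCausalNode_of_isDescendant_backdoorGraph
      (Finset.disjoint_coe.2 hXY) hy hvy).1
    rw [doFactor, if_neg (by simpa using this)]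
  rw [hdo, adjustedProb_eq_tsum, ← tsum_lintegral_margProd hR P W Z ξ (measurable_eventInd Y υ)]
  refine tsum_congr fun z => ?_
  set ζ := Function.updateFinset ξ Z z with hζ
  have hlaw : ∀ h : (∀ v, Ω v) → ℝ≥0∞, Measurable h → DependsOn h (W : Set (S × ℤ)) →
      ∫⁻ ω, h ω ∂P = ∫⁻ ω, margProd (factor κ ξ fun _ => ∅) W h ω ∂P := fun h hh hd =>
    hP.lintegral_eq ξ a b hh (hd.mono fun v hv => (mem_window.1 hv).2)
  -- Consistency: on the event that `X` has its values in `ξ`, the cut mechanisms read the actual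
  -- values.
  have hcons : ∀ h : (∀ v, Ω v) → ℝ≥0∞,
      margProd (factor κ ξ fun _ => ∅) W (fun η => h η * eventInd X ξ η)
        = margProd (factor κ ξ C) W (fun η => h η * eventInd X ξ η) := by
    intro h
    unfold margProd
    congr 1
    funext η
    by_cases hη : ∀ u ∈ X, η u = ξ u
    · congr 1
      refine Finset.prod_congr rfl fun v _ => ?_
      rw [factor_congr_of_eq (C := C) fun u _ hu => hη u hu.1]
    · dsimp only
      rw [eventInd_apply, if_neg hη, mul_zero, zero_mul, zero_mul]
  obtain ⟨Φ, Ψ, hΦΨ⟩ := exists_lintegral_margProd_eq_mul hG backdoorGraph_le hP.indep_of_disjoint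
    hX hY hZ hYZ (fun u v huv hu => ⟨huv, fun h => absurd (mem_window.1 (hX h.1)).1 (not_le.2 hu)⟩)
    hC hR ζ
  have hmZ := measurable_eventInd Z ζ
  have hmX := measurable_eventInd X ξ
  have hmY := measurable_eventInd Y υ
  have hdX := dependsOn_eventInd X ξ
  have hdY := dependsOn_eventInd Y υ
  have hdZ := dependsOn_eventInd Z ζ
  have hconst : ∀ A : Set (S × ℤ), DependsOn (fun _ : ∀ v, Ω v => (1 : ℝ≥0∞)) A :=
    fun A _ _ _ => rfl
  have hz : P (event Z z) = Φ 1 * Ψ 1 := by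
    have h1 := hΦΨ 1 1 measurable_one measurable_one (hconst _) (hconst _)
    rw [← h1, event_eq_restrict z ξ, ← lintegral_eventInd, hlaw _ hmZ (hdZ.mono hZ)]
    simp only [Pi.one_apply, mul_one]
    change _ = ∫⁻ ω, margProd _ W (eventInd Z ζ) ω ∂P
    -- An ancestor of `Z` in `G` has no cut parent, since its being a causal node below `X` would
    -- contradict `hF`. Hence cutting preserves the law of `Z`.
    set A := W.filter fun v => ∃ t ∈ (Z : Set (S × ℤ)), IsDescendant G v t with hA
    have hAcl : ∀ C, ∀ u v, (cutGraph G C).Adj u v → v ∈ A → u ∈ W → u ∈ A := by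
      intro C u v huv hv hu
      obtain ⟨-, y, hy, hvy⟩ := Finset.mem_filter.1 hv
      exact Finset.mem_filter.2 ⟨hu, y, hy, .head huv.1 hvy⟩
    have hdep : DependsOn (eventInd Z ζ) {v | v ∈ W → v ∈ A} :=
      hdZ.mono fun v hv hvW => Finset.mem_filter.2 ⟨hvW, v, hv, .refl⟩
    rw [hK.margProd_eq (hacyc _) (A := A) (Finset.filter_subset _ _) (hAcl _) hmZ hdep,
      hR.margProd_eq (hacyc C) (A := A) (Finset.filter_subset _ _) (hAcl _) hmZ hdep]
    refine lintegral_congr fun ω => ?_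
    unfold margProd
    congr 1
    funext η
    congr 1
    refine Finset.prod_congr rfl fun v hv => ?_
    obtain ⟨-, t, ht, hvt⟩ := Finset.mem_filter.1 hv
    rw [factor_congr_of_eq (C := C) fun u huv hu => absurd hvt (hF u hu.1 v huv hu.2 t ht)]
  have hxz : P (event X (fun v => ξ v) ∩ event Z z) = Φ (eventInd X ξ) * Ψ 1 := by
    rw [← hΦΨ (eventInd X ξ) 1 hmX measurable_one hdX (hconst _)]
    simp only [Pi.one_apply, mul_one]
    rw [← hcons, ← hlaw _ (hmZ.fun_mul hmX) (dependsOn_mul (hdZ.mono hZ) (hdX.mono hX))]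
    simp_rw [eventInd_mul_eventInd]
    rw [lintegral_indicator_one ((measurableSet_event _ _).inter (measurableSet_event _ _)),
      Set.inter_comm, event_eq_restrict z ξ]
  have hxyz : P (event X (fun v => ξ v) ∩ event Z z ∩ event Y fun v => υ v)
      = Φ (eventInd X ξ) * Ψ (eventInd Y υ) := by
    rw [← hΦΨ (eventInd X ξ) (eventInd Y υ) hmX hmY hdX hdY]
    have h1 : (fun η => eventInd Z ζ η * (eventInd X ξ η * eventInd Y υ η))
        = fun η => (eventInd Z ζ η * eventInd Y υ η) * eventInd X ξ η := by
      funext η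
      ring
    rw [h1, ← hcons, ← hlaw _ ((hmZ.fun_mul hmY).fun_mul hmX)
      (dependsOn_mul (dependsOn_mul (hdZ.mono hZ) (hdY.mono hY)) (hdX.mono hX))]
    have h2 : ∀ η, eventInd Z ζ η * eventInd Y υ η * eventInd X ξ η
        = (((event Z fun v => ζ v) ∩ event Y fun v => υ v) ∩ event X fun v => ξ v).indicator 1 η := by
      intro η
      rw [Set.inter_indicator_one, Set.inter_indicator_one]
      rfl
    simp_rw [h2]
    rw [lintegral_indicator_one (((measurableSet_event _ _).inter (measurableSet_event _ _)).inter
      (measurableSet_event _ _)), event_eq_restrict z ξ]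
    congr 1
    ext ω
    simp only [Set.mem_inter_iff]
    tauto
  have hyz : ∫⁻ ω, margProd (factor κ ξ C) W (fun η => eventInd Z ζ η * eventInd Y υ η) ω ∂P
      = Φ 1 * Ψ (eventInd Y υ) := by
    rw [← hΦΨ 1 (eventInd Y υ) measurable_one hmY (hconst _) hdY]
    simp only [Pi.one_apply, one_mul, hWdef]
  -- Settles the values `z` of probability zero, where admissibility says nothing.
  have hle : Φ 1 * Ψ (eventInd Y υ) ≤ Φ 1 * Ψ 1 := by
    rw [← hΦΨ 1 (eventInd Y υ) measurable_one hmY (hconst _) hdY,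
      ← hΦΨ 1 1 measurable_one measurable_one (hconst _) (hconst _)]
    refine lintegral_mono fun ω => lmarginal_mono (fun η => ?_) ω
    dsimp only
    gcongr
    exact Set.indicator_le_self' (fun _ _ => zero_le) η
  rw [hyz, cond_apply ((measurableSet_event _ _).inter (measurableSet_event _ _)), hxz, hxyz]
  by_cases h0 : P (event Z z) = 0
  · rw [h0, mul_zero]
    rw [hz] at h0
    exact le_antisymm (hle.trans h0.le) (zero_le)
  · have h1 := hx z h0
    have h2 : P (event X (fun v => ξ v) ∩ event Z z) ≠ ⊤ := measure_ne_top _ _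
    rw [hxz] at h1 h2
    rw [hz]
    calc Φ 1 * Ψ (eventInd Y υ)
        = ((Φ (eventInd X ξ) * Ψ 1)⁻¹ * (Φ (eventInd X ξ) * Ψ 1)) * (Φ 1 * Ψ (eventInd Y υ)) := by
          rw [ENNReal.inv_mul_cancel h1 h2, one_mul]
      _ = _ := by ring

end Soundness

end SCGAdjustment

namespace SCGAdjustment

/-! ### Linear models over the field with two elements -/

noncomputable section Linear

/-- The law of a noise bit: `1` with probability `1/4`. -/
def noiseBit : Measure (ZMod 2) :=
  (3 / 4 : ℝ≥0∞) • Measure.dirac 0 + (1 / 4 : ℝ≥0∞) • Measure.dirac 1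

theorem noiseBit_one : noiseBit {1} = 1 / 4 := by
  simp [noiseBit]

theorem noiseBit_zero : noiseBit {0} = 3 / 4 := by
  simp [noiseBit]

instance : IsProbabilityMeasure noiseBit := by
  constructor
  simp only [noiseBit, Measure.coe_add, Measure.coe_smul, Pi.add_apply, Pi.smul_apply,
    measure_univ, smul_eq_mul, mul_one]
  rw [← ENNReal.add_div, show (3 : ℝ≥0∞) + 1 = 4 by norm_num]
  exact ENNReal.div_self (by simp) (by simp)

theorem noiseBit_singleton_ne_zero (b : ZMod 2) : noiseBit {b} ≠ 0 := by
  fin_cases b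
  · change noiseBit {0} ≠ 0
    rw [noiseBit_zero]
    simp
  · change noiseBit {1} ≠ 0
    rw [noiseBit_one]
    simp

variable {V : Type*}

/-- Independent noise bits at all vertices. -/
def noise (V : Type*) : Measure (V → ZMod 2) := Measure.infinitePi fun _ => noiseBit

instance : IsProbabilityMeasure (noise V) := by unfold noise; infer_instance

theorem noise_eval (v : V) (b : ZMod 2) : noise V {n | n v = b} = noiseBit {b} := by
  have h := Measure.infinitePi_pi (fun _ : V => noiseBit) (s := {v}) (t := fun _ => {b})
    (fun _ _ => measurableSet_singleton b)
  rw [Finset.prod_singleton] at h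
  rw [← h]
  congr 1
  ext n
  simp

theorem noise_eval_eval {u v : V} (huv : u ≠ v) (b c : ZMod 2) :
    noise V {n | n u = b ∧ n v = c} = noiseBit {b} * noiseBit {c} := by
  classical
  have h := Measure.infinitePi_pi (fun _ : V => noiseBit) (s := {u, v})
    (t := fun w => if w = u then {b} else {c}) (fun _ _ => MeasurableSet.of_discrete)
  rw [Finset.prod_pair huv] at h
  simp only [if_true, if_neg huv.symm] at h
  rw [← h]
  congr 1
  ext n
  simp [huv.symm]

theorem noise_agree_ne_zero (F : Finset V) (n₀ : V → ZMod 2) :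
    noise V {n | ∀ v ∈ F, n v = n₀ v} ≠ 0 := by
  have h := Measure.infinitePi_pi (fun _ : V => noiseBit) (s := F) (t := fun v => {n₀ v})
    (fun _ _ => measurableSet_singleton _)
  have h' : {n | ∀ v ∈ F, n v = n₀ v} = (F : Set V).pi fun v => {n₀ v} := by
    ext n
    simp
  rw [h']
  refine ne_of_eq_of_ne h ?_
  exact Finset.prod_ne_zero_iff.2 fun v _ => noiseBit_singleton_ne_zero _

/-- Fresh noise in a finite window leaves the product law unchanged. This makes it possible to
condition on the remaining noise, which determines the past of the window. -/
theorem noise_resample [DecidableEq V] (W : Finset V) :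
    ((noise V).prod (Measure.pi fun _ : W => noiseBit)).map
      (fun p => Function.updateFinset p.1 W p.2) = noise V := by
  refine Measure.eq_infinitePi (fun _ : V => noiseBit) fun s t ht => ?_
  rw [Measure.map_apply measurable_updateFinset'
    (MeasurableSet.pi s.countable_toSet fun i _ => ht i)]
  have hset : (fun p : (V → ZMod 2) × (W → ZMod 2) => Function.updateFinset p.1 W p.2) ⁻¹'
      (s : Set V).pi t
      = (((s \ W : Finset V) : Set V).pi t) ×ˢ
        (Set.univ.pi fun v : W => if (v : V) ∈ s then t v else Set.univ) := by
    ext p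
    simp only [Set.mem_preimage, Set.mem_pi, Set.mem_prod, Finset.mem_coe, Finset.mem_sdiff,
      Set.mem_univ, true_imp_iff]
    constructor
    · intro h
      refine ⟨fun i hi => ?_, fun v => ?_⟩
      · have := h i hi.1
        rwa [Function.updateFinset, dif_neg hi.2] at this
      · split_ifs with hv
        · have := h v hv
          rwa [Function.updateFinset, dif_pos v.2] at this
        · trivial
    · rintro ⟨h1, h2⟩ i hi
      rw [Function.updateFinset]
      split_ifs with hiW
      · simpa [hi] using h2 ⟨i, hiW⟩
      · exact h1 i ⟨hi, hiW⟩
  rw [hset, Measure.prod_prod, Measure.pi_pi]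
  have h1 := Measure.infinitePi_pi (fun _ : V => noiseBit) (s := s \ W) (t := t) fun i _ => ht i
  have h2 : ∏ v : W, noiseBit (if (v : V) ∈ s then t v else Set.univ) = ∏ v ∈ s ∩ W, noiseBit (t v) := by
    rw [Finset.prod_coe_sort W fun v => noiseBit (if v ∈ s then t v else Set.univ),
      Finset.inter_comm, ← Finset.filter_mem_eq_inter, Finset.prod_filter]
    refine Finset.prod_congr rfl fun v _ => ?_
    split_ifs
    · rfl
    · exact measure_univ
  rw [show noise V _ = _ from h1, h2, mul_comm, ← Finset.prod_union]
  · rw [Finset.union_comm, Finset.sdiff_union_inter]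
  · rw [Finset.disjoint_left]
    intro v hv hv'
    exact (Finset.mem_sdiff.1 hv').2 (Finset.mem_inter.1 hv).2

open Classical in
/-- A solved system of equations over the field with two elements: each variable is the sum of some
of its parents and, for noisy variables, of its noise bit. -/
structure LinearModel (G : Digraph V) where
  par : V → Finset V
  noisy : Set V
  sol : (V → ZMod 2) → V → ZMod 2
  adj_of_mem : ∀ {u v}, u ∈ par v → G.Adj u v
  measurable_sol : ∀ v, Measurable fun n => sol n v
  sol_eq : ∀ n v, sol n v = ∑ u ∈ par v, sol n u + if v ∈ noisy then n v else 0
  dependsOn_sol : ∀ v, DependsOn (fun n => sol n v) {u | IsDescendant G u v}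

/-- The encoding of a bit as a value of a variable. -/
def enc (α : Type*) [Nontrivial α] (b : ZMod 2) : α :=
  if b = 0 then (exists_pair_ne α).choose else (exists_pair_ne α).choose_spec.choose

open Classical in
/-- The bit that a value encodes. -/
def dec (α : Type*) [Nontrivial α] (o : α) : ZMod 2 := if o = enc α 1 then 1 else 0

theorem dec_enc {α : Type*} [Nontrivial α] (b : ZMod 2) : dec α (enc α b) = b := by
  have h : enc α 0 ≠ enc α 1 := by
    simpa [enc] using (exists_pair_ne α).choose_spec.choose_spec
  have hb : b = 0 ∨ b = 1 := by revert b; decide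
  rcases hb with rfl | rfl
  · simp [dec, h]
  · simp [dec]

theorem enc_injective {α : Type*} [Nontrivial α] : Function.Injective (enc α) :=
  Function.LeftInverse.injective dec_enc

namespace LinearModel

variable {S : Type*} [DecidableEq S] {Ω : S × ℤ → Type*} [∀ v, MeasurableSpace (Ω v)]
  {G : Digraph (S × ℤ)} [∀ v, DiscreteMeasurableSpace (Ω v)]
  [∀ v, Nontrivial (Ω v)] (M : LinearModel G)

open Classical in
/-- The value of `v` as a function of the values of its parents and of the noise. -/
def eqn (v : S × ℤ) (η : ∀ v, Ω v) (b : ZMod 2) : Ω v :=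
  enc (Ω v) (∑ u ∈ M.par v, dec (Ω u) (η u) + if v ∈ M.noisy then b else 0)

/-- The configuration that solves the equations for the given noise. -/
def config (n : S × ℤ → ZMod 2) (v : S × ℤ) : Ω v := enc (Ω v) (M.sol n v)

/-- The joint law of the variables. -/
def law (Ω : S × ℤ → Type*) [∀ v, MeasurableSpace (Ω v)] [∀ v, Nontrivial (Ω v)] :
    Measure (∀ v, Ω v) :=
  (noise (S × ℤ)).map M.config

open Classical in
/-- The conditional distributions of the variables given their parents. -/
def mech (Ω : S × ℤ → Type*) [∀ v, MeasurableSpace (Ω v)] [∀ v, DiscreteMeasurableSpace (Ω v)]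
    [∀ v, Nontrivial (Ω v)] : Mechanisms G Ω := fun v =>
  { toFun := fun η => noiseBit.map fun b => enc (Ω v)
      (∑ u ∈ (M.par v).attach, dec (Ω u) (η ⟨u, M.adj_of_mem u.2⟩) + if v ∈ M.noisy then b else 0)
    measurable' := by
      have h : Measurable fun η : ∀ u : {u // G.Adj u v}, Ω u =>
          ∑ u ∈ (M.par v).attach, dec (Ω u) (η ⟨u, M.adj_of_mem u.2⟩) :=
        Finset.measurable_fun_sum _ fun u _ =>
          (Measurable.of_discrete (f := dec (Ω u))).comp
            (measurable_pi_apply (⟨u, M.adj_of_mem u.2⟩ : {u // G.Adj u v}))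
      exact (Measurable.of_discrete (f := fun s : ZMod 2 => noiseBit.map fun b => enc (Ω v)
        (s + if v ∈ M.noisy then b else 0))).comp h }

theorem mech_apply (v : S × ℤ) (η : ∀ v, Ω v) (t : Ω v) :
    M.mech Ω v (fun u => η u) {t} = noiseBit {b | M.eqn v η b = t} := by
  change noiseBit.map _ _ = _
  rw [Measure.map_apply Measurable.of_discrete (measurableSet_singleton _)]
  congr 1
  ext b
  simp only [Set.mem_preimage, Set.mem_singleton_iff, Set.mem_ofPred_eq, eqn]
  rw [Finset.sum_attach (M.par v) fun u => dec (Ω u) (η u)]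

theorem measurable_config : Measurable (M.config (Ω := Ω)) :=
  measurable_pi_lambda _ fun v => Measurable.of_discrete.comp (M.measurable_sol v)

theorem config_eq (n : S × ℤ → ZMod 2) (v : S × ℤ) :
    M.config (Ω := Ω) n v = M.eqn v (M.config n) (n v) := by
  simp only [config, eqn, dec_enc]
  rw [← M.sol_eq]

theorem eqn_congr {v : S × ℤ} {η η' : ∀ v, Ω v} (h : ∀ u ∈ M.par v, η u = η' u) (b : ZMod 2) :
    M.eqn v η b = M.eqn v η' b := by
  unfold eqn
  rw [Finset.sum_congr rfl fun u hu => by rw [h u hu]]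

/-! ### Linear models give compatible distributions -/

theorem isProbabilityMeasure_law : IsProbabilityMeasure (M.law Ω) :=
  Measure.isProbabilityMeasure_map M.measurable_config.aemeasurable

theorem law_apply {B : Set (∀ v, Ω v)} (hB : MeasurableSet B) :
    M.law Ω B = noise (S × ℤ) {n | M.config n ∈ B} :=
  Measure.map_apply M.measurable_config hB

/-- The variables in an ancestral set are functions of the noise in that set. -/
theorem indep_of_disjoint (A B : Set (S × ℤ)) (hA : IsAncestral G A) (hB : IsAncestral G B)
    (hAB : Disjoint A B) : Indep (cylinderEvents A) (cylinderEvents B) (M.law Ω) := by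
  have hiI : iIndep (fun v => MeasurableSpace.comap (fun n : S × ℤ → ZMod 2 => n v) inferInstance)
      (noise (S × ℤ)) := iIndepFun_infinitePi (X := fun _ b => b) fun _ => measurable_id
  have hI := indep_iSup_of_disjoint (fun v => (measurable_pi_apply v).comap_le) hiI hAB
  have hmeas : ∀ C : Set (S × ℤ), IsAncestral G C → ∀ E : Set (∀ v, Ω v),
      MeasurableSet[cylinderEvents C] E →
      MeasurableSet[cylinderEvents (X := fun _ : S × ℤ => ZMod 2) C] {n | M.config n ∈ E} := by
    intro C hC E hE
    have h1 : Measurable[cylinderEvents (X := fun _ : S × ℤ => ZMod 2) C, cylinderEvents C]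
        (M.config (Ω := Ω)) := by
      rw [@measurable_cylinderEvents_iff]
      intro v hv
      refine (Measurable.of_discrete (f := enc (Ω v))).comp
        (measurable_cylinderEvents_of_dependsOn (M.measurable_sol v)
          ((M.dependsOn_sol v).mono fun u (hu : IsDescendant G u v) => ?_))
      induction hu using Relation.ReflTransGen.head_induction_on with
      | refl => exact hv
      | head hab _ ih => exact hC _ _ hab ih
    exact h1 hE
  rw [Indep_iff]
  intro s t hs ht
  have hs' := cylinderEvents_le_pi _ hs
  have ht' := cylinderEvents_le_pi _ ht
  rw [M.law_apply (hs'.inter ht'), M.law_apply hs', M.law_apply ht']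
  exact (Indep_iff _ _ _).1 hI _ _ (hmeas A hA s hs) (hmeas B hB t ht)

variable [∀ v, Countable (Ω v)] [Fintype S]

/-- After the noise in `W` is resampled, the remaining noise decides `B`. The window has the value
`w` if and only if each equation, with parents set to `w` inside and to the past outside `W`, yields
`w v`. These are conditions on separate noise bits, so their probability is a product. -/
theorem factorization (hG : IsFTCG G) (a b : ℤ) (B : Set (∀ v, Ω v))
    (hB : MeasurableSet[cylinderEvents {v : S × ℤ | v.2 < a}] B)
    {W : Finset (S × ℤ)} (hW : ∀ v, v ∈ W ↔ a ≤ v.2 ∧ v.2 ≤ b) (w : ∀ v : W, Ω v) :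
    M.law Ω (B ∩ event W w)
      = ∫⁻ ω in B, factorProduct (M.mech Ω) ∅ W w ω ∂(M.law Ω) := by
  classical
  have hB' := cylinderEvents_le_pi _ hB
  have hBd := dependsOn_of_measurable_cylinderEvents hB
  have hT : MeasurableSet {n | M.config (Ω := Ω) n ∈ B ∩ event W w} :=
    M.measurable_config (hB'.inter (measurableSet_event W w))
  have hfp : Measurable (factorProduct (M.mech Ω) ∅ W w) :=
    measurable_factorProduct (M.mech Ω) (fun v => enc (Ω v) 0) W w
  rw [M.law_apply (hB'.inter (measurableSet_event W w)), law,
    setLIntegral_map hB' hfp M.measurable_config, ← noise_resample W]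
  rw [Measure.map_apply measurable_updateFinset' hT,
    Measure.prod_apply (measurable_updateFinset' hT), noise_resample W,
    ← lintegral_indicator (M.measurable_config hB')]
  refine lintegral_congr fun n => ?_
  have hpast : ∀ (m : W → ZMod 2) (v : S × ℤ), v.2 < a →
      M.config (Ω := Ω) (Function.updateFinset n W m) v = M.config n v := by
    intro m v hv
    unfold config
    congr 1
    refine M.dependsOn_sol v fun u hu => ?_
    rw [Function.updateFinset, dif_neg]
    intro huW
    have h1 : u.2 ≤ v.2 := by
      clear huW
      induction hu with
      | refl => rfl
      | tail _ h ih => exact (ih (lt_of_le_of_lt (hG.forward _ _ h) hv)).trans (hG.forward _ _ h)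
    have h2 := ((hW _).1 huW).1
    omega
  have hBiff : ∀ m : W → ZMod 2, M.config (Ω := Ω) (Function.updateFinset n W m) ∈ B ↔
      M.config n ∈ B := fun m => iff_of_eq (hBd fun v hv => hpast m v hv)
  have key : ∀ (m : W → ZMod 2) (v : S × ℤ) (hv : v ∈ W),
      (∀ u ∈ M.par v, ∀ hu : u ∈ W,
        M.config (Ω := Ω) (Function.updateFinset n W m) u = w ⟨u, hu⟩) →
      M.config (Ω := Ω) (Function.updateFinset n W m) v
        = M.eqn v (splice W w (M.config n)) (m ⟨v, hv⟩) := by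
    intro m v hv h
    rw [M.config_eq]
    have hmv : Function.updateFinset n W m v = m ⟨v, hv⟩ := by simp [Function.updateFinset, hv]
    rw [hmv]
    refine M.eqn_congr (fun u hu => ?_) _
    unfold splice
    split_ifs with huW
    · exact h u hu huW
    · refine hpast m u ?_
      have h1 := hG.forward u v (M.adj_of_mem hu)
      have h2 := ((hW _).1 hv).2
      by_contra hlt
      exact huW ((hW _).2 ⟨not_lt.1 hlt, h1.trans h2⟩)
  have hset : Prod.mk n ⁻¹' ((fun p : (S × ℤ → ZMod 2) × (W → ZMod 2) =>
        Function.updateFinset p.1 W p.2) ⁻¹' {n | M.config (Ω := Ω) n ∈ B ∩ event W w})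
      = {m | M.config (Ω := Ω) n ∈ B ∧ ∀ v : W, M.eqn v (splice W w (M.config n)) (m v) = w v} := by
    ext m
    simp only [Set.mem_preimage, Set.mem_ofPred_eq, Set.mem_inter_iff]
    rw [hBiff]
    refine and_congr_right fun _ => ⟨fun h v => ?_, fun h v => ?_⟩
    · rw [← key m v v.2 fun u _ hu => h ⟨u, hu⟩]
      exact h v
    · by_contra hne
      -- A wrong value with no wrong parent in the window would contradict its own equation.
      obtain ⟨v', hv', hsrc⟩ := hG.acyclic.exists_source
        (F := W.filter fun v => ∃ hv : v ∈ W,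
          M.config (Ω := Ω) (Function.updateFinset n W m) v ≠ w ⟨v, hv⟩)
        ⟨v, Finset.mem_filter.2 ⟨v.2, v.2, hne⟩⟩
      obtain ⟨hv'W, _, hne'⟩ := Finset.mem_filter.1 hv'
      refine hne' ?_
      rw [key m v' hv'W, h ⟨v', hv'W⟩]
      intro u hu huW
      by_contra hcon
      exact hsrc u (Finset.mem_filter.2 ⟨huW, huW, hcon⟩) (M.adj_of_mem hu)
  rw [hset]
  by_cases hn : M.config (Ω := Ω) n ∈ B
  · rw [Set.indicator_of_mem (by exact hn)]
    have h1 : {m : W → ZMod 2 | M.config (Ω := Ω) n ∈ B ∧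
          ∀ v : W, M.eqn v (splice W w (M.config n)) (m v) = w v}
        = Set.univ.pi fun v : W => {b | M.eqn v (splice W w (M.config n)) b = w v} := by
      ext m
      simp [hn]
    rw [h1, Measure.pi_pi, factorProduct]
    refine Finset.prod_congr rfl fun v _ => ?_
    rw [if_neg (Finset.notMem_empty _), ← M.mech_apply]
  · rw [Set.indicator_of_notMem (by exact hn)]
    simp [hn]

theorem isCompatible (hG : IsFTCG G) : IsCompatible G (M.mech Ω) (M.law Ω) where
  isProbabilityMeasure := M.isProbabilityMeasure_law
  isMarkovKernel _ := ⟨fun _ => Measure.isProbabilityMeasure_map Measurable.of_discrete.aemeasurable⟩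
  factorization a b B hB w := M.factorization hG a b B hB (fun _ => mem_window) w
  indep_of_disjoint := M.indep_of_disjoint

end LinearModel

end Linear

end SCGAdjustment

namespace SCGAdjustment

/-! ### Shortest directed paths -/

noncomputable section Legs

open Relation

variable {V : Type*} {R : V → V → Prop}

/-- There is a walk of length `n` from `a` to `b`. -/
def StepN (R : V → V → Prop) : ℕ → V → V → Prop
  | 0, a, b => a = b
  | n + 1, a, b => ∃ c, R a c ∧ StepN R n c b

theorem exists_stepN {a b : V} (h : ReflTransGen R a b) : ∃ n, StepN R n a b := by
  induction h using ReflTransGen.head_induction_on with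
  | refl => exact ⟨0, rfl⟩
  | head hab _ ih =>
    obtain ⟨n, hn⟩ := ih
    exact ⟨n + 1, _, hab, hn⟩

theorem StepN.reflTransGen {n : ℕ} {a b : V} (h : StepN R n a b) : ReflTransGen R a b := by
  induction n generalizing a with
  | zero => cases h; exact .refl
  | succ n ih =>
    obtain ⟨c, hac, hcb⟩ := h
    exact .head hac (ih hcb)

/-- The length of a shortest walk from `a` to `b`. -/
def stepDist (R : V → V → Prop) (a b : V) : ℕ := sInf {n | StepN R n a b}

theorem stepN_stepDist {a b : V} (h : ReflTransGen R a b) : StepN R (stepDist R a b) a b :=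
  Nat.sInf_mem (s := {n | StepN R n a b}) (exists_stepN h)

theorem StepN.stepDist_le {n : ℕ} {a b : V} (h : StepN R n a b) : stepDist R a b ≤ n :=
  Nat.sInf_le h

theorem stepDist_self (a : V) : stepDist R a a = 0 :=
  Nat.le_zero.1 (StepN.stepDist_le (n := 0) rfl)

theorem eq_of_stepDist_eq_zero {a b : V} (h : ReflTransGen R a b) (h0 : stepDist R a b = 0) :
    a = b := by
  have := stepN_stepDist h
  rwa [h0] at this

theorem exists_next {v t : V} (h : ReflTransGen R v t) (hne : v ≠ t) :
    ∃ c, R v c ∧ ReflTransGen R c t ∧ stepDist R v t = stepDist R c t + 1 := by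
  have h1 := stepN_stepDist h
  obtain ⟨n, hn⟩ : ∃ n, stepDist R v t = n + 1 :=
    Nat.exists_eq_succ_of_ne_zero fun h0 => hne (eq_of_stepDist_eq_zero h h0)
  rw [hn] at h1
  obtain ⟨c, hvc, hct⟩ := h1
  refine ⟨c, hvc, hct.reflTransGen, ?_⟩
  have h2 := hct.stepDist_le
  have h3 : StepN R (stepDist R c t + 1) v t := ⟨c, hvc, stepN_stepDist hct.reflTransGen⟩
  have h4 := h3.stepDist_le
  omega

open Classical in
/-- The next vertex on a shortest walk from `v` to `t`. -/
def next (R : V → V → Prop) (t v : V) : V :=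
  if h : ∃ c, R v c ∧ ReflTransGen R c t ∧ stepDist R v t = stepDist R c t + 1
  then h.choose else v

theorem next_spec {v t : V} (h : ReflTransGen R v t) (hne : v ≠ t) :
    R v (next R t v) ∧ ReflTransGen R (next R t v) t ∧
      stepDist R v t = stepDist R (next R t v) t + 1 := by
  have h' := exists_next h hne
  rw [next, dif_pos h']
  exact h'.choose_spec

/-- The vertices on the chosen shortest walk from `s` to `t`. -/
def leg (R : V → V → Prop) (s t : V) : Set V :=
  {v | ∃ m ≤ stepDist R s t, v = (next R t)^[m] s}

theorem iterate_next_spec {s t : V} (h : ReflTransGen R s t) {m : ℕ} (hm : m ≤ stepDist R s t) :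
    ReflTransGen R ((next R t)^[m] s) t ∧ StepN R m s ((next R t)^[m] s) ∧
      stepDist R ((next R t)^[m] s) t + m = stepDist R s t := by
  induction m generalizing s with
  | zero => exact ⟨h, rfl, rfl⟩
  | succ m ih =>
    have hne : s ≠ t := by
      rintro rfl
      rw [stepDist_self] at hm
      omega
    obtain ⟨h1, h2, h3⟩ := next_spec h hne
    obtain ⟨h4, h5, h6⟩ := ih h2 (by omega)
    rw [Function.iterate_succ_apply]
    exact ⟨h4, ⟨_, h1, h5⟩, by omega⟩

theorem finite_leg (s t : V) : (leg R s t).Finite := by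
  refine ((Set.finite_Iic (stepDist R s t)).image fun m => (next R t)^[m] s).subset ?_
  rintro v ⟨m, hm, rfl⟩
  exact ⟨m, hm, rfl⟩

theorem left_mem_leg (s t : V) : s ∈ leg R s t := ⟨0, Nat.zero_le _, rfl⟩

theorem right_mem_leg {s t : V} (h : ReflTransGen R s t) : t ∈ leg R s t := by
  refine ⟨_, le_rfl, ?_⟩
  obtain ⟨h1, -, h2⟩ := iterate_next_spec h le_rfl
  exact (eq_of_stepDist_eq_zero h1 (by omega)).symm

theorem reflTransGen_of_mem_leg {s t v : V} (h : ReflTransGen R s t) (hv : v ∈ leg R s t) :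
    ReflTransGen R s v ∧ ReflTransGen R v t := by
  obtain ⟨m, hm, rfl⟩ := hv
  obtain ⟨h1, h2, -⟩ := iterate_next_spec h hm
  exact ⟨h2.reflTransGen, h1⟩

theorem stepDist_add_le_of_mem_leg {s t v : V} (h : ReflTransGen R s t) (hv : v ∈ leg R s t) :
    stepDist R s v + stepDist R v t ≤ stepDist R s t := by
  obtain ⟨m, hm, rfl⟩ := hv
  obtain ⟨-, h2, h3⟩ := iterate_next_spec h hm
  have := h2.stepDist_le
  omega

theorem next_mem_leg {s t v : V} (h : ReflTransGen R s t) (hv : v ∈ leg R s t) (hne : v ≠ t) :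
    next R t v ∈ leg R s t := by
  obtain ⟨m, hm, rfl⟩ := hv
  obtain ⟨h1, -, h3⟩ := iterate_next_spec h hm
  refine ⟨m + 1, ?_, (Function.iterate_succ_apply' _ _ _).symm⟩
  have := next_spec h1 hne
  omega

theorem exists_of_mem_leg {s t v : V} (h : ReflTransGen R s t) (hv : v ∈ leg R s t)
    (hne : v ≠ s) : ∃ u ∈ leg R s t, u ≠ t ∧ next R t u = v := by
  obtain ⟨m, hm, rfl⟩ := hv
  cases m with
  | zero => exact absurd rfl hne
  | succ m =>
    refine ⟨(next R t)^[m] s, ⟨m, by omega, rfl⟩, fun he => ?_,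
      (Function.iterate_succ_apply' _ _ _).symm⟩
    obtain ⟨-, -, h3⟩ := iterate_next_spec h (m := m) (by omega)
    rw [he, stepDist_self] at h3
    omega

/-- Along a leg the distance to `t` drops by one at each step, so it determines the position. -/
theorem next_injOn_leg {s t u u' : V} (h : ReflTransGen R s t) (hu : u ∈ leg R s t)
    (hu' : u' ∈ leg R s t) (hut : u ≠ t) (hut' : u' ≠ t) (he : next R t u = next R t u') :
    u = u' := by
  have h1 := (next_spec (reflTransGen_of_mem_leg h hu).2 hut).2.2
  have h2 := (next_spec (reflTransGen_of_mem_leg h hu').2 hut').2.2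
  obtain ⟨m, hm, rfl⟩ := hu
  obtain ⟨m', hm', rfl⟩ := hu'
  have h3 := (iterate_next_spec h hm).2.2
  have h4 := (iterate_next_spec h hm').2.2
  rw [he] at h1
  have : m = m' := by omega
  rw [this]

theorem next_ne_left {s t u : V} (h : ReflTransGen R s t) (hu : u ∈ leg R s t) (hut : u ≠ t) :
    next R t u ≠ s := by
  intro he
  have h1 := (next_spec (reflTransGen_of_mem_leg h hu).2 hut).2.2
  have h2 := stepDist_add_le_of_mem_leg h hu
  rw [he] at h1
  omega

end Legs

/-! ### A shortest chain from `Y` to `X` -/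

section Chain

open Relation

variable {V : Type*} {H : Digraph V} {X Y Z : Set V}

/-- The steps of directed paths that leave only vertices outside `Z`. -/
abbrev openStep (H : Digraph V) (Z : Set V) : V → V → Prop := fun a b => H.Adj a b ∧ a ∉ Z

/-- The vertices `t 0 ∈ Y`, `t 1, …, t k ∈ Z`, `t (k + 1) ∈ X`, of which any two successive ones
have a common open ancestor. -/
structure IsChainSeq (H : Digraph V) (X Y Z : Set V) (k : ℕ) (t : ℕ → V) : Prop where
  zero_mem : t 0 ∈ Y
  mem : ∀ i, 1 ≤ i → i ≤ k → t i ∈ Z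
  last_mem : t (k + 1) ∈ X
  nonempty : ∀ i ≤ k, (openAnc H Z (t i) ∩ openAnc H Z (t (i + 1))).Nonempty

theorem Linked.exists_seq {t' : V} (h : Linked H Y Z t') : ∃ k, ∃ t : ℕ → V, t 0 ∈ Y ∧
    (∀ i, 1 ≤ i → i ≤ k → t i ∈ Z) ∧ t k = t' ∧
      ∀ i < k, (openAnc H Z (t i) ∩ openAnc H Z (t (i + 1))).Nonempty := by
  induction h with
  | @base t' ht => exact ⟨0, fun _ => t', ht, fun i h1 h2 => by omega, rfl, fun i h => by omega⟩
  | @step t₁ t₂ s _ ht' hs hs' ih =>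
    obtain ⟨k, t, h0, hm, hk, hne⟩ := ih
    refine ⟨k + 1, fun i => if i ≤ k then t i else t₂, by simpa using h0, fun i h1 h2 => ?_,
      by simp, fun i hi => ?_⟩
    · dsimp only
      split_ifs with h
      · exact hm i h1 h
      · exact ht'
    · dsimp only
      rw [if_pos (by omega)]
      split_ifs with h
      · exact hne i h
      · have : i = k := by omega
        subst this
        rw [hk]
        exact ⟨s, hs, hs'⟩

theorem IsConnected.exists_isChainSeq (h : IsConnected H X Y Z) : ∃ k t, IsChainSeq H X Y Z k t := by
  obtain ⟨x, hx, t', s, ht', hsx, hst⟩ := h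
  obtain ⟨k, t, h0, hm, hk, hne⟩ := ht'.exists_seq
  refine ⟨k, fun i => if i ≤ k then t i else x, by simpa using h0, fun i h1 h2 => ?_,
    by simpa using hx, fun i hi => ?_⟩
  · simpa [h2] using hm i h1 h2
  · rw [if_pos hi]
    split_ifs with h
    · exact hne i h
    · have : i = k := by omega
      subst this
      rw [hk]
      exact ⟨s, hst, hsx⟩

theorem exists_argmin {α : Type*} (f : α → ℕ) {s : Set α} (hs : s.Nonempty) :
    ∃ a ∈ s, ∀ b ∈ s, f a ≤ f b := by
  obtain ⟨a, ha, h⟩ := (measure f).wf.has_min s hs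
  exact ⟨a, ha, fun b hb => not_lt.1 (h b hb)⟩

/-- The total length of the shortest open paths from `s` to `t` and to `t'`. -/
noncomputable def pairDist (H : Digraph V) (Z : Set V) (t t' s : V) : ℕ :=
  stepDist (openStep H Z) s t + stepDist (openStep H Z) s t'

/-- A shortest sequence of vertices between `Y` and `X` with closest common open ancestors. -/
structure IsShortestChain (H : Digraph V) (X Y Z : Set V) (k : ℕ) (t s : ℕ → V) : Prop
    extends IsChainSeq H X Y Z k t where
  disjoint : ∀ a b, a + 2 ≤ b → b ≤ k + 1 → ∀ v, v ∈ openAnc H Z (t a) → v ∉ openAnc H Z (t b)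
  disjoint_of_mem : ∀ x ∈ X, ∀ b < k, ∀ v, v ∈ openAnc H Z x → v ∉ openAnc H Z (t b)
  source_left : ∀ i ≤ k, s i ∈ openAnc H Z (t i)
  source_right : ∀ i ≤ k, s i ∈ openAnc H Z (t (i + 1))
  pairDist_le : ∀ i ≤ k, ∀ v, v ∈ openAnc H Z (t i) → v ∈ openAnc H Z (t (i + 1)) →
    pairDist H Z (t i) (t (i + 1)) (s i) ≤ pairDist H Z (t i) (t (i + 1)) v
  pairDist_le_of_mem : ∀ x ∈ X, ∀ v, v ∈ openAnc H Z (t k) → v ∈ openAnc H Z x →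
    pairDist H Z (t k) (t (k + 1)) (s k) ≤ pairDist H Z (t k) x v

theorem IsConnected.exists_isShortestChain (h : IsConnected H X Y Z) :
    ∃ k t s, IsShortestChain H X Y Z k t s := by
  classical
  have hex := h.exists_isChainSeq
  let k := Nat.find hex
  have hmin : ∀ k', k' < k → ∀ t, ¬ IsChainSeq H X Y Z k' t := fun k' hk' t ht =>
    Nat.find_min hex hk' ⟨t, ht⟩
  -- Among the chains of least length, the last pair is minimized over the chain as well, so that no
  -- other element of `X` is closer than `t (k + 1)`. The other common ancestors are then minimized
  -- for this fixed chain.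
  obtain ⟨⟨t, sk⟩, ⟨ht, hsk⟩, htmin⟩ := exists_argmin
    (fun p : (ℕ → V) × V => pairDist H Z (p.1 k) (p.1 (k + 1)) p.2)
    (s := {p | IsChainSeq H X Y Z k p.1 ∧
      p.2 ∈ openAnc H Z (p.1 k) ∩ openAnc H Z (p.1 (k + 1))}) (by
      obtain ⟨t, ht⟩ := Nat.find_spec hex
      obtain ⟨s, hs⟩ := ht.nonempty k le_rfl
      exact ⟨(t, s), ht, hs⟩)
  have hs : ∀ i, ∃ v, i ≤ k → v ∈ openAnc H Z (t i) ∩ openAnc H Z (t (i + 1)) ∧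
      ∀ w ∈ openAnc H Z (t i) ∩ openAnc H Z (t (i + 1)),
        pairDist H Z (t i) (t (i + 1)) v ≤ pairDist H Z (t i) (t (i + 1)) w := by
    intro i
    by_cases hi : i ≤ k
    · obtain ⟨v, hv, hvm⟩ := exists_argmin (pairDist H Z (t i) (t (i + 1))) (ht.nonempty i hi)
      exact ⟨v, fun _ => ⟨hv, hvm⟩⟩
    · exact ⟨t i, fun h => absurd h hi⟩
  choose s hs using hs
  refine ⟨k, t, s, { ht with
    disjoint := ?_
    disjoint_of_mem := ?_
    source_left := fun i hi => (hs i hi).1.1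
    source_right := fun i hi => (hs i hi).1.2
    pairDist_le := fun i hi v h1 h2 => (hs i hi).2 v ⟨h1, h2⟩
    pairDist_le_of_mem := ?_ }⟩
  · intro a b hab hb v hva hvb
    -- A common open ancestor of two targets that are not neighbours allows the `b - a - 1` targets
    -- between them to be cut out.
    refine hmin (k - (b - a - 1)) (by omega) (fun i => if i ≤ a then t i else t (i + (b - a - 1)))
      ⟨by simpa using ht.zero_mem, fun i h1 h2 => ?_, ?_, fun i hi => ?_⟩
    · split_ifs with h
      · exact ht.mem i h1 (by omega)
      · exact ht.mem _ (by omega) (by omega)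
    · rw [if_neg (by omega), show k - (b - a - 1) + 1 + (b - a - 1) = k + 1 by omega]
      exact ht.last_mem
    · rcases lt_trichotomy i a with h | h | h
      · rw [if_pos h.le, if_pos (by omega)]
        exact ht.nonempty i (by omega)
      · subst h
        rw [if_pos le_rfl, if_neg (by omega), show i + 1 + (b - i - 1) = b by omega]
        exact ⟨v, hva, hvb⟩
      · rw [if_neg (by omega), if_neg (by omega),
          show i + 1 + (b - a - 1) = i + (b - a - 1) + 1 by omega]
        exact ht.nonempty _ (by omega)
  · intro x hx b hb v hvx hvb
    refine hmin b hb (fun i => if i ≤ b then t i else x)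
      ⟨by simpa using ht.zero_mem, fun i h1 h2 => ?_, by simpa using hx, fun i hi => ?_⟩
    · simpa [h2] using ht.mem i h1 (by omega)
    · rw [if_pos hi]
      split_ifs with h
      · exact ht.nonempty i (by omega)
      · have : i = b := by omega
        subst this
        exact ⟨v, hvb, hvx⟩
  · intro x hx v h1 h2
    have h3 := (hs k le_rfl).2 sk hsk
    refine h3.trans ?_
    have h4 := htmin (fun i => if i ≤ k then t i else x, v) ⟨⟨by simpa using ht.zero_mem,
      fun i h1 h2 => ?_, by simpa using hx, fun i hi => ?_⟩, by simpa using ⟨h1, h2⟩⟩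
    · simpa using h4
    · simpa [h2] using ht.mem i h1 h2
    · dsimp only
      rw [if_pos hi]
      split_ifs with h
      · exact ht.nonempty i hi
      · have : i = k := by omega
        subst this
        exact ⟨v, h1, h2⟩

end Chain

end SCGAdjustment

namespace SCGAdjustment

/-! ### The linear model of a shortest chain -/

namespace IsShortestChain

open Relation

variable {V : Type*} {G H : Digraph V} {X Y Z : Set V} {k : ℕ} {t s : ℕ → V}

theorem source_mem (c : IsShortestChain H X Y Z k t s) {i j : ℕ} (hi : i ≤ k)
    (hj : j = i ∨ j = i + 1) : s i ∈ openAnc H Z (t j) := by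
  rcases hj with rfl | rfl
  · exact c.source_left _ hi
  · exact c.source_right _ hi

/-- Equal targets would give a shortcut in the chain, or a common element of two of the sets `X`,
`Y`, `Z`. -/
theorem target_injective (c : IsShortestChain H X Y Z k t s) (hXY : Disjoint X Y)
    (hXZ : Disjoint X Z) (hYZ : Disjoint Y Z) {j j' : ℕ} (hj : j ≤ k + 1) (hj' : j' ≤ k + 1)
    (h : t j = t j') : j = j' := by
  wlog hlt : j < j' generalizing j j'
  · rcases lt_trichotomy j j' with h1 | h1 | h1
    · exact this hj hj' h h1
    · exact h1
    · exact (this hj' hj h.symm h1).symm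
  exfalso
  rcases Nat.lt_or_ge (j + 1) j' with h2 | h2
  · have h3 := c.source_left j (by omega)
    exact c.disjoint j j' h2 hj' _ h3 (h ▸ h3)
  · obtain rfl : j' = j + 1 := by omega
    rcases Nat.eq_zero_or_pos j with rfl | h0
    · have h3 := c.zero_mem
      rcases Nat.eq_zero_or_pos k with rfl | hk
      · exact Set.disjoint_left.1 hXY c.last_mem (h ▸ h3)
      · exact Set.disjoint_left.1 hYZ h3 (h ▸ c.mem 1 le_rfl hk)
    · have h3 := c.mem j h0 (by omega)
      rcases Nat.lt_or_ge j k with hk | hk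
      · refine c.disjoint (j - 1) (j + 1) (by omega) hj' (s (j - 1))
          (c.source_left _ (by omega)) ?_
        rw [← h]
        exact c.source_mem (by omega) (by omega)
      · obtain rfl : j = k := by omega
        exact Set.disjoint_left.1 hXZ c.last_mem (h ▸ h3)

theorem notMem_or_eq_of_mem_leg {a b v : V} (h : ReflTransGen (openStep H Z) a b)
    (hv : v ∈ leg (openStep H Z) a b) : v ∉ Z ∨ v = b := by
  rcases (reflTransGen_of_mem_leg h hv).2.cases_head with h1 | ⟨w, h1, -⟩
  · exact .inr h1
  · exact .inl h1.2

/-- The paths from the sources to different targets meet at most in a common source. -/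
theorem eq_or_of_mem_leg (c : IsShortestChain H X Y Z k t s) (hXY : Disjoint X Y)
    (hXZ : Disjoint X Z) (hYZ : Disjoint Y Z) {i j i' j' : ℕ} (hi : i ≤ k) (hi' : i' ≤ k)
    (hj : j = i ∨ j = i + 1) (hj' : j' = i' ∨ j' = i' + 1) {v : V}
    (hv : v ∈ leg (openStep H Z) (s i) (t j)) (hv' : v ∈ leg (openStep H Z) (s i') (t j')) :
    j = j' ∨ i = i' ∧ v = s i := by
  wlog hlt : j < j' generalizing i j i' j'
  · rcases lt_trichotomy j j' with h1 | h1 | h1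
    · exact this hi hi' hj hj' hv hv' h1
    · exact .inl h1
    · rcases this hi' hi hj' hj hv' hv h1 with h | ⟨h, h'⟩
      · exact .inl h.symm
      · exact .inr ⟨h.symm, h ▸ h'⟩
  have hs := c.source_mem hi hj
  have hs' := c.source_mem hi' hj'
  have hvZ : v ∉ Z := by
    intro hvZ
    have h1 := (notMem_or_eq_of_mem_leg hs.2 hv).resolve_left (not_not.2 hvZ)
    have h2 := (notMem_or_eq_of_mem_leg hs'.2 hv').resolve_left (not_not.2 hvZ)
    have := c.target_injective hXY hXZ hYZ (by omega) (by omega) (h1.symm.trans h2)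
    omega
  have hr := reflTransGen_of_mem_leg hs.2 hv
  have hr' := reflTransGen_of_mem_leg hs'.2 hv'
  have hj1 : j' = j + 1 := by
    by_contra hne
    exact c.disjoint j j' (by omega) (by omega) v ⟨hvZ, hr.2⟩ ⟨hvZ, hr'.2⟩
  subst hj1
  -- Through `v`, the source `s i` also reaches `t (j + 1)`; if `i = j - 1`, this is a shortcut.
  have hi1 : i = j := by
    by_contra hne
    exact c.disjoint i (j + 1) (by omega) (by omega) (s i) (c.source_left i hi)
      ⟨hs.1, hr.1.trans hr'.2⟩
  subst hi1
  have hi2 : i = i' := by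
    by_contra hne
    exact c.disjoint i (i' + 1) (by omega) (by omega) (s i') ⟨hs'.1, hr'.1.trans hr.2⟩
      (c.source_right i' hi')
  subst hi2
  refine .inr ⟨rfl, ?_⟩
  -- Both legs start at `s i` and pass through `v`, so `v` would be a closer common ancestor unless
  -- it is the source.
  have h1 := c.pairDist_le i hi v ⟨hvZ, hr.2⟩ ⟨hvZ, hr'.2⟩
  have h2 := stepDist_add_le_of_mem_leg (R := openStep H Z) hs.2 hv
  have h3 := stepDist_add_le_of_mem_leg (R := openStep H Z) hs'.2 hv'
  unfold pairDist at h1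
  exact (eq_of_stepDist_eq_zero (R := openStep H Z) hr.1 (by omega)).symm

/-- The vertex `v` is on one of the two paths from the source `s i`. -/
def OnLegs (H : Digraph V) (Z : Set V) (t s : ℕ → V) (i : ℕ) (v : V) : Prop :=
  ∃ j, (j = i ∨ j = i + 1) ∧ v ∈ leg (openStep H Z) (s i) (t j)

/-- The edge from `u` to `v` is on one of the paths from the sources to the targets. -/
def LegEdge (H : Digraph V) (Z : Set V) (k : ℕ) (t s : ℕ → V) (u v : V) : Prop :=
  ∃ i ≤ k, ∃ j, (j = i ∨ j = i + 1) ∧ u ∈ leg (openStep H Z) (s i) (t j) ∧ u ≠ t j ∧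
    next (openStep H Z) (t j) u = v

theorem finite_legEdge (v : V) : {u | LegEdge H Z k t s u v}.Finite := by
  refine (((Set.finite_Iic k).prod (Set.finite_Iic (k + 1))).biUnion
    fun p _ => finite_leg (R := openStep H Z) (s p.1) (t p.2)).subset ?_
  rintro u ⟨i, hi, j, hj, hu, -⟩
  exact Set.mem_biUnion (x := (i, j)) ⟨hi, by simp only [Set.mem_Iic]; omega⟩ hu

/-- The vertices from which an edge of the paths leads to `v`. -/
noncomputable def legParents (H : Digraph V) (Z : Set V) (k : ℕ) (t s : ℕ → V) (v : V) : Finset V :=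
  (finite_legEdge (H := H) (Z := Z) (k := k) (t := t) (s := s) v).toFinset

theorem mem_legParents {u v : V} : u ∈ legParents H Z k t s v ↔ LegEdge H Z k t s u v :=
  Set.Finite.mem_toFinset _

theorem onLegs_source (c : IsShortestChain H X Y Z k t s) (hXY : Disjoint X Y)
    (hXZ : Disjoint X Z) (hYZ : Disjoint Y Z) {i i' : ℕ} (hi : i ≤ k) (hi' : i' ≤ k) :
    OnLegs H Z t s i (s i') ↔ i = i' := by
  refine ⟨?_, ?_⟩
  · rintro ⟨j, hj, h⟩
    have h1 := c.eq_or_of_mem_leg hXY hXZ hYZ hi hi' hj (.inl rfl) h (left_mem_leg _ _)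
    have h2 := c.eq_or_of_mem_leg hXY hXZ hYZ hi hi' hj (.inr rfl) h (left_mem_leg _ _)
    omega
  · rintro rfl
    exact ⟨i, .inl rfl, left_mem_leg _ _⟩

theorem not_legEdge_source (c : IsShortestChain H X Y Z k t s) (hXY : Disjoint X Y)
    (hXZ : Disjoint X Z) (hYZ : Disjoint Y Z) {i : ℕ} (hi : i ≤ k) {u : V} :
    ¬ LegEdge H Z k t s u (s i) := by
  rintro ⟨i', hi', j, hj, hu, hut, he⟩
  have hs := c.source_mem hi' hj
  have h1 := next_mem_leg hs.2 hu hut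
  rw [he] at h1
  obtain rfl := (c.onLegs_source hXY hXZ hYZ hi' hi).1 ⟨j, hj, h1⟩
  exact next_ne_left hs.2 hu hut he

/-- `next` depends on the target but not on the source, so two legs to the same target coincide once
they meet. -/
theorem onLegs_of_legEdge (c : IsShortestChain H X Y Z k t s) (hXY : Disjoint X Y)
    (hXZ : Disjoint X Z) (hYZ : Disjoint Y Z) {i : ℕ} (hi : i ≤ k) {u v : V}
    (huv : LegEdge H Z k t s u v) (hu : OnLegs H Z t s i u) : ∃ j, (j = i ∨ j = i + 1) ∧
      u ∈ leg (openStep H Z) (s i) (t j) ∧ u ≠ t j ∧ next (openStep H Z) (t j) u = v := by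
  obtain ⟨i', hi', j', hj', hu', hut, he⟩ := huv
  obtain ⟨j, hj, hu⟩ := hu
  rcases c.eq_or_of_mem_leg hXY hXZ hYZ hi hi' hj hj' hu hu' with rfl | ⟨rfl, -⟩
  · exact ⟨j, hj, hu, hut, he⟩
  · exact ⟨j', hj', hu', hut, he⟩

-- The bit of `s i` arrives at a vertex other than a source along exactly one edge, or not at all.
-- So it is neither doubled, which would cancel it, nor lost, and the claimed solution satisfies the
-- equations.
open Classical in
theorem sum_legEdge (c : IsShortestChain H X Y Z k t s) (hXY : Disjoint X Y)
    (hXZ : Disjoint X Z) (hYZ : Disjoint Y Z) {i : ℕ} (hi : i ≤ k) {v : V}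
    (hv : ∀ i ≤ k, v ≠ s i) (b : ZMod 2) :
    ∑ u ∈ legParents H Z k t s v,
      (if OnLegs H Z t s i u then b else 0) = if OnLegs H Z t s i v then b else 0 := by
  split_ifs with h
  · obtain ⟨j, hj, hvj⟩ := h
    have hs := c.source_mem hi hj
    obtain ⟨u, hu, hut, he⟩ := exists_of_mem_leg hs.2 hvj (hv i hi)
    rw [Finset.sum_eq_single u]
    · rw [if_pos ⟨j, hj, hu⟩]
    · intro u' hu' hne
      rw [if_neg]
      intro hon
      obtain ⟨j', hj', hu', hut', he'⟩ := c.onLegs_of_legEdge hXY hXZ hYZ hi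
        (mem_legParents.1 hu') hon
      have h1 := next_mem_leg (c.source_mem hi hj').2 hu' hut'
      rw [he'] at h1
      rcases c.eq_or_of_mem_leg hXY hXZ hYZ hi hi hj hj' hvj h1 with rfl | ⟨-, h2⟩
      · exact hne (next_injOn_leg hs.2 hu' hu hut' hut (he'.trans he.symm))
      · exact hv i hi h2
    · intro hnot
      exact absurd (mem_legParents.2 ⟨i, hi, j, hj, hu, hut, he⟩) hnot
  · refine Finset.sum_eq_zero fun u hu => if_neg fun hon => h ?_
    obtain ⟨j, hj, hu', hut, he⟩ := c.onLegs_of_legEdge hXY hXZ hYZ hi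
      (mem_legParents.1 hu) hon
    have h1 := next_mem_leg (c.source_mem hi hj).2 hu' hut
    exact ⟨j, hj, he ▸ h1⟩

theorem isDescendant_of_onLegs (c : IsShortestChain H X Y Z k t s) {i : ℕ} (hi : i ≤ k) {v : V}
    (h : OnLegs H Z t s i v) : IsDescendant H (s i) v := by
  obtain ⟨j, hj, h⟩ := h
  exact ReflTransGen.mono (fun _ _ h => h.1) _ _
    (reflTransGen_of_mem_leg (c.source_mem hi hj).2 h).1

open Classical in
/-- The model in which each source is a noise bit that is passed on along the two paths that start
at the source. -/
noncomputable def linearModel (c : IsShortestChain H X Y Z k t s)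
    (hHG : ∀ u v, H.Adj u v → G.Adj u v) (hXY : Disjoint X Y)
    (hXZ : Disjoint X Z) (hYZ : Disjoint Y Z) : LinearModel G where
  par := legParents H Z k t s
  noisy := {v | ∃ i ≤ k, v = s i}
  sol n v := ∑ i ∈ Finset.range (k + 1), if OnLegs H Z t s i v then n (s i) else 0
  adj_of_mem := by
    intro u v h
    obtain ⟨i, hi, j, hj, hu, hut, he⟩ := mem_legParents.1 h
    exact he ▸ hHG _ _
      (next_spec (reflTransGen_of_mem_leg (c.source_mem hi hj).2 hu).2 hut).1.1
  measurable_sol v := by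
    refine Finset.measurable_fun_sum _ fun i _ => ?_
    split_ifs
    · exact measurable_pi_apply _
    · exact measurable_const
  sol_eq n v := by
    by_cases hv : ∃ i ≤ k, v = s i
    · obtain ⟨i, hi, rfl⟩ := hv
      rw [if_pos ⟨i, hi, rfl⟩, Finset.sum_eq_zero (s := legParents H Z k t s (s i))
        fun u hu => absurd (mem_legParents.1 hu)
          (c.not_legEdge_source hXY hXZ hYZ hi), zero_add, Finset.sum_eq_single i]
      · rw [if_pos ((c.onLegs_source hXY hXZ hYZ hi hi).2 rfl)]
      · intro i' hi' hne
        rw [if_neg]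
        rwa [c.onLegs_source hXY hXZ hYZ (by simpa [Nat.lt_succ_iff] using hi') hi]
      · intro h
        exact absurd (Finset.mem_range.2 (by omega)) h
    · rw [if_neg (show v ∉ {v | ∃ i ≤ k, v = s i} from hv), add_zero, Finset.sum_comm]
      refine Finset.sum_congr rfl fun i hi => ?_
      exact (c.sum_legEdge hXY hXZ hYZ (by simpa [Nat.lt_succ_iff] using hi)
        (fun i hi h => hv ⟨i, hi, h⟩) _).symm
  dependsOn_sol v := by
    intro n n' h
    refine Finset.sum_congr rfl fun i hi => ?_
    split_ifs with hon
    · exact h _ (IsDescendant.mono hHG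
        (c.isDescendant_of_onLegs (by simpa [Nat.lt_succ_iff] using hi) hon))
    · rfl

theorem onLegs_target_iff (c : IsShortestChain H X Y Z k t s) (hXY : Disjoint X Y)
    (hXZ : Disjoint X Z) (hYZ : Disjoint Y Z) {i j : ℕ} (hi : i ≤ k) (hj : j ≤ k + 1) :
    OnLegs H Z t s i (t j) ↔ j = i ∨ j = i + 1 := by
  refine ⟨?_, fun h => ⟨j, h, right_mem_leg (c.source_mem hi h).2⟩⟩
  rintro ⟨j', hj', h⟩
  have h1 : ∀ i' ≤ k, (j = i' ∨ j = i' + 1) → j' = j ∨ i = i' ∧ t j = s i := fun i' hi' h' =>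
    c.eq_or_of_mem_leg hXY hXZ hYZ hi hi' hj' h' h (right_mem_leg (c.source_mem hi' h').2)
  rcases Nat.lt_or_ge k j with hk | hk
  · have := h1 k le_rfl (by omega)
    omega
  · have := h1 j hk (.inl rfl)
    omega

section Properties

variable (c : IsShortestChain H X Y Z k t s) (hHG : ∀ u v, H.Adj u v → G.Adj u v)
  (hXY : Disjoint X Y) (hXZ : Disjoint X Z) (hYZ : Disjoint Y Z)

theorem sol_zero (n : V → ZMod 2) : (c.linearModel hHG hXY hXZ hYZ).sol n (t 0) = n (s 0) := by
  change ∑ i ∈ Finset.range (k + 1), _ = _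
  rw [Finset.sum_eq_single 0]
  · rw [if_pos ((c.onLegs_target_iff hXY hXZ hYZ (by omega) (by omega)).2 (.inl rfl))]
  · intro i hi hne
    have := Finset.mem_range.1 hi
    rw [if_neg]
    rw [c.onLegs_target_iff hXY hXZ hYZ (by omega) (by omega)]
    omega
  · intro h
    exact absurd (Finset.mem_range.2 (by omega)) h

theorem sol_last (n : V → ZMod 2) :
    (c.linearModel hHG hXY hXZ hYZ).sol n (t (k + 1)) = n (s k) := by
  change ∑ i ∈ Finset.range (k + 1), _ = _
  rw [Finset.sum_eq_single k]
  · rw [if_pos ((c.onLegs_target_iff hXY hXZ hYZ (by omega) (by omega)).2 (.inr rfl))]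
  · intro i hi hne
    have := Finset.mem_range.1 hi
    rw [if_neg]
    rw [c.onLegs_target_iff hXY hXZ hYZ (by omega) (by omega)]
    omega
  · intro h
    exact absurd (Finset.mem_range.2 (by omega)) h

theorem sol_succ (n : V → ZMod 2) {j : ℕ} (hj : j < k) :
    (c.linearModel hHG hXY hXZ hYZ).sol n (t (j + 1)) = n (s j) + n (s (j + 1)) := by
  classical
  change ∑ i ∈ Finset.range (k + 1), _ = _
  rw [← Finset.sum_filter, show (Finset.range (k + 1)).filter
    (fun i => OnLegs H Z t s i (t (j + 1))) = {j, j + 1} from ?_, Finset.sum_pair (by omega)]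
  ext i
  simp only [Finset.mem_filter, Finset.mem_range, Finset.mem_insert, Finset.mem_singleton]
  constructor
  · rintro ⟨h1, h2⟩
    rw [c.onLegs_target_iff hXY hXZ hYZ (by omega) (by omega)] at h2
    omega
  · intro h
    refine ⟨by omega, ?_⟩
    rw [c.onLegs_target_iff hXY hXZ hYZ (by omega) (by omega)]
    omega

/-- Each inner target is the sum of the bits of two successive sources, so the sum telescopes in
characteristic two. -/
theorem sol_zero_eq (n : V → ZMod 2) :
    (c.linearModel hHG hXY hXZ hYZ).sol n (t 0)
      = (c.linearModel hHG hXY hXZ hYZ).sol n (t (k + 1))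
        + ∑ j ∈ Finset.range k, (c.linearModel hHG hXY hXZ hYZ).sol n (t (j + 1)) := by
  rw [c.sol_zero, c.sol_last]
  have h : ∀ m ≤ k, n (s 0) = n (s m)
      + ∑ j ∈ Finset.range m, (c.linearModel hHG hXY hXZ hYZ).sol n (t (j + 1)) := by
    intro m
    induction m with
    | zero => simp
    | succ m ih =>
      intro hm
      rw [Finset.sum_range_succ, c.sol_succ hHG hXY hXZ hYZ n (by omega), ih (by omega)]
      have := CharTwo.add_self_eq_zero (n (s (m + 1)))
      linear_combination -this
  exact h k le_rfl

/-- By the length of the chain, another element of `X` can only be on a leg from `s k`. There it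
would form with `t k` a pair that is closer than `t k` and `t (k + 1)`. -/
theorem sol_eq_zero_of_mem (n : V → ZMod 2) {x : V} (hx : x ∈ X) (hne : x ≠ t (k + 1)) :
    (c.linearModel hHG hXY hXZ hYZ).sol n x = 0 := by
  change ∑ i ∈ Finset.range (k + 1), _ = _
  refine Finset.sum_eq_zero fun i hi => if_neg ?_
  rintro ⟨j, hj, hxj⟩
  have hik : i ≤ k := by simpa [Nat.lt_succ_iff] using hi
  have hs := c.source_mem hik hj
  have hr := reflTransGen_of_mem_leg hs.2 hxj
  obtain rfl : i = k := by
    by_contra hne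
    exact c.disjoint_of_mem x hx i (by omega) (s i) ⟨hs.1, hr.1⟩ (c.source_left i hik)
  have h2 := stepDist_add_le_of_mem_leg (R := openStep H Z) hs.2 hxj
  have h3 := c.pairDist_le_of_mem x hx (s i) (c.source_left i hik) ⟨hs.1, hr.1⟩
  unfold pairDist at h3
  rcases hj with rfl | rfl
  · have hxZ : x ∉ Z := Set.disjoint_left.1 hXZ hx
    have h4 := c.pairDist_le_of_mem x hx x ⟨hxZ, hr.2⟩ ⟨hxZ, .refl⟩
    unfold pairDist at h4
    rw [stepDist_self] at h4
    have h5 := eq_of_stepDist_eq_zero (R := openStep H Z) hr.1 (by omega)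
    have h6 := eq_of_stepDist_eq_zero (R := openStep H Z) (c.source_right j hik).2 (by omega)
    exact hne (h5.symm.trans h6)
  · exact hne (eq_of_stepDist_eq_zero (R := openStep H Z) hr.2 (by omega))

/-- An element of `Z` on a leg is an inner target, where two flipped bits cancel. Flipping all the
noise thus changes `t (k + 1)` and preserves `Z`, which is the source of admissibility. -/
theorem sol_add_one (n : V → ZMod 2) {z : V} (hz : z ∈ Z) :
    (c.linearModel hHG hXY hXZ hYZ).sol (n + 1) z = (c.linearModel hHG hXY hXZ hYZ).sol n z := by
  by_cases h : ∃ i ≤ k, OnLegs H Z t s i z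
  · obtain ⟨i, hi, j, hj, hzj⟩ := h
    obtain rfl := (notMem_or_eq_of_mem_leg (c.source_mem hi hj).2 hzj).resolve_left
      (not_not.2 hz)
    cases j with
    | zero => exact absurd hz (Set.disjoint_left.1 hYZ c.zero_mem)
    | succ j =>
      have hjk : j < k := by
        by_contra hjk
        obtain rfl : j = k := by omega
        exact Set.disjoint_left.1 hXZ c.last_mem hz
      rw [c.sol_succ _ _ _ _ _ hjk, c.sol_succ _ _ _ _ _ hjk]
      simp only [Pi.add_apply, Pi.one_apply]
      have := CharTwo.add_self_eq_zero (1 : ZMod 2)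
      linear_combination this
  · have h0 : ∀ n, (c.linearModel hHG hXY hXZ hYZ).sol n z = 0 := fun n =>
      Finset.sum_eq_zero (s := Finset.range (k + 1)) fun i hi => if_neg fun h' =>
        h ⟨i, by simpa [Nat.lt_succ_iff] using hi, h'⟩
    rw [h0, h0]

theorem mem_leg_of_mem_par {u v : V} (h : u ∈ (c.linearModel hHG hXY hXZ hYZ).par v)
    (hv : v ∈ leg (openStep H Z) (s 0) (t 0)) : u ∈ leg (openStep H Z) (s 0) (t 0) := by
  have huv : LegEdge H Z k t s u v := mem_legParents.1 h
  have huv' := huv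
  obtain ⟨i, hi, j, hj, hu, hut, he⟩ := huv
  have h1 := next_mem_leg (c.source_mem hi hj).2 hu hut
  rw [he] at h1
  rcases c.eq_or_of_mem_leg hXY hXZ hYZ hi (Nat.zero_le k) hj (.inl rfl) h1 hv with
    rfl | ⟨rfl, h2⟩
  · obtain rfl : i = 0 := by omega
    exact hu
  · subst h2
    exact absurd huv' (c.not_legEdge_source hXY hXZ hYZ hi)

end Properties

end IsShortestChain

end SCGAdjustment

namespace SCGAdjustment

/-! ### The adjustment formula in linear models -/

noncomputable section Evaluation

variable {S : Type*} [DecidableEq S] {Ω : S × ℤ → Type*} [∀ v, MeasurableSpace (Ω v)]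
  {G : Digraph (S × ℤ)} [∀ v, DiscreteMeasurableSpace (Ω v)] [∀ v, Countable (Ω v)]

theorem tsum_measure_event_inter (μ : Measure (∀ v, Ω v)) (A : Finset (S × ℤ))
    {B : Set (∀ v, Ω v)} (hB : MeasurableSet B) :
    ∑' z : ∀ v : A, Ω v, μ (event A z ∩ B) = μ B := by
  rw [← measure_iUnion, ← Set.iUnion_inter, iUnion_event, Set.univ_inter]
  · intro z z' h
    exact (pairwise_disjoint_event A h).mono Set.inter_subset_left Set.inter_subset_left
  · exact fun z => (measurableSet_event A z).inter hB

/-- Both sides of the formula are additive in `y`, so the values of the other elements of `Y` can be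
summed out; the tests below look at one vertex only. -/
theorem doProb_singleton_eq [Fintype S] [∀ v, Nonempty (Ω v)] {κ : Mechanisms G Ω}
    {P : Measure (∀ v, Ω v)} (hG : IsFTCG G) (hP : IsCompatible G κ P) {X Y Z : Finset (S × ℤ)}
    {ξ : ∀ v, Ω v} (h : ∀ y : ∀ v : Y, Ω v,
      doProb κ P X Y (fun v => ξ v) y = adjustedProb P X Y Z (fun v => ξ v) y)
    {y : S × ℤ} (hy : y ∈ Y) (υ : ∀ v, Ω v) :
    doProb κ P X {y} (fun v => ξ v) (fun v => υ v)
      = adjustedProb P X {y} Z (fun v => ξ v) (fun v => υ v) := by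
  classical
  have := hP.isProbabilityMeasure
  obtain ⟨a, b, hW⟩ := exists_window_superset (X ∪ Y)
  have hX : X ⊆ window a b := fun v hv => hW (by simp [hv])
  have hY : Y ⊆ window a b := fun v hv => hW (by simp [hv])
  have hy' : {y} ⊆ window a b := fun v hv => hY (by rw [Finset.mem_singleton.1 hv]; exact hy)
  set A := Y.erase y with hA
  have hev : ∀ w : ∀ v : A, Ω v, (event Y fun v => Function.updateFinset υ A w v)
      = (event A w) ∩ event {y} fun v => υ v := by
    intro w
    rw [event_eq_restrict w υ]
    ext ω
    simp only [Set.mem_inter_iff, mem_event_restrict, Finset.mem_singleton, forall_eq]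
    have hyA : y ∉ A := by simp [hA]
    refine ⟨fun h => ⟨fun v hv => h v (Finset.mem_of_mem_erase hv), ?_⟩, fun h v hv => ?_⟩
    · have := h y hy
      rwa [Function.updateFinset, dif_neg hyA] at this
    · by_cases hvy : v = y
      · subst hvy
        rw [Function.updateFinset, dif_neg hyA]
        exact h.2
      · exact h.1 v (Finset.mem_erase.2 ⟨hvy, hv⟩)
  have hφ := isFactorSystem_doFactor hG.acyclic hP.isMarkovKernel ξ X fun _ => ∅
  rw [doProb_eq hG hP ξ υ hX hy',
    ← tsum_lintegral_margProd hφ P _ A υ (measurable_eventInd {y} υ)]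
  have h1 : ∀ w : ∀ v : A, Ω v, (fun η => eventInd A (Function.updateFinset υ A w) η
      * eventInd {y} υ η) = eventInd Y (Function.updateFinset υ A w) := by
    intro w
    funext η
    rw [eventInd_mul_eventInd, eventInd, hev, ← event_eq_restrict]
  simp_rw [h1, ← doProb_eq hG hP ξ _ hX hY, h, adjustedProb_eq_tsum]
  rw [ENNReal.tsum_comm]
  refine tsum_congr fun z => ?_
  rw [ENNReal.tsum_mul_right]
  simp_rw [hev]
  rw [tsum_measure_event_inter _ _ (measurableSet_event _ _)]

namespace LinearModel

variable [∀ v, Nontrivial (Ω v)] (M : LinearModel G)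

/-- The graph of the equations of the model. -/
def parGraph : Digraph (S × ℤ) where
  Adj u v := u ∈ M.par v

theorem factor_mech (ξ : ∀ v, Ω v) (v : S × ℤ) (η : ∀ v, Ω v) :
    factor (M.mech Ω) ξ (fun _ => ∅) v η = noiseBit {b | M.eqn v η b = η v} := by
  unfold factor
  simp only [Set.mem_empty_iff_false, if_false]
  exact M.mech_apply v η (η v)

theorem isMarkovKernel_mech (v : S × ℤ) : IsMarkovKernel (M.mech Ω v) :=
  ⟨fun _ => Measure.isProbabilityMeasure_map Measurable.of_discrete.aemeasurable⟩

theorem dependsOn_factor_mech (ξ : ∀ v, Ω v) (v : S × ℤ) :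
    DependsOn (factor (M.mech Ω) ξ (fun _ => ∅) v) (insert v {u | M.parGraph.Adj u v}) := by
  intro η η' h
  rw [M.factor_mech, M.factor_mech, h v (Set.mem_insert _ _)]
  congr 1
  ext b
  simp only [Set.mem_ofPred_eq]
  rw [M.eqn_congr fun u hu => h u (.inr hu)]

theorem isFactorSystem_factor (hG : IsAcyclic G) (ξ : ∀ v, Ω v) :
    IsFactorSystem M.parGraph (factor (M.mech Ω) ξ fun _ => ∅) :=
  { SCGAdjustment.isFactorSystem_factor hG M.isMarkovKernel_mech ξ fun _ => ∅ with
    dependsOn := M.dependsOn_factor_mech ξ }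

theorem isFactorSystem_doFactor (hG : IsAcyclic G) (ξ : ∀ v, Ω v) (X : Finset (S × ℤ)) :
    IsFactorSystem M.parGraph (doFactor (M.mech Ω) ξ X fun _ => ∅) :=
  { SCGAdjustment.isFactorSystem_doFactor hG M.isMarkovKernel_mech ξ X fun _ => ∅ with
    dependsOn := fun v η η' h => by
      unfold doFactor
      rw [M.dependsOn_factor_mech ξ v h, h v (Set.mem_insert _ _)] }

-- `A` need only be closed under the parents that the equations use, not under those of `G`. Hence
-- the observed and the intervened law can be compared on a small set of factors.
open Classical in
theorem lintegral_law_eq [Fintype S] (hG : IsFTCG G) (X : Finset (S × ℤ)) (ξ : ∀ v, Ω v)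
    {A : Set (S × ℤ)} (hA : ∀ u v, u ∈ M.par v → v ∈ A → u ∈ A) (a b : ℤ)
    {h h' : (∀ v, Ω v) → ℝ≥0∞} (hh : Measurable h) (hh' : Measurable h')
    (hd : DependsOn h (A ∩ {v | v.2 ≤ b})) (hd' : DependsOn h' A)
    (heq : ∀ η, h η * ∏ v ∈ (window a b).filter (· ∈ A), factor (M.mech Ω) ξ (fun _ => ∅) v η
      = h' η * ∏ v ∈ (window a b).filter (· ∈ A), doFactor (M.mech Ω) ξ X (fun _ => ∅) v η) :
    ∫⁻ ω, h ω ∂(M.law Ω)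
      = ∫⁻ ω, margProd (doFactor (M.mech Ω) ξ X fun _ => ∅) (window a b) h' ω ∂(M.law Ω) := by
  have hD : IsAcyclic M.parGraph := hG.acyclic.mono fun u v h => M.adj_of_mem h
  have hsub : (window a b).filter (· ∈ A) ⊆ window a b := Finset.filter_subset _ _
  have hcl : ∀ u v, M.parGraph.Adj u v → v ∈ (window a b).filter (· ∈ A) → u ∈ window a b →
      u ∈ (window a b).filter (· ∈ A) := fun u v huv hv hu =>
    Finset.mem_filter.2 ⟨hu, hA u v huv (Finset.mem_filter.1 hv).2⟩
  have hAsub : A ⊆ {v | v ∈ window a b → v ∈ (window a b).filter (· ∈ A)} := fun v hv hvW =>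
    Finset.mem_filter.2 ⟨hvW, hv⟩
  rw [(M.isCompatible hG).lintegral_eq ξ a b hh (hd.mono Set.inter_subset_right),
    (M.isFactorSystem_factor hG.acyclic ξ).margProd_eq hD hsub hcl hh
      (hd.mono (Set.inter_subset_left.trans hAsub)),
    (M.isFactorSystem_doFactor hG.acyclic ξ X).margProd_eq hD hsub hcl hh' (hd'.mono hAsub)]
  unfold margProd
  simp_rw [heq]

theorem doProb_eq_of_disjoint [Fintype S] (hG : IsFTCG G) {X : Finset (S × ℤ)} (ξ υ : ∀ v, Ω v)
    {A : Set (S × ℤ)} (hA : ∀ u v, u ∈ M.par v → v ∈ A → u ∈ A) (hAX : ∀ v ∈ A, v ∉ X)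
    {y : S × ℤ} (hy : y ∈ A) :
    doProb (M.mech Ω) (M.law Ω) X {y} (fun v => ξ v) (fun v => υ v)
      = M.law Ω (event {y} fun v => υ v) := by
  classical
  obtain ⟨a, b, hW⟩ := exists_window_superset (X ∪ {y})
  have hyW : y ∈ window a b := hW (by simp)
  rw [doProb_eq hG (M.isCompatible hG) ξ υ (fun v hv => hW (by simp [hv]))
    (fun v hv => hW (Finset.mem_union_right _ hv)), ← lintegral_eventInd]
  have hd := dependsOn_eventInd {y} υ
  refine (M.lintegral_law_eq hG X ξ hA a b (measurable_eventInd _ _) (measurable_eventInd _ _)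
    (hd.mono ?_) (hd.mono ?_) fun η => ?_).symm
  · intro v hv
    obtain rfl : v = y := by simpa using hv
    exact ⟨hy, (mem_window.1 hyW).2⟩
  · intro v hv
    obtain rfl : v = y := by simpa using hv
    exact hy
  · congr 1
    refine Finset.prod_congr rfl fun v hv => ?_
    rw [doFactor, if_neg (hAX v (Finset.mem_filter.1 hv).2)]

/-- The variable `x` is pure noise and the only element of `X` in `A`. Its observed factor is the
constant `noiseBit {b}` where the intervened one is a point mass, and all other factors in `A`
agree. -/
theorem law_eq_mul_doProb [Fintype S] (hG : IsFTCG G) {X : Finset (S × ℤ)} (ξ υ : ∀ v, Ω v)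
    {A : Set (S × ℤ)} (hA : ∀ u v, u ∈ M.par v → v ∈ A → u ∈ A) {x y : S × ℤ} (hx : x ∈ X)
    (hxA : x ∈ A) (hAX : ∀ v ∈ A, v ∈ X → v = x) (hpar : M.par x = ∅) (hnoisy : x ∈ M.noisy)
    {b : ZMod 2} (hξ : ξ x = enc (Ω x) b) (hy : y ∈ A) :
    M.law Ω ((event {x} fun v => ξ v) ∩ event {y} fun v => υ v)
      = noiseBit {b} * doProb (M.mech Ω) (M.law Ω) X {y} (fun v => ξ v) (fun v => υ v) := by
  classical
  obtain ⟨a, c, hW⟩ := exists_window_superset (X ∪ {y})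
  have hyW : y ∈ window a c := hW (by simp)
  have hxW : x ∈ window a c := hW (by simp [hx])
  have hφ := M.isFactorSystem_doFactor hG.acyclic ξ X
  rw [doProb_eq hG (M.isCompatible hG) ξ υ (fun v hv => hW (by simp [hv]))
    (fun v hv => hW (Finset.mem_union_right _ hv)),
    ← lintegral_const_mul _ (hφ.measurable_margProd _ (measurable_eventInd _ _))]
  have h1 : ∀ ω, noiseBit {b} * margProd (doFactor (M.mech Ω) ξ X fun _ => ∅) (window a c)
      (eventInd {y} υ) ω = margProd (doFactor (M.mech Ω) ξ X fun _ => ∅) (window a c)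
        (fun η => noiseBit {b} * eventInd {y} υ η) ω := by
    intro ω
    simp only [margProd, lmarginal_count, mul_assoc]
    rw [ENNReal.tsum_mul_left]
  simp_rw [h1]
  rw [← lintegral_indicator_one ((measurableSet_event _ _).inter (measurableSet_event _ _))]
  simp_rw [← eventInd_mul_eventInd]
  have hdx := dependsOn_eventInd {x} ξ
  have hdy := dependsOn_eventInd {y} υ
  refine M.lintegral_law_eq hG X ξ hA a c
    ((measurable_eventInd _ _).fun_mul (measurable_eventInd _ _))
    ((measurable_eventInd _ _).const_mul _)
    (dependsOn_mul (hdx.mono ?_) (hdy.mono ?_))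
    (fun η η' h => congrArg (noiseBit {b} * ·) (hdy fun v hv => h v ?_)) fun η => ?_
  · intro v hv
    obtain rfl : v = x := by simpa using hv
    exact ⟨hxA, (mem_window.1 hxW).2⟩
  · intro v hv
    obtain rfl : v = y := by simpa using hv
    exact ⟨hy, (mem_window.1 hyW).2⟩
  · obtain rfl : v = y := by simpa using hv
    exact hy
  · have hxmem : x ∈ (window a c).filter (· ∈ A) := Finset.mem_filter.2 ⟨hxW, hxA⟩
    rw [← Finset.mul_prod_erase _ _ hxmem, ← Finset.mul_prod_erase _ _ hxmem]
    have h2 : ∏ v ∈ ((window a c).filter (· ∈ A)).erase x,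
          doFactor (M.mech Ω) ξ X (fun _ => ∅) v η
        = ∏ v ∈ ((window a c).filter (· ∈ A)).erase x, factor (M.mech Ω) ξ (fun _ => ∅) v η := by
      refine Finset.prod_congr rfl fun v hv => ?_
      rw [doFactor, if_neg]
      intro hvX
      obtain ⟨hne, hv⟩ := Finset.mem_erase.1 hv
      exact hne (hAX v (Finset.mem_filter.1 hv).2 hvX)
    rw [h2, doFactor, if_pos hx, eventInd_apply]
    simp only [Finset.mem_singleton, forall_eq]
    split_ifs with hηx
    · have h3 : factor (M.mech Ω) ξ (fun _ => ∅) x η = noiseBit {b} := by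
        rw [M.factor_mech, hηx, hξ]
        congr 1
        ext c
        simp [eqn, hpar, hnoisy, enc_injective.eq_iff]
      rw [h3]
      ring
    · simp

/-- The values at which the adjustment formula is tested: `1` at `x` and `0` at all other
vertices. -/
def testValue (Ω : S × ℤ → Type*) [∀ v, Nontrivial (Ω v)] (x v : S × ℤ) : Ω v :=
  enc (Ω v) (if v = x then 1 else 0)

/-- Given noise that produces `z`, this noise or its complement gives `x` the value 1 and still
produces `z`. Only finitely many bits matter, so such noise has positive probability. -/
theorem isAdmissible_law {X Z F : Finset (S × ℤ)} {x a : S × ℤ}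
    (hF : ∀ n n' : S × ℤ → ZMod 2, (∀ v ∈ F, n v = n' v) → ∀ v, M.sol n v = M.sol n' v)
    (hx : ∀ n, M.sol n x = n a) (hX : ∀ n, ∀ v ∈ X, v ≠ x → M.sol n v = 0)
    (hZ : ∀ n, ∀ v ∈ Z, M.sol (n + 1) v = M.sol n v) :
    IsAdmissible (M.law Ω) X Z fun v => testValue Ω x v := by
  intro z hz
  rw [M.law_apply (measurableSet_event _ _)] at hz
  rw [M.law_apply ((measurableSet_event _ _).inter (measurableSet_event _ _))]
  obtain ⟨n, hn⟩ := nonempty_of_measure_ne_zero hz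
  obtain ⟨n', hn', hnZ⟩ : ∃ n' : S × ℤ → ZMod 2, n' a = 1 ∧ ∀ v ∈ Z, M.sol n' v = M.sol n v := by
    have h2 : ∀ c : ZMod 2, c = 1 ∨ c + 1 = 1 := by decide
    rcases h2 (n a) with h | h
    · exact ⟨n, h, fun _ _ => rfl⟩
    · exact ⟨n + 1, h, hZ n⟩
  refine fun h0 => noise_agree_ne_zero F n' (measure_mono_null (fun m hm => ?_) h0)
  have hm' := hF m n' hm
  refine ⟨fun v => ?_, fun v => ?_⟩
  · simp only [config, testValue]
    congr 1
    rw [hm']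
    split_ifs with hvx
    · rw [hvx, hx, hn']
    · exact hX n' v v.2 hvx
  · rw [← hn v]
    simp only [config]
    rw [hm', hnZ v v.2]

/-- Given `x`, the event for `Y` is decided by `Z`: the conditional probability is 1 or 0 according
to whether `z` lies in `D`, and the sum is the probability of `D`. -/
theorem adjustedProb_law [Fintype S] {X Y Z : Finset (S × ℤ)} {x : ∀ v : X, Ω v} {y : ∀ v : Y, Ω v}
    (hadm : IsAdmissible (M.law Ω) X Z x) {D : Set (∀ v, Ω v)} (hD : MeasurableSet D)
    (hDZ : DependsOn (· ∈ D) (Z : Set (S × ℤ)))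
    (h : ∀ n, M.config n ∈ event X x → (M.config n ∈ event Y y ↔ M.config n ∈ D)) :
    adjustedProb (M.law Ω) X Y Z x y = noise (S × ℤ) {n | M.config (Ω := Ω) n ∈ D} := by
  have := M.isProbabilityMeasure_law (Ω := Ω)
  rw [adjustedProb_eq_tsum, ← M.law_apply hD, ← tsum_measure_event_inter _ Z hD]
  refine tsum_congr fun z => ?_
  have hX := measurableSet_event X x
  have hY := measurableSet_event Y y
  have hZ := measurableSet_event Z z
  by_cases h0 : M.law Ω (event Z z) = 0
  · rw [h0, mul_zero]
    exact (measure_mono_null Set.inter_subset_left h0).symm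
  have hB := hadm z h0
  have hmem : ∀ ω ∈ event Z z, ∀ ω' ∈ event Z z, ω ∈ D → ω' ∈ D := fun ω hω ω' hω' hωD =>
    (iff_of_eq (hDZ fun v hv => (hω ⟨v, hv⟩).trans (hω' ⟨v, hv⟩).symm)).1 hωD
  rw [cond_apply (hX.inter hZ)]
  by_cases hne : ∃ ω ∈ event Z z, ω ∈ D
  · obtain ⟨ω, hω, hωD⟩ := hne
    rw [Set.inter_eq_left.2 fun ω' hω' => hmem ω hω ω' hω' hωD]
    have h1 : M.law Ω (event X x ∩ event Z z ∩ event Y y) = M.law Ω (event X x ∩ event Z z) := by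
      rw [M.law_apply ((hX.inter hZ).inter hY), M.law_apply (hX.inter hZ)]
      congr 1
      ext n
      exact and_iff_left_of_imp fun hn => (h n hn.1).2 (hmem ω hω _ hn.2 hωD)
    rw [h1, ENNReal.inv_mul_cancel hB (measure_ne_top _ _), one_mul]
  · push Not at hne
    rw [(Set.disjoint_left.2 hne).inter_eq, measure_empty]
    have h1 : M.law Ω (event X x ∩ event Z z ∩ event Y y) = 0 := by
      rw [M.law_apply ((hX.inter hZ).inter hY)]
      convert measure_empty (μ := noise (S × ℤ))
      exact Set.eq_empty_of_forall_notMem fun n hn => hne _ hn.1.2 ((h n hn.1.1).1 hn.2)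
    rw [h1, mul_zero, zero_mul]

theorem config_mem_event_singleton {n : S × ℤ → ZMod 2} {v : S × ℤ} {b : ZMod 2}
    {a : ∀ u : ({v} : Finset (S × ℤ)), Ω u}
    (ha : a ⟨v, Finset.mem_singleton_self v⟩ = enc (Ω v) b) :
    M.config n ∈ event {v} a ↔ M.sol n v = b := by
  have h : M.config n ∈ event {v} a ↔ M.config n v = a ⟨v, Finset.mem_singleton_self v⟩ := by
    refine ⟨fun h => h ⟨v, Finset.mem_singleton_self v⟩, fun h u => ?_⟩
    obtain ⟨u, hu⟩ := u
    obtain rfl := Finset.mem_singleton.1 hu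
    exact h
  rw [h, ha, config, enc_injective.eq_iff]

end LinearModel

end Evaluation

end SCGAdjustment

namespace SCGAdjustment

/-! ### Necessity of the adjustment criterion -/

noncomputable section Necessity

open Relation

section CausalModel

variable {V : Type*} {G : Digraph V} {X Y Z : Set V}

/-- The vertices to which a directed path that avoids `X` leads from `w`. -/
def avoidingDesc (G : Digraph V) (X : Set V) (w : V) : Set V :=
  {v | ReflTransGen (fun a b => G.Adj a b ∧ b ∉ X) w v}

theorem notMem_of_mem_avoidingDesc {w v : V} (hw : w ∉ X) (hv : v ∈ avoidingDesc G X w) :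
    v ∉ X := by
  rcases ReflTransGen.cases_tail hv with rfl | ⟨_, _, h⟩
  · exact hw
  · exact h.2

theorem isDescendant_of_mem_avoidingDesc {w v : V} (hv : v ∈ avoidingDesc G X w) :
    IsDescendant G w v :=
  ReflTransGen.mono (fun _ _ h => h.1) _ _ hv

/-- Follow the directed path from `w` to `z` until it meets `Z` or is about to enter `X`. If it
enters `X` first and no such `z'` existed, the causal path from `w` to `Y` would be open too, and
`w` would connect `X` with `Y`. -/
theorem exists_mem_avoidingDesc (hC : ¬ IsConnected (backdoorGraph G X Y) X Y Z) {w z : V}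
    (hw : IsCausalNode G X Y w) (hz : z ∈ Z) (hwz : IsDescendant G w z) :
    ∃ z' ∈ Z, z' ∈ avoidingDesc G X w := by
  obtain ⟨hwX, y, hy, hwy⟩ := hw
  have key : ∀ a, IsDescendant G a z → a ∉ X → (∃ z' ∈ Z, z' ∈ avoidingDesc G X a) ∨
      ∃ x ∈ X, ReflTransGen (fun a b => (backdoorGraph G X Y).Adj a b ∧ a ∉ Z) a x := by
    intro a ha
    induction ha using ReflTransGen.head_induction_on with
    | refl => exact fun _ => .inl ⟨z, hz, .refl⟩
    | @head a b hab _ ih =>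
      intro haX
      by_cases haZ : a ∈ Z
      · exact .inl ⟨a, haZ, .refl⟩
      have hstep : (backdoorGraph G X Y).Adj a b := ⟨hab, fun h => haX h.1⟩
      by_cases hbX : b ∈ X
      · exact .inr ⟨b, hbX, .single ⟨hstep, haZ⟩⟩
      · rcases ih hbX with ⟨z', hz', h⟩ | ⟨x, hx, h⟩
        · exact .inl ⟨z', hz', .head ⟨hab, hbX⟩ h⟩
        · exact .inr ⟨x, hx, .head ⟨hstep, haZ⟩ h⟩
  rcases key w hwz hwX with h | ⟨x, hx, hwx⟩
  · exact h
  by_contra hno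
  push Not at hno
  have hwZ : w ∉ Z := fun h => hno w h .refl
  have hopen : ReflTransGen (fun a b => (backdoorGraph G X Y).Adj a b ∧ a ∉ Z) w y := by
    clear hy
    induction hwy with
    | refl => exact .refl
    | @tail b c hwb hbc ih =>
      refine ih.tail ⟨⟨hbc.1, fun h => notMem_of_mem_avoidingDesc hwX hwb h.1⟩,
        fun h => hno b h hwb⟩
  exact hC ⟨x, hx, y, w, .base hy, ⟨hwZ, hwx⟩, ⟨hwZ, hopen⟩⟩

theorem exists_parent_of_mem_avoidingDesc {w v : V} (hv : v ∈ avoidingDesc G X w) (hne : v ≠ w) :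
    ∃ u ∈ avoidingDesc G X w, G.Adj u v := by
  rcases ReflTransGen.cases_tail hv with rfl | ⟨u, hu, h⟩
  · exact absurd rfl hne
  · exact ⟨u, hu, h.1⟩

open Classical in
/-- The model in which `x` is a noise bit, and `x` plus a second noise bit is passed on from `w` to
all vertices to which a directed path that avoids `X` leads from `w`. -/
def causalModel {x w : V} (hx : x ∈ X) (hxw : G.Adj x w) (hw : w ∉ X) : LinearModel G where
  par v := if h : v ∈ avoidingDesc G X w then
      if hne : v ≠ w then {(exists_parent_of_mem_avoidingDesc h hne).choose} else {x}
    else ∅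
  noisy := {x, w}
  sol n v := if v ∈ avoidingDesc G X w then n x + n w else if v = x then n x else 0
  adj_of_mem := by
    intro u v hu
    split_ifs at hu with h hne
    · rw [Finset.mem_singleton.1 hu]
      exact (exists_parent_of_mem_avoidingDesc h hne).choose_spec.2
    · rw [Finset.mem_singleton.1 hu, not_not.1 hne]
      exact hxw
    · exact absurd hu (Finset.notMem_empty _)
  measurable_sol v := by
    split_ifs
    · have h1 : Measurable fun n : V → ZMod 2 => n x := measurable_pi_apply x
      have h2 : Measurable fun n : V → ZMod 2 => n w := measurable_pi_apply w
      exact h1.add h2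
    · exact measurable_pi_apply x
    · exact measurable_const
  sol_eq n v := by
    have hxT : x ∉ avoidingDesc G X w := fun h => notMem_of_mem_avoidingDesc hw h hx
    have hxw' : w ≠ x := fun h => hw (h ▸ hx)
    by_cases h : v ∈ avoidingDesc G X w
    · have hvx : v ≠ x := fun he => hxT (he ▸ h)
      by_cases hne : v = w
      · subst hne
        simp [h, hxT]
      · have h1 := (exists_parent_of_mem_avoidingDesc h hne).choose_spec.1
        simp [h, hne, hvx, h1]
    · have hvw : v ≠ w := fun he => h (he ▸ .refl)
      simp [h, hvw]
      by_cases hvx : v = x <;> simp [hvx]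
  dependsOn_sol v := by
    intro n n' h
    dsimp only
    split_ifs with hv hvx
    · have hwv := isDescendant_of_mem_avoidingDesc hv
      rw [h x (.head hxw hwv), h w hwv]
    · subst hvx
      exact h v .refl
    · rfl

end CausalModel

variable {S : Type*} [DecidableEq S] [Fintype S] {Ω : S × ℤ → Type*}
  [∀ v, MeasurableSpace (Ω v)] [∀ v, DiscreteMeasurableSpace (Ω v)] [∀ v, Countable (Ω v)]
  [∀ v, Nontrivial (Ω v)] {G : Digraph (S × ℤ)} {X Y Z : Finset (S × ℤ)}

/-! ### The two counterexamples -/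

theorem noise_eval_one (v : S × ℤ) : noise (S × ℤ) {n | n v = 1} = 1 / 4 :=
  (noise_eval v 1).trans noiseBit_one

theorem avoidsForbidden_of_forall (hG : IsFTCG G) (hXZ : Disjoint X Z)
    (hC : ¬ IsConnected (backdoorGraph G (X : Set (S × ℤ)) Y) (X : Set (S × ℤ)) Y Z)
    (h : ∀ (κ : Mechanisms G Ω) (P : Measure (∀ v, Ω v)), IsCompatible G κ P →
      ∀ (x : ∀ v : X, Ω v) (y : ∀ v : Y, Ω v), IsAdmissible P X Z x →
        doProb κ P X Y x y = adjustedProb P X Y Z x y) :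
    AvoidsForbidden G (X : Set (S × ℤ)) Y Z := by
  classical
  intro x hx w hxw hw z hz hwz
  obtain ⟨z', hz', hz'T⟩ := exists_mem_avoidingDesc hC hw hz hwz
  obtain ⟨hwX, y, hy, hyT⟩ := hw
  set M := causalModel hx hxw hwX with hM
  have hxT : x ∉ avoidingDesc G (X : Set (S × ℤ)) w := fun h => notMem_of_mem_avoidingDesc hwX h hx
  have hsolT : ∀ n, ∀ v ∈ avoidingDesc G (X : Set (S × ℤ)) w, M.sol n v = n x + n w :=
    fun n v hv => if_pos hv
  have hsolx : ∀ n, M.sol n x = n x := fun n => (if_neg hxT).trans (if_pos rfl)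
  have hsol0 : ∀ n, ∀ v, v ∉ avoidingDesc G (X : Set (S × ℤ)) w → v ≠ x → M.sol n v = 0 :=
    fun n v hv hvx => (if_neg hv).trans (if_neg hvx)
  have hadm : IsAdmissible (M.law Ω) X Z fun v => LinearModel.testValue Ω x v := by
    refine M.isAdmissible_law (F := {x, w}) (a := x) (fun n n' hn v => ?_) hsolx
      (fun n v hv hvx => hsol0 n v (fun h => notMem_of_mem_avoidingDesc hwX h hv) hvx)
      fun n v hv => ?_
    · change (if _ then _ else _) = (if _ then _ else _)
      rw [hn x (by simp), hn w (by simp)]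
    · by_cases hvT : v ∈ avoidingDesc G (X : Set (S × ℤ)) w
      · rw [hsolT _ _ hvT, hsolT _ _ hvT]
        simp only [Pi.add_apply, Pi.one_apply]
        have := CharTwo.add_self_eq_zero (1 : ZMod 2)
        linear_combination this
      · have hvx : v ≠ x := by
          rintro rfl
          exact Finset.disjoint_left.1 hXZ hx hv
        rw [hsol0 _ _ hvT hvx, hsol0 _ _ hvT hvx]
  have hform := doProb_singleton_eq hG (M.isCompatible hG)
    (fun y' => h _ _ (M.isCompatible hG) _ y' hadm) hy fun v => enc (Ω v) 1
  have hparx : M.par x = ∅ := dif_neg hxT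
  have hlhs := M.law_eq_mul_doProb (Ω := Ω) hG (X := X) (LinearModel.testValue Ω x)
    (fun v => enc (Ω v) 1) (A := insert x (avoidingDesc G (X : Set (S × ℤ)) w))
    (fun u v hu hv => by
      rcases hv with rfl | hv
      · rw [hparx] at hu
        exact absurd hu (Finset.notMem_empty _)
      · change u ∈ (if h : v ∈ avoidingDesc G (X : Set (S × ℤ)) w then _ else _) at hu
        rw [dif_pos hv] at hu
        split_ifs at hu with hne
        · rw [Finset.mem_singleton.1 hu]
          exact .inr (exists_parent_of_mem_avoidingDesc hv hne).choose_spec.1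
        · exact .inl (Finset.mem_singleton.1 hu))
    (x := x) (y := y) hx (.inl rfl)
    (fun v hv hvX => hv.resolve_right fun h => notMem_of_mem_avoidingDesc hwX h hvX) hparx
    (.inl rfl) (b := 1) (by simp [LinearModel.testValue]) (.inr hyT)
  have hrhs := M.adjustedProb_law (Y := {y}) (y := fun v => enc (Ω v) 1) hadm
    (D := (event {z'} fun v => enc (Ω v) 1)) (measurableSet_event _ _)
    (fun ω ω' hω => propext (forall_congr' fun u => by
      rw [hω u (by rw [Finset.mem_singleton.1 u.2]; exact hz')]))
    (fun n _ => by
      rw [M.config_mem_event_singleton rfl, M.config_mem_event_singleton rfl, hsolT n y hyT,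
        hsolT n z' hz'T])
  -- A union bound suffices: if `z'` is 1, then one of its two noise bits is 1.
  have hle : noise (S × ℤ) {n | M.config (Ω := Ω) n ∈ event {z'} fun v => enc (Ω v) 1}
      ≤ 1 / 4 + 1 / 4 := by
    rw [← noise_eval_one x]
    nth_rw 2 [noise_eval_one x]
    rw [← noise_eval_one w]
    refine (measure_mono fun n hn => ?_).trans (measure_union_le _ _)
    have hn := (M.config_mem_event_singleton rfl).1 hn
    rw [hsolT n z' hz'T] at hn
    revert hn
    change n x + n w = 1 → n x = 1 ∨ n w = 1
    generalize n x = a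
    generalize n w = b
    revert a b
    decide
  -- `x` and `y` are both 1 exactly if the bit of `x` is 1 and that of `w` is 0.
  have heq : M.law Ω ((event {x} fun v => LinearModel.testValue Ω x v) ∩
      event {y} fun v => enc (Ω v) 1) = 1 / 4 * (3 / 4) := by
    rw [M.law_apply ((measurableSet_event _ _).inter (measurableSet_event _ _)), ← noiseBit_one,
      ← noiseBit_zero, ← noise_eval_eval (u := x) (v := w) (fun he => hwX (he ▸ hx))]
    congr 1
    ext n
    simp only [Set.mem_ofPred_eq, Set.mem_inter_iff]
    rw [M.config_mem_event_singleton (b := 1) (by simp [LinearModel.testValue]),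
      M.config_mem_event_singleton rfl, hsolx, hsolT n y hyT]
    generalize n x = a
    generalize n w = b
    revert a b
    decide
  rw [heq, hform, hrhs, noiseBit_one] at hlhs
  -- The interventional probability is 3/4 and the adjusted one at most 1/2; the common factor 1/4
  -- need not be cancelled.
  have hcon : (1 / 4 * (3 / 4) : ℝ≥0∞) ≤ 1 / 4 * (1 / 4 + 1 / 4) := by
    rw [hlhs]
    gcongr
  rw [← ENNReal.toReal_le_toReal (by finiteness) (by finiteness)] at hcon
  rw [ENNReal.toReal_mul, ENNReal.toReal_mul, ENNReal.toReal_add (by finiteness) (by finiteness)]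
    at hcon
  norm_num [ENNReal.toReal_div] at hcon

theorem not_isConnected_of_forall (hG : IsFTCG G) (hXY : Disjoint X Y) (hXZ : Disjoint X Z)
    (hYZ : Disjoint Y Z)
    (h : ∀ (κ : Mechanisms G Ω) (P : Measure (∀ v, Ω v)), IsCompatible G κ P →
      ∀ (x : ∀ v : X, Ω v) (y : ∀ v : Y, Ω v), IsAdmissible P X Z x →
        doProb κ P X Y x y = adjustedProb P X Y Z x y) :
    ¬ IsConnected (backdoorGraph G (X : Set (S × ℤ)) Y) (X : Set (S × ℤ)) Y Z := by
  classical
  intro hC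
  have hXY' := Finset.disjoint_coe.2 hXY
  have hXZ' := Finset.disjoint_coe.2 hXZ
  have hYZ' := Finset.disjoint_coe.2 hYZ
  obtain ⟨k, t, s, c⟩ := hC.exists_isShortestChain
  set M := c.linearModel backdoorGraph_le hXY' hXZ' hYZ' with hM
  have hsol0 : ∀ n, M.sol n (t 0) = n (s 0) := c.sol_zero _ _ _ _
  have hsolk : ∀ n, M.sol n (t (k + 1)) = n (s k) := c.sol_last _ _ _ _
  have hsum : ∀ n, M.sol n (t 0) = M.sol n (t (k + 1))
      + ∑ j ∈ Finset.range k, M.sol n (t (j + 1)) := c.sol_zero_eq _ _ _ _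
  have hadm : IsAdmissible (M.law Ω) X Z fun v => LinearModel.testValue Ω (t (k + 1)) v := by
    refine M.isAdmissible_law (F := (Finset.range (k + 1)).image s) (a := s k)
      (fun n n' hn v => ?_) hsolk (fun n v hv hvx => c.sol_eq_zero_of_mem _ _ _ _ n hv hvx)
      fun n v hv => c.sol_add_one _ _ _ _ n hv
    refine Finset.sum_congr (s₁ := Finset.range (k + 1)) rfl fun i hi => ?_
    rw [hn (s i) (Finset.mem_image_of_mem s hi)]
  have hy : t 0 ∈ Y := c.zero_mem
  have hform := doProb_singleton_eq hG (M.isCompatible hG)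
    (fun y' => h _ _ (M.isCompatible hG) _ y' hadm) hy fun v => enc (Ω v) 1
  have hs0 := c.source_left 0 (Nat.zero_le k)
  -- The leg from `s 0` to `t 0` contains all that determines `t 0`, and it avoids `X` because it
  -- leads to `Y` in the back-door graph.
  have hlhs := M.doProb_eq_of_disjoint (Ω := Ω) hG (X := X) (LinearModel.testValue Ω (t (k + 1)))
    (fun v => enc (Ω v) 1)
    (fun u v hu hv => c.mem_leg_of_mem_par _ hXY' hXZ' hYZ' hu hv)
    (fun v hv => (isCausalNode_of_isDescendant_backdoorGraph hXY' hy
      (ReflTransGen.mono (fun _ _ h => h.1) _ _ (reflTransGen_of_mem_leg hs0.2 hv).2)).1)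
    (right_mem_leg hs0.2)
  have hlaw : M.law Ω (event {t 0} fun v => enc (Ω v) 1) = 1 / 4 := by
    rw [M.law_apply (measurableSet_event _ _), ← noise_eval_one (s 0)]
    congr 1
    ext n
    simp only [Set.mem_ofPred_eq]
    rw [M.config_mem_event_singleton rfl, hsol0]
  have hdec : Measurable fun ω : ∀ v, Ω v =>
      ∑ j ∈ Finset.range k, dec (Ω (t (j + 1))) (ω (t (j + 1))) :=
    Finset.measurable_fun_sum _ fun j _ =>
      (Measurable.of_discrete (f := dec (Ω (t (j + 1))))).comp (measurable_pi_apply (t (j + 1)))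
  have hconf : ∀ n, ∑ j ∈ Finset.range k,
      dec (Ω (t (j + 1))) (M.config n (t (j + 1))) = n (s 0) + n (s k) := by
    intro n
    simp only [LinearModel.config, dec_enc]
    have h1 := hsum n
    rw [hsol0, hsolk] at h1
    have h2 := CharTwo.add_self_eq_zero (n (s k))
    linear_combination -h1 - h2
  have hrhs := M.adjustedProb_law (Y := {t 0}) (y := fun v => enc (Ω v) 1) hadm
    (D := {ω | ∑ j ∈ Finset.range k, dec (Ω (t (j + 1))) (ω (t (j + 1))) = 0})
    (hdec (measurableSet_singleton 0))
    (fun ω ω' hω => by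
      simp only [Set.mem_ofPred_eq]
      rw [Finset.sum_congr rfl fun j hj => by
        rw [hω (t (j + 1)) (c.mem (j + 1) (by omega) (Finset.mem_range.1 hj))]])
    (fun n hn => by
      have h1 := hn ⟨t (k + 1), c.last_mem⟩
      simp only [LinearModel.config, LinearModel.testValue, if_true, enc_injective.eq_iff,
        hsolk] at h1
      rw [M.config_mem_event_singleton rfl, Set.mem_ofPred_eq, hconf, hsol0, h1]
      generalize n (s 0) = a
      revert a
      decide)
  rw [hlhs, hlaw, hrhs] at hform
  -- The elements of `Z` sum to 0 unless one of the bits at `s 0` and `s k` is 1. With the formula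
  -- this gives 1 ≤ 1/4 + 1/4 + 1/4. The case `k = 0` is included.
  have hcov : (Set.univ : Set (S × ℤ → ZMod 2)) ⊆ ({n | M.config (Ω := Ω) n ∈
      {ω | ∑ j ∈ Finset.range k, dec (Ω (t (j + 1))) (ω (t (j + 1))) = 0}} ∪
        ({n | n (s 0) = 1} ∪ {n | n (s k) = 1})) := by
    intro n _
    simp only [Set.mem_union, Set.mem_ofPred_eq, hconf]
    generalize n (s 0) = a
    generalize n (s k) = b
    revert a b
    decide
  have hone := (measure_mono hcov).trans ((measure_union_le (μ := noise (S × ℤ)) _ _).trans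
    (add_le_add_right (measure_union_le (μ := noise (S × ℤ)) _ _) _))
  rw [measure_univ, ← hform, noise_eval_one, noise_eval_one] at hone
  rw [← ENNReal.toReal_le_toReal (by finiteness) (by finiteness),
    ENNReal.toReal_add (by finiteness) (by finiteness),
    ENNReal.toReal_add (by finiteness) (by finiteness)] at hone
  norm_num [ENNReal.toReal_div] at hone

end Necessity

end SCGAdjustment

open SCGAdjustment MeasureTheory in
theorem mainTheorem2 {S : Type*} [Fintype S] [DecidableEq S]
    (Ω : S × ℤ → Type*) [∀ v, MeasurableSpace (Ω v)] [∀ v, DiscreteMeasurableSpace (Ω v)]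
    [∀ v, Countable (Ω v)] [∀ v, Nontrivial (Ω v)]
    (Gs : Digraph S) (X Y Z : Finset (S × ℤ))
    (hXY : Disjoint X Y) (hXZ : Disjoint X Z) (hYZ : Disjoint Y Z) :
    CommonAdjustmentCriterion Gs (X : Set (S × ℤ)) (Y : Set (S × ℤ)) (Z : Set (S × ℤ)) ↔
      ∀ Gf ∈ candidates Gs, ∀ (κ : Mechanisms Gf Ω) (P : Measure (∀ v, Ω v)),
        IsCompatible Gf κ P →
          ∀ (x : ∀ v : X, Ω v) (y : ∀ v : Y, Ω v), IsAdmissible P X Z x →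
            doProb κ P X Y x y = adjustedProb P X Y Z x y := by
  have hXY' := Finset.disjoint_coe.2 hXY
  have hXZ' := Finset.disjoint_coe.2 hXZ
  have hYZ' := Finset.disjoint_coe.2 hYZ
  constructor
  · intro h Gf hGf κ P hP x y hx
    have hG := hGf.1.acyclic
    exact doProb_eq_adjustedProb hGf.1 hP hXY hYZ
      (avoidsForbidden_of_forbidden_inter_eq_empty hG (h Gf hGf).1)
      (not_isConnected_of_adjustmentCriterion hG hXY' hXZ' hYZ' (h Gf hGf)) x y hx
  · intro h Gf hGf
    -- Separation comes first: it is needed to find an element of `Z` that is reached without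
    -- passing through `X`.
    have hC := not_isConnected_of_forall hGf.1 hXY hXZ hYZ (h Gf hGf)
    exact adjustmentCriterion_of_not_isConnected hGf.1.acyclic hXY' hXZ' hYZ'
      (avoidsForbidden_of_forall hGf.1 hXZ hC (h Gf hGf)) hC
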